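/- In this statement a $\mathbb{Q}$-algebra is a commutative ring $E$ whose additive group is a finite-dimensional vector space over $\mathbb{Q}$. An element $\alpha\in E$ is called separable if $f(\alpha)=0$ for some $f\in\mathbb{Q}[X]$ that is coprime to its derivative $f'$. Write $E_{\mathrm{sep}}$ for the set of separable elements of $E$, which is a $\mathbb{Q}$-subalgebra, and $\sqrt{0}$ for the nilradical of $E$, i.e. the ideal of nilpotent elements. The map $E_{\mathrm{sep}}\oplus\sqrt{0}\to E$, $(u,v)\mapsto u+v$, is an isomorphism of $\mathbb{Q}$-vector spaces. In algorithms, $E$ is specified by $n=\dim_{\mathbb{Q}}E$ and the rational structure constants $(a_{ijk})_{1\le i,j,k\le n}$ with respect to some $\mathbb{Q}$-basis $e_1,\dots,e_n$ of $E$, so $e_ie_j=\sum_{k=1}^n a_{ijk}e_k$. Elements of $E$ are represented by their coordinate vectors on $e_1,\dots,e_n$, subspaces by $\mathbb{Q}$-bases, and rational numbers by numerator and denominator. Running time is measured in bit operations, as a function of the bit length of the input. **Theorem.** There is a deterministic polynomial-time algorithm that, given a $\mathbb{Q}$-algebra $E$, computes a $\mathbb{Q}$-basis of $E_{\mathrm{sep}}$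 and a $\mathbb{Q}$-basis of $\sqrt{0}$, as well as the matrix of the isomorphism $E_{\mathrm{sep}}\oplus\sqrt{0}\to E$, $(u,v)\mapsto u+v$, with respect to these two bases and $e_1,\dots,e_n$, and the matrix of the inverse isomorphism $E\to E_{\mathrm{sep}}\oplus\sqrt{0}$. -/

import Mathlib

/-! ### Random access machines with logarithmic cost

A random access machine with integer registers and integer memory banks.  A program is a finite
object and so names only finitely many registers and banks; a bank has one cell for every
integer address and is accessed by indirect addressing.  The input is read from a one-way input
tape of integers, the output is written to a one-way output tape of integers.  Time is measured
by the logarithmic cost criterion: every operation is charged the number of bits of all integers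
(addresses, operands, results) that it handles. -/

namespace RAM

/-- The bit length of an integer (one bit for the sign). -/
def bits (z : ℤ) : ℕ := Nat.size z.natAbs + 1

/-- The bit length of a list of integers. -/
def bitLength (w : List ℤ) : ℕ := (w.map bits).sum

/-- Configurations of the machine: registers, memory banks, the unread part of the input, and the
output written so far. -/
structure State where
  reg : ℕ → ℤ
  bank : ℕ → ℤ → ℤ
  inp : List ℤ
  out : List ℤ

/-- The initial configuration on input `w`: all registers and all memory cells are zero. -/
def State.init (w : List ℤ) : State where
  reg := fun _ => 0
  bank := fun _ _ => 0
  inp := w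
  out := []

/-- Integer expressions: constants, registers, the memory cell of bank `a` at a computed address,
sum, difference, product, and quotient with (Euclidean) remainder discarded. -/
inductive Expr where
  | const (z : ℤ)
  | reg (x : ℕ)
  | cell (a : ℕ) (address : Expr)
  | add (e₁ e₂ : Expr)
  | sub (e₁ e₂ : Expr)
  | mul (e₁ e₂ : Expr)
  | quot (e₁ e₂ : Expr)

/-- The value of an expression. -/
def Expr.eval (s : State) : Expr → ℤ
  | .const z => z
  | .reg x => s.reg x
  | .cell a i => s.bank a (i.eval s)
  | .add e₁ e₂ => e₁.eval s + e₂.eval s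
  | .sub e₁ e₂ => e₁.eval s - e₂.eval s
  | .mul e₁ e₂ => e₁.eval s * e₂.eval s
  | .quot e₁ e₂ => e₁.eval s / e₂.eval s

/-- The cost of evaluating an expression: the total bit length of the values of all its
subexpressions. -/
def Expr.cost (s : State) : Expr → ℕ
  | .const z => bits z
  | .reg x => bits (s.reg x)
  | .cell a i => i.cost s + bits (s.bank a (i.eval s))
  | .add e₁ e₂ => e₁.cost s + e₂.cost s + bits (e₁.eval s + e₂.eval s)
  | .sub e₁ e₂ => e₁.cost s + e₂.cost s + bits (e₁.eval s - e₂.eval s)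
  | .mul e₁ e₂ => e₁.cost s + e₂.cost s + bits (e₁.eval s * e₂.eval s)
  | .quot e₁ e₂ => e₁.cost s + e₂.cost s + bits (e₁.eval s / e₂.eval s)

/-- Programs. -/
inductive Prog where
  | skip
  /-- `x := e` -/
  | assign (x : ℕ) (e : Expr)
  /-- write the value of `e` into bank `a` at the given address -/
  | store (a : ℕ) (address e : Expr)
  /-- move the next integer of the input tape to register `x` (`0` at the end of the tape) -/
  | read (x : ℕ)
  /-- append the value of `e` to the output tape -/
  | write (e : Expr)
  | seq (P Q : Prog)
  /-- if `e > 0` then `P` else `Q` -/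
  | ifPos (e : Expr) (P Q : Prog)
  /-- while `e > 0` do `P` -/
  | whilePos (e : Expr) (P : Prog)

/-- `P.Exec s c s'`: started in configuration `s`, the program `P` halts in configuration `s'`, and
the cost of the whole run is `c`. -/
inductive Prog.Exec : Prog → State → ℕ → State → Prop
  | skip (s : State) : Exec .skip s 1 s
  | assign (x : ℕ) (e : Expr) (s : State) :
      Exec (.assign x e) s (e.cost s + 1) { s with reg := Function.update s.reg x (e.eval s) }
  | store (a : ℕ) (i e : Expr) (s : State) :
      Exec (.store a i e) s (i.cost s + e.cost s + 1)
        { s with bank := Function.update s.bank a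
                          (Function.update (s.bank a) (i.eval s) (e.eval s)) }
  | read (x : ℕ) (s : State) :
      Exec (.read x) s (bits (s.inp.headD 0) + 1)
        { s with reg := Function.update s.reg x (s.inp.headD 0), inp := s.inp.tail }
  | write (e : Expr) (s : State) :
      Exec (.write e) s (e.cost s + 1) { s with out := s.out ++ [e.eval s] }
  | seq (P Q : Prog) (s s' s'' : State) (c c' : ℕ) :
      Exec P s c s' → Exec Q s' c' s'' → Exec (.seq P Q) s (c + c' + 1) s''
  | ifPos_true (e : Expr) (P Q : Prog) (s s' : State) (c : ℕ) :
      0 < e.eval s → Exec P s c s' → Exec (.ifPos e P Q) s (e.cost s + c + 1) s'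
  | ifPos_false (e : Expr) (P Q : Prog) (s s' : State) (c : ℕ) :
      ¬ 0 < e.eval s → Exec Q s c s' → Exec (.ifPos e P Q) s (e.cost s + c + 1) s'
  | whilePos_true (e : Expr) (P : Prog) (s s' s'' : State) (c c' : ℕ) :
      0 < e.eval s → Exec P s c s' → Exec (.whilePos e P) s' c' s'' →
        Exec (.whilePos e P) s (e.cost s + c + c' + 1) s''
  | whilePos_false (e : Expr) (P : Prog) (s : State) :
      ¬ 0 < e.eval s → Exec (.whilePos e P) s (e.cost s + 1) s

/-- The machine is deterministic: the starting configuration determines the final configuration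
and the cost. -/
theorem Prog.Exec.deterministic {P : Prog} {s s₁ s₂ : State} {c₁ c₂ : ℕ}
    (h₁ : P.Exec s c₁ s₁) (h₂ : P.Exec s c₂ s₂) : c₁ = c₂ ∧ s₁ = s₂ := by
  induction h₁ generalizing c₂ s₂ with
  | skip | assign | store | read | write => cases h₂; exact ⟨rfl, rfl⟩
  | seq P Q s s' s'' c c' _ _ ih ih' =>
    cases h₂ with
    | seq _ _ _ _ _ _ _ a b =>
      obtain ⟨rfl, rfl⟩ := ih a
      obtain ⟨rfl, rfl⟩ := ih' b
      exact ⟨rfl, rfl⟩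
  | ifPos_true e P Q s s' c h _ ih =>
    cases h₂ with
    | ifPos_true _ _ _ _ _ _ _ a => obtain ⟨rfl, rfl⟩ := ih a; exact ⟨rfl, rfl⟩
    | ifPos_false _ _ _ _ _ _ h' _ => exact absurd h h'
  | ifPos_false e P Q s s' c h _ ih =>
    cases h₂ with
    | ifPos_true _ _ _ _ _ _ h' _ => exact absurd h' h
    | ifPos_false _ _ _ _ _ _ _ a => obtain ⟨rfl, rfl⟩ := ih a; exact ⟨rfl, rfl⟩
  | whilePos_true e P s s' s'' c c' h _ _ ih ih' =>
    cases h₂ with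
    | whilePos_true _ _ _ _ _ _ _ _ a b =>
      obtain ⟨rfl, rfl⟩ := ih a
      obtain ⟨rfl, rfl⟩ := ih' b
      exact ⟨rfl, rfl⟩
    | whilePos_false _ _ _ h' => exact absurd h h'
  | whilePos_false e P s h =>
    cases h₂ with
    | whilePos_true _ _ _ _ _ _ _ h' _ _ => exact absurd h' h
    | whilePos_false _ _ _ _ => exact ⟨rfl, rfl⟩

/-- On input `w` the program `P` halts with output `v`, in time at most `t`. -/
def Prog.OutputsInTime (P : Prog) (w v : List ℤ) (t : ℕ) : Prop :=
  ∃ (c : ℕ) (s : State), P.Exec (State.init w) c s ∧ s.out = v ∧ c ≤ t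

end RAM

namespace QAlg

/-! ### Encodings -/

/-- A rational number is written as its numerator and its (positive) denominator, in lowest
terms. -/
def encodeRat (q : ℚ) : List ℤ := [q.num, (q.den : ℤ)]

/-- A rational matrix is written row by row, for given orderings of its row and column indices. -/
def encodeMatrix {ι κ : Type} (rows : List ι) (cols : List κ) (M : Matrix ι κ ℚ) : List ℤ :=
  rows.flatMap fun i => cols.flatMap fun j => encodeRat (M i j)

/-- The structure constants of an algebra with respect to a basis:
`b i * b j = ∑ k, structureConstants b i j k • b k`. -/
noncomputable def structureConstants {n : ℕ} {E : Type*} [CommRing E] [Algebra ℚ E]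
    (b : Module.Basis (Fin n) ℚ E) (i j k : Fin n) : ℚ :=
  b.repr (b i * b j) k

/-- A `ℚ`-algebra with a given basis is written as its dimension followed by its structure
constants. -/
noncomputable def encodeAlgebra {n : ℕ} {E : Type*} [CommRing E] [Algebra ℚ E]
    (b : Module.Basis (Fin n) ℚ E) : List ℤ :=
  (n : ℤ) :: (List.finRange n).flatMap fun i =>
    encodeMatrix (List.finRange n) (List.finRange n) (structureConstants b i)

/-- The data to be computed for an algebra of dimension `n`: two lists of coordinate vectors, of
lengths `m` and `l` (the rows of `U` and `V`), and two matrices. -/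
structure SplittingData (n : ℕ) where
  m : ℕ
  l : ℕ
  U : Matrix (Fin m) (Fin n) ℚ
  V : Matrix (Fin l) (Fin n) ℚ
  A : Matrix (Fin n) (Fin m ⊕ Fin l) ℚ
  B : Matrix (Fin m ⊕ Fin l) (Fin n) ℚ

/-- The output list of integers that stands for given splitting data. -/
def SplittingData.encode {n : ℕ} (D : SplittingData n) : List ℤ :=
  let ns := List.finRange n
  let ms := List.finRange D.m
  let ls := List.finRange D.l
  let sums : List (Fin D.m ⊕ Fin D.l) := ms.map Sum.inl ++ ls.map Sum.inr
  (D.m : ℤ) :: (D.l : ℤ) :: (encodeMatrix ms ns D.U ++ encodeMatrix ls ns D.V ++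
    encodeMatrix ns sums D.A ++ encodeMatrix sums ns D.B)

/-! ### The decomposition -/

/-- An element of a `ℚ`-algebra is separable if it is a zero of a separable polynomial, that is, of
a polynomial over `ℚ` that is coprime to its derivative. -/
def IsSeparableElement {E : Type*} [CommRing E] [Algebra ℚ E] (α : E) : Prop :=
  ∃ f : Polynomial ℚ, f.Separable ∧ Polynomial.aeval α f = 0

/-- `D` is a correct output for the algebra `E` with basis `b`.  Here `S` is the subalgebra of all
separable elements, `N` is the nilradical (as a `ℚ`-vector space), and `φ` is the isomorphism
`S ⊕ N → E`, `(u, v) ↦ u + v`.  The rows of `D.U` and `D.V` are the coordinate vectors, with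
respect to `b`, of a basis `bS` of `S` and of a basis `bN` of `N`; and `D.A` and `D.B` are the
matrices of `φ` and of its inverse with respect to the bases `bS`, `bN` and `b`. -/
def SplittingData.IsCorrect {n : ℕ} {E : Type*} [CommRing E] [Algebra ℚ E]
    (D : SplittingData n) (b : Module.Basis (Fin n) ℚ E) : Prop :=
  ∃ (S : Subalgebra ℚ E) (N : Submodule ℚ E)
    (bS : Module.Basis (Fin D.m) ℚ S) (bN : Module.Basis (Fin D.l) ℚ N)
    (φ : (S × N) ≃ₗ[ℚ] E),
    (S : Set E) = {α : E | IsSeparableElement α} ∧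
    N = (nilradical E).restrictScalars ℚ ∧
    (∀ (u : S) (v : N), φ (u, v) = (u : E) + (v : E)) ∧
    (∀ i j, D.U i j = b.repr (bS i : E) j) ∧
    (∀ i j, D.V i j = b.repr (bN i : E) j) ∧
    D.A = LinearMap.toMatrix (bS.prod bN) b φ.toLinearMap ∧
    D.B = LinearMap.toMatrix b (bS.prod bN) φ.symm.toLinearMap

end QAlg

/-!
Let `T i` be the matrix of multiplication by `δ (e i) = e i ⊗ 1 - 1 ⊗ e i` on `E ⊗ E`, and write its
characteristic polynomial as `X ^ m * q i` with `q i 0 ≠ 0`. The element `z = ∏ i, q i (δ (e i))` of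
`E ⊗ E` cuts out the part on which all `δ (e i)` are nilpotent, and an element `x` of `E` is
separable if and only if `z * δ x = 0`
(`QAlg.isSeparableElement_iff_prod_mul_diagonalDiff_eq_zero`). Indeed `z` is a unit multiple of an
idempotent `ε`, and `z * δ x` is always nilpotent. If `x` is separable then so are `δ x` and
`ε * δ x`, and the latter, being also nilpotent, vanishes. Conversely, if `π` is the projection of
`E` to its separable part, an algebra homomorphism with nilpotent `x - π x`, then `x ⊗ y ↦ x * π y`
sends `z` to a unit and `δ x` to `x - π x`. So the coordinates of the separable elements are the
solutions of a homogeneous linear system. The same holds for the nilpotent elements: they form the kernel of the trace form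
(`QAlg.isNilpotent_iff_trace_mul_eq_zero`). That the two subspaces are complementary is the
Jordan–Chevalley decomposition of the multiplication maps.

All the linear algebra is reduced to one integral procedure, the Faddeev–LeVerrier recursion, whose
intermediate results are the matrices `T.tailCharpoly j` with entries of polynomially bounded length
(`Matrix.abs_tailCharpoly_apply_le`). It yields `q i (T i)`; applied to a Gram matrix it yields a
matrix whose columns span a kernel (`Matrix.span_col_tailCharpoly_gram`) as well as the rank
(`Matrix.card_sub_natTrailingDegree_charpoly_gram`), so that a basis can be picked greedily from
these columns; and applied to an invertible matrix it yields the inverse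
(`Matrix.mul_tailCharpoly_one`). The structure constants are made integral by multiplying them with
the product of their denominators, which amounts to scaling the basis and so changes neither of the
two spaces of coordinate vectors.

The running time is controlled by a single number `β`, a polynomial in the length of the input. If
all integers that occur have at most `β` bits and every loop is run at most `β` times, a program
with loops nested to depth `d` costs at most a constant times `β ^ (d + 1)`; `RAM.Prog.Runs` and its
rules carry this bound along with the correctness of the programs. The output `QAlg.splittingData`
is correct by `QAlg.splittingData_isCorrect`, and the run is assembled in
`QAlg.computeSplitting_runs`.

The registers are used as follows: `0` to `3` are scratch registers of `RAM.tabulate`, `4` holds the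
dimension, `5` to `9` belong to the Faddeev–LeVerrier recursion, `10` and `17` count the outer
loops, `11` holds the common denominator, `12` the number of basis vectors found so far, `13` the
dimension of the separable part, and `14` to `16` serve Euclid's algorithm.
-/

/-! ### Resource-bounded runs of programs -/

namespace RAM

theorem one_le_bits (z : ℤ) : 1 ≤ bits z := Nat.le_add_left 1 _

theorem bits_le_succ_iff {z : ℤ} {n : ℕ} : bits z ≤ n + 1 ↔ z.natAbs < 2 ^ n := by
  rw [bits, Nat.add_le_add_iff_right, Nat.size_le]

theorem bits_le_of_natAbs_le {y z : ℤ} (h : y.natAbs ≤ z.natAbs) : bits y ≤ bits z :=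
  Nat.add_le_add_right (Nat.size_le_size h) 1

theorem natAbs_lt_two_pow_bits (z : ℤ) : z.natAbs < 2 ^ (bits z - 1) := by
  simpa [bits] using Nat.lt_size_self z.natAbs

theorem bits_add_le (y z : ℤ) : bits (y + z) ≤ bits y + bits z := by
  obtain ⟨a, ha⟩ := Nat.exists_eq_add_of_le' (one_le_bits y)
  obtain ⟨b, hb⟩ := Nat.exists_eq_add_of_le' (one_le_bits z)
  have hy := natAbs_lt_two_pow_bits y
  have hz := natAbs_lt_two_pow_bits z
  rw [ha, Nat.add_sub_cancel] at hy
  rw [hb, Nat.add_sub_cancel] at hz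
  rw [ha, hb, show a + 1 + (b + 1) = (a + b + 1) + 1 by ring, bits_le_succ_iff]
  have h1 : 2 ^ a ≤ 2 ^ (a + b) := Nat.pow_le_pow_right two_pos (by lia)
  have h2 : 2 ^ b ≤ 2 ^ (a + b) := Nat.pow_le_pow_right two_pos (by lia)
  have := Int.natAbs_add_le y z
  rw [pow_succ]
  lia

theorem bits_neg (z : ℤ) : bits (-z) = bits z := by simp [bits]

theorem bits_sub_le (y z : ℤ) : bits (y - z) ≤ bits y + bits z := by
  simpa [sub_eq_add_neg, bits_neg] using bits_add_le y (-z)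

theorem bits_mul_le (y z : ℤ) : bits (y * z) ≤ bits y + bits z := by
  obtain ⟨a, ha⟩ := Nat.exists_eq_add_of_le' (one_le_bits y)
  obtain ⟨b, hb⟩ := Nat.exists_eq_add_of_le' (one_le_bits z)
  have hy := natAbs_lt_two_pow_bits y
  have hz := natAbs_lt_two_pow_bits z
  rw [ha, Nat.add_sub_cancel] at hy
  rw [hb, Nat.add_sub_cancel] at hz
  rw [ha, hb, show a + 1 + (b + 1) = (a + b + 1) + 1 by ring, bits_le_succ_iff, Int.natAbs_mul]
  calc _ < 2 ^ a * 2 ^ b := Nat.mul_lt_mul'' hy hz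
    _ ≤ _ := by rw [← pow_add]; exact Nat.pow_le_pow_right two_pos (by lia)

theorem bits_ediv_le (y z : ℤ) : bits (y / z) ≤ bits y :=
  bits_le_of_natAbs_le (Int.natAbs_ediv_le_natAbs y z)

theorem bits_natCast_le {m β : ℕ} (h : m ≤ β) (hβ : 3 ≤ β) : bits (m : ℤ) ≤ β := by
  obtain ⟨b, rfl⟩ := Nat.exists_eq_add_of_le' hβ
  rw [show b + 3 = (b + 2) + 1 by ring, bits_le_succ_iff, Int.natAbs_natCast]
  have : b < 2 ^ b := Nat.lt_two_pow_self
  rw [pow_add]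
  lia

/-- Every integer in the registers, in the memory and on the input tape has at most `β` bits.  The
lower bound on `β` gives room for the loop counters. -/
structure State.Bdd (β : ℕ) (s : State) : Prop where
  le : 3 ≤ β
  reg : ∀ x, bits (s.reg x) ≤ β
  bank : ∀ a i, bits (s.bank a i) ≤ β
  inp : ∀ z ∈ s.inp, bits z ≤ β

/-- The state with a new value in one register. -/
def State.setReg (s : State) (x : ℕ) (z : ℤ) : State :=
  { s with reg := Function.update s.reg x z }

/-- The state with a new value in one memory cell. -/
def State.setCell (s : State) (a : ℕ) (i z : ℤ) : State :=
  { s with bank := Function.update s.bank a (Function.update (s.bank a) i z) }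

section
variable (s : State) (x a : ℕ) (i z : ℤ)

@[simp] theorem State.setReg_reg_self : (s.setReg x z).reg x = z := by simp [State.setReg]

theorem State.setReg_reg (y : ℕ) : (s.setReg x z).reg y = if y = x then z else s.reg y := by
  simp [State.setReg, Function.update_apply]

@[simp] theorem State.setReg_reg_of_ne {y : ℕ} (h : y ≠ x) : (s.setReg x z).reg y = s.reg y := by
  simp [State.setReg, h]

@[simp] theorem State.setReg_bank : (s.setReg x z).bank = s.bank := rfl
@[simp] theorem State.setReg_inp : (s.setReg x z).inp = s.inp := rfl

@[simp] theorem State.setCell_reg : (s.setCell a i z).reg = s.reg := rfl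

theorem State.setCell_bank (j : ℤ) :
    (s.setCell a i z).bank a j = if j = i then z else s.bank a j := by
  simp [State.setCell, Function.update_apply]

@[simp] theorem State.setCell_bank_of_ne {b : ℕ} (h : b ≠ a) :
    (s.setCell a i z).bank b = s.bank b := by
  simp [State.setCell, h]

end

theorem State.Bdd.setReg {β : ℕ} {s : State} (h : s.Bdd β) {x : ℕ} {z : ℤ} (hz : bits z ≤ β) :
    (s.setReg x z).Bdd β where
  le := h.le
  reg y := by
    rw [State.setReg_reg]
    split_ifs
    exacts [hz, h.reg y]
  bank := h.bank
  inp := h.inp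

theorem State.Bdd.setCell {β : ℕ} {s : State} (h : s.Bdd β) {a : ℕ} {i z : ℤ} (hz : bits z ≤ β) :
    (s.setCell a i z).Bdd β where
  le := h.le
  reg := h.reg
  bank b j := by
    rcases eq_or_ne b a with rfl | hb
    · rw [State.setCell_bank]
      split_ifs
      exacts [hz, h.bank _ j]
    · rw [State.setCell_bank_of_ne _ _ _ _ hb]
      exact h.bank b j
  inp := h.inp

/-- The value of an expression has at most `deg e * β` bits in a state bounded by `β`. -/
def Expr.deg : Expr → ℕ
  | .const z => bits z
  | .reg _ => 1
  | .cell _ _ => 1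
  | .add e₁ e₂ => e₁.deg + e₂.deg
  | .sub e₁ e₂ => e₁.deg + e₂.deg
  | .mul e₁ e₂ => e₁.deg + e₂.deg
  | .quot e₁ e₂ => e₁.deg + e₂.deg

/-- The evaluation of an expression costs at most `weight e * β` in a state bounded by `β`. -/
def Expr.weight : Expr → ℕ
  | .const z => bits z
  | .reg _ => 1
  | .cell _ i => i.weight + 1
  | .add e₁ e₂ => e₁.weight + e₂.weight + (e₁.deg + e₂.deg)
  | .sub e₁ e₂ => e₁.weight + e₂.weight + (e₁.deg + e₂.deg)
  | .mul e₁ e₂ => e₁.weight + e₂.weight + (e₁.deg + e₂.deg)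
  | .quot e₁ e₂ => e₁.weight + e₂.weight + (e₁.deg + e₂.deg)

theorem Expr.bits_eval_le {β : ℕ} {s : State} (h : s.Bdd β) (e : Expr) :
    bits (e.eval s) ≤ e.deg * β := by
  have hβ := h.le
  induction e with
  | const z => exact Nat.le_mul_of_pos_right _ (by lia)
  | reg x => simpa [Expr.deg, Expr.eval] using h.reg x
  | cell a i => simpa [Expr.deg, Expr.eval] using h.bank a _
  | add e₁ e₂ h₁ h₂ =>
    rw [Expr.deg, add_mul]
    exact (bits_add_le _ _).trans (Nat.add_le_add h₁ h₂)
  | sub e₁ e₂ h₁ h₂ =>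
    rw [Expr.deg, add_mul]
    exact (bits_sub_le _ _).trans (Nat.add_le_add h₁ h₂)
  | mul e₁ e₂ h₁ h₂ =>
    rw [Expr.deg, add_mul]
    exact (bits_mul_le _ _).trans (Nat.add_le_add h₁ h₂)
  | quot e₁ e₂ h₁ h₂ =>
    rw [Expr.deg, add_mul]
    exact (bits_ediv_le _ _).trans (h₁.trans (Nat.le_add_right _ _))

theorem Expr.cost_le {β : ℕ} {s : State} (h : s.Bdd β) (e : Expr) :
    e.cost s ≤ e.weight * β := by
  have hβ := h.le
  induction e with
  | const z => exact Nat.le_mul_of_pos_right _ (by lia)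
  | reg x => simpa [Expr.weight, Expr.cost] using h.reg x
  | cell a i hi =>
    have := h.bank a (i.eval s)
    simp only [Expr.weight, Expr.cost, add_mul]
    lia
  | add e₁ e₂ h₁ h₂ =>
    have := Expr.bits_eval_le h (.add e₁ e₂)
    simp only [Expr.weight, Expr.cost, Expr.deg, Expr.eval, add_mul] at *
    lia
  | sub e₁ e₂ h₁ h₂ =>
    have := Expr.bits_eval_le h (.sub e₁ e₂)
    simp only [Expr.weight, Expr.cost, Expr.deg, Expr.eval, add_mul] at *
    lia
  | mul e₁ e₂ h₁ h₂ =>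
    have := Expr.bits_eval_le h (.mul e₁ e₂)
    simp only [Expr.weight, Expr.cost, Expr.deg, Expr.eval, add_mul] at *
    lia
  | quot e₁ e₂ h₁ h₂ =>
    have := Expr.bits_eval_le h (.quot e₁ e₂)
    simp only [Expr.weight, Expr.cost, Expr.deg, Expr.eval, add_mul] at *
    lia

/-- The constant in the time bounds for a program: a program in which loops are nested to depth `d`,
are run at most `β` times, and handle integers of at most `β` bits, costs at most
`weight * β ^ (d + 1)`. -/
def Prog.weight : Prog → ℕ
  | .skip => 1
  | .assign _ e => e.weight + 1
  | .store _ i e => i.weight + e.weight + 1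
  | .read _ => 2
  | .write e => e.weight + 1
  | .seq P Q => P.weight + Q.weight + 1
  | .ifPos e P Q => e.weight + 1 + P.weight + Q.weight
  | .whilePos e P => P.weight + 2 * e.weight + 4

/-- Started in `s`, the program `P` halts within time `P.weight * β ^ d` in a state satisfying
`Q`. -/
def Prog.Runs (β : ℕ) (P : Prog) (s : State) (d : ℕ) (Q : State → Prop) : Prop :=
  ∃ c s', P.Exec s c s' ∧ c ≤ P.weight * β ^ d ∧ Q s'

namespace Prog.Runs

variable {β : ℕ} {P P' : Prog} {s : State} {d d' m : ℕ} {Q Q' : State → Prop}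

theorem mono (h : P.Runs β s d Q) (hQ : ∀ s', Q s' → Q' s') : P.Runs β s d Q' := by
  obtain ⟨c, s', h₁, h₂, h₃⟩ := h
  exact ⟨c, s', h₁, h₂, hQ s' h₃⟩

theorem weaken (h : P.Runs β s d Q) (hs : s.Bdd β) (hd : d ≤ d') : P.Runs β s d' Q := by
  obtain ⟨c, s', h₁, h₂, h₃⟩ := h
  have hβ := hs.le
  exact ⟨c, s', h₁, h₂.trans (Nat.mul_le_mul_left _ (Nat.pow_le_pow_right (by lia) hd)), h₃⟩

theorem skip (hs : s.Bdd β) (hQ : Q s) : Prog.skip.Runs β s d Q := by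
  have hβ := hs.le
  exact ⟨1, s, .skip s, by simpa [weight] using Nat.one_le_pow _ _ (by lia), hQ⟩

theorem seq (hs : s.Bdd β) (h : P.Runs β s d Q') (h' : ∀ s', Q' s' → P'.Runs β s' d Q) :
    (Prog.seq P P').Runs β s d Q := by
  obtain ⟨c, s', h₁, h₂, h₃⟩ := h
  obtain ⟨c', s'', h₁', h₂', h₃'⟩ := h' s' h₃
  refine ⟨_, s'', .seq _ _ _ _ _ _ _ h₁ h₁', ?_, h₃'⟩
  have hβ := hs.le
  have := Nat.one_le_pow d β (by lia)
  rw [weight, add_mul, add_mul]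
  lia

theorem cost_add_one_le {w c : ℕ} (hβ : 3 ≤ β) (hd : 1 ≤ d) (hc : c ≤ w * β) :
    c + 1 ≤ (w + 1) * β ^ d := by
  calc c + 1 ≤ (w + 1) * β := by rw [add_mul]; lia
    _ ≤ (w + 1) * β ^ d := Nat.mul_le_mul_left _ (Nat.le_self_pow (by lia) β)

theorem assign {x : ℕ} {e : Expr} (hs : s.Bdd β) (hd : 1 ≤ d) (hQ : Q (s.setReg x (e.eval s))) :
    (Prog.assign x e).Runs β s d Q :=
  ⟨_, _, .assign x e s, cost_add_one_le hs.le hd (e.cost_le hs), hQ⟩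

theorem write {e : Expr} (hs : s.Bdd β) (hd : 1 ≤ d)
    (hQ : Q { s with out := s.out ++ [e.eval s] }) :
    (Prog.write e).Runs β s d Q :=
  ⟨_, _, .write e s, cost_add_one_le hs.le hd (e.cost_le hs), hQ⟩

theorem store {a : ℕ} {i e : Expr} (hs : s.Bdd β) (hd : 1 ≤ d)
    (hQ : Q (s.setCell a (i.eval s) (e.eval s))) :
    (Prog.store a i e).Runs β s d Q :=
  ⟨_, _, .store a i e s, cost_add_one_le hs.le hd
    (by rw [add_mul]; exact Nat.add_le_add (i.cost_le hs) (e.cost_le hs)), hQ⟩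

theorem read {x : ℕ} {z : ℤ} {w : List ℤ} (hs : s.Bdd β) (hd : 1 ≤ d) (hw : s.inp = z :: w)
    (hQ : Q { s.setReg x z with inp := w }) :
    (Prog.read x).Runs β s d Q := by
  refine ⟨_, _, .read x s, ?_, ?_⟩
  · refine cost_add_one_le (w := 1) hs.le hd ?_
    simpa [hw] using hs.inp z (by simp [hw])
  · simpa [hw, State.setReg] using hQ

theorem ifPos {e : Expr} (hs : s.Bdd β) (hd : 1 ≤ d) (h : 0 < e.eval s → P.Runs β s d Q)
    (h' : ¬ 0 < e.eval s → P'.Runs β s d Q) :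
    (Prog.ifPos e P P').Runs β s d Q := by
  have hc := cost_add_one_le hs.le hd (e.cost_le hs)
  by_cases he : 0 < e.eval s
  · obtain ⟨c, s', h₁, h₂, h₃⟩ := h he
    refine ⟨_, s', .ifPos_true _ _ _ _ _ _ he h₁, ?_, h₃⟩
    rw [weight, add_mul, add_mul]
    lia
  · obtain ⟨c, s', h₁, h₂, h₃⟩ := h' he
    refine ⟨_, s', .ifPos_false _ _ _ _ _ _ he h₁, ?_, h₃⟩
    rw [weight, add_mul, add_mul]
    lia

/-- A `while` loop whose body decreases a natural number on which the invariant depends. -/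
theorem whilePos {e : Expr} (Inv : ℕ → State → Prop) (hd : 1 ≤ d) (hm : m ≤ β)
    (h0 : Inv m s) (hInv : ∀ k s, Inv k s → s.Bdd β)
    (hstep : ∀ k s, Inv k s → 0 < e.eval s → P.Runs β s d fun s' => ∃ k' < k, Inv k' s')
    (hQ : ∀ k s', Inv k s' → ¬ 0 < e.eval s' → Q s') :
    (Prog.whilePos e P).Runs β s (d + 1) Q := by
  have key : ∀ k s, Inv k s → ∃ c s', (Prog.whilePos e P).Exec s c s' ∧
      c ≤ k * ((P.weight + e.weight + 2) * β ^ d) + (e.weight + 1) * β ^ d ∧ Q s' := by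
    intro k
    induction k using Nat.strong_induction_on with
    | _ k ih =>
    intro s hs
    have hb := hInv k s hs
    have hβ := hb.le
    have hc := cost_add_one_le hβ hd (e.cost_le hb)
    by_cases he : 0 < e.eval s
    · obtain ⟨c, s', h₁, h₂, k', hk', h₃⟩ := hstep k s hs he
      obtain ⟨c', s'', h₁', h₂', h₃'⟩ := ih k' hk' s' h₃
      refine ⟨_, s'', .whilePos_true _ _ _ _ _ _ _ he h₁ h₁', ?_, h₃'⟩
      have h4 : (k' + 1) * ((P.weight + e.weight + 2) * β ^ d)
          ≤ k * ((P.weight + e.weight + 2) * β ^ d) := Nat.mul_le_mul_right _ hk'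
      have h5 : (P.weight + e.weight + 2) * β ^ d
          = P.weight * β ^ d + (e.weight + 1) * β ^ d + β ^ d := by ring
      rw [add_mul, one_mul] at h4
      lia
    · exact ⟨_, s, .whilePos_false _ _ _ he, by lia, hQ k s hs he⟩
  obtain ⟨c, s', h₁, h₂, h₃⟩ := key m s h0
  refine ⟨c, s', h₁, h₂.trans ?_, h₃⟩
  have hβ := (hInv m s h0).le
  calc _ ≤ β * ((P.weight + e.weight + 2) * β ^ d) + (e.weight + 1) * (β ^ d * β) :=
        Nat.add_le_add (Nat.mul_le_mul_right _ hm)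
          (Nat.mul_le_mul_left _ (Nat.le_mul_of_pos_right _ (by lia)))
    _ ≤ _ := by
      rw [pow_succ, weight]
      nlinarith [Nat.zero_le (β ^ d * β)]

end Prog.Runs

/-- `for x = 0, …, e - 1 do P` -/
def forLoop (x : ℕ) (e : Expr) (P : Prog) : Prog :=
  .seq (.assign x (.const 0))
    (.whilePos (.sub e (.reg x)) (.seq P (.assign x (.add (.reg x) (.const 1)))))

/-- The rule for counting loops: `Inv k` holds before round `k`, in which the counter `x` has the
value `k`. -/
theorem Prog.Runs.forLoop {β : ℕ} {P : Prog} {s : State} {d m x : ℕ} {Q : State → Prop} {e : Expr}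
    (Inv : ℕ → State → Prop) (hd : 1 ≤ d) (hs : s.Bdd β) (hm : m ≤ β)
    (h0 : Inv 0 (s.setReg x 0))
    (hInv : ∀ k ≤ m, ∀ s, Inv k s → s.Bdd β ∧ s.reg x = k ∧ e.eval s = m)
    (hstep : ∀ k < m, ∀ s, Inv k s → P.Runs β s d fun s' =>
      s'.Bdd β ∧ s'.reg x = k ∧ Inv (k + 1) (s'.setReg x (k + 1 : ℕ)))
    (hQ : ∀ s', Inv m s' → Q s') :
    (forLoop x e P).Runs β s (d + 1) Q := by
  refine seq hs (assign hs (by lia) (Q := fun s' => Inv 0 s') h0)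
    fun s' hs' => whilePos (m := m) (fun k s => ∃ i, i ≤ m ∧ k = m - i ∧ Inv i s) hd hm
      ⟨0, by lia, rfl, hs'⟩ ?_ ?_ ?_
  · rintro k s ⟨i, hi, -, h⟩
    exact (hInv i hi s h).1
  · rintro k s ⟨i, hi, rfl, h⟩ he
    obtain ⟨h₁, h₂, h₃⟩ := hInv i hi s h
    simp only [Expr.eval, h₂, h₃] at he
    refine seq h₁ (hstep i (by lia) s h) fun s' hs' => ?_
    obtain ⟨h₁', h₂', h₃'⟩ := hs'
    refine assign h₁' hd ⟨m - (i + 1), by lia, i + 1, by lia, rfl, ?_⟩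
    simpa [Expr.eval, h₂'] using h₃'
  · rintro k s ⟨i, hi, rfl, h⟩ he
    obtain ⟨h₁, h₂, h₃⟩ := hInv i hi s h
    simp only [Expr.eval, h₂, h₃] at he
    obtain rfl : i = m := by lia
    exact hQ s h

/-- `s'` arises from `s` by changes to the registers in `R` and the memory banks in `B`. -/
structure Agree (R B : Finset ℕ) (s s' : State) : Prop where
  reg : ∀ x ∉ R, s'.reg x = s.reg x
  bank : ∀ b ∉ B, s'.bank b = s.bank b
  inp : s'.inp = s.inp
  out : s'.out = s.out

namespace Agree

variable {R R' B B' : Finset ℕ} {s s' s'' : State}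

theorem refl (R B : Finset ℕ) (s : State) : Agree R B s s :=
  ⟨fun _ _ => rfl, fun _ _ => rfl, rfl, rfl⟩

theorem trans (h : Agree R B s s') (h' : Agree R' B' s' s'') (hR : R' ⊆ R) (hB : B' ⊆ B) :
    Agree R B s s'' where
  reg x hx := (h'.reg x fun h => hx (hR h)).trans (h.reg x hx)
  bank b hb := (h'.bank b fun h => hb (hB h)).trans (h.bank b hb)
  inp := h'.inp.trans h.inp
  out := h'.out.trans h.out

theorem setReg (h : Agree R B s s') {x : ℕ} (hx : x ∈ R) (z : ℤ) : Agree R B s (s'.setReg x z) where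
  reg y hy := by rw [State.setReg_reg_of_ne _ _ _ (by rintro rfl; exact hy hx), h.reg y hy]
  bank := h.bank
  inp := h.inp
  out := h.out

theorem setCell (h : Agree R B s s') {a : ℕ} (ha : a ∈ B) (i z : ℤ) :
    Agree R B s (s'.setCell a i z) where
  reg := h.reg
  bank b hb := by rw [State.setCell_bank_of_ne _ _ _ _ (by rintro rfl; exact hb ha), h.bank b hb]
  inp := h.inp
  out := h.out

end Agree

/-- `s'` arises from `s` by changes to memory bank `a` and to the scratch registers
`0, 1, 2, 3`. -/
abbrev Frame (a : ℕ) (s s' : State) : Prop := Agree {0, 1, 2, 3} {a} s s'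

/-- Tabulation of sums: for `i < R` and `j < C`, the sum over `k < K` of the values of `f` is
written to the address `base + i * C + j` of bank `a`.  The expression `f` finds `i`, `j`, `k` in
the registers `0`, `1`, `2`. -/
def tabulate (a : ℕ) (base R C K f : Expr) : Prog :=
  forLoop 0 R (forLoop 1 C (.seq (.assign 3 (.const 0))
    (.seq (forLoop 2 K (.assign 3 (.add (.reg 3) f)))
      (.store a (.add base (.add (.mul (.reg 0) C) (.reg 1))) (.reg 3)))))

/-- The tabulation writes the expected sums and leaves all other cells of the bank unchanged.  The
bound for the sums of the absolute values covers all partial sums. -/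
theorem tabulate_runs {β : ℕ} {s : State} {a : ℕ} {base R C K f : Expr} {b : ℤ} {r c k : ℕ}
    (F : ℕ → ℕ → ℕ → ℤ) (hs : s.Bdd β) (hr : r ≤ β) (hc : c ≤ β) (hk : k ≤ β)
    (hbase : ∀ s', Frame a s s' → base.eval s' = b) (hR : ∀ s', Frame a s s' → R.eval s' = r)
    (hC : ∀ s', Frame a s s' → C.eval s' = c) (hK : ∀ s', Frame a s s' → K.eval s' = k)
    (hf : ∀ s', Frame a s s' → ∀ i < r, ∀ j < c, ∀ l < k,
      s'.reg 0 = i → s'.reg 1 = j → s'.reg 2 = l → f.eval s' = F i j l)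
    (hF : ∀ i < r, ∀ j < c, bits (∑ l ∈ Finset.range k, |F i j l|) ≤ β) :
    (tabulate a base R C K f).Runs β s 4 fun s' =>
      Frame a s s' ∧ s'.Bdd β ∧
      (∀ i < r, ∀ j < c, s'.bank a (b + (i * c + j)) = ∑ l ∈ Finset.range k, F i j l) ∧
      ∀ x, x < b ∨ b + r * c ≤ x → s'.bank a x = s.bank a x := by
  have hβ := hs.le
  -- partial sums are bounded by the sum of the absolute values
  have hpart : ∀ i < r, ∀ j < c, ∀ l ≤ k, bits (∑ l ∈ Finset.range l, F i j l) ≤ β := by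
    intro i hi j hj l hl
    refine (bits_le_of_natAbs_le ?_).trans (hF i hi j hj)
    have h1 : |∑ l ∈ Finset.range l, F i j l| ≤ ∑ l ∈ Finset.range k, |F i j l| :=
      (Finset.abs_sum_le_sum_abs _ _).trans (Finset.sum_le_sum_of_subset_of_nonneg
        (Finset.range_subset_range.2 hl) fun _ _ _ => abs_nonneg _)
    rw [Int.abs_eq_natAbs] at h1
    lia
  -- the cells already written when the counters are `i` and `j`
  let Done (i j : ℕ) (s' : State) : Prop :=
    (∀ i' < r, ∀ j' < c, (i' < i ∨ i' = i ∧ j' < j) →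
      s'.bank a (b + (i' * c + j')) = ∑ l ∈ Finset.range k, F i' j' l) ∧
    ∀ x, x < b ∨ b + r * c ≤ x → s'.bank a x = s.bank a x
  have addr : ∀ i < r, ∀ j < c, (i * c + j : ℤ) < r * c := by
    intro i hi j hj
    have : (i + 1) * c ≤ r * c := Nat.mul_le_mul_right _ hi
    zify at this
    lia
  refine Prog.Runs.forLoop (m := r) (d := 3)
    (fun i s' => s'.Bdd β ∧ s'.reg 0 = i ∧ Frame a s s' ∧ Done i 0 s') (by lia) hs hr ?_ ?_
    (fun i hi s₁ h₁ => Prog.Runs.forLoop (m := c) (d := 2)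
      (fun j s' => s'.Bdd β ∧ s'.reg 0 = i ∧ s'.reg 1 = j ∧ Frame a s s' ∧ Done i j s') (by lia)
      h₁.1 hc ?_ ?_
      (fun j hj s₂ h₂ => Prog.Runs.seq h₂.1
        (Q' := fun s' => s'.Bdd β ∧ s'.reg 0 = i ∧ s'.reg 1 = j ∧ s'.reg 3 = 0 ∧ Frame a s s' ∧
          Done i j s')
        (Prog.Runs.assign h₂.1 (by lia) ?_)
        fun s₃ h₃ => Prog.Runs.seq h₃.1
          (Q' := fun s' => s'.Bdd β ∧ s'.reg 0 = i ∧ s'.reg 1 = j ∧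
            s'.reg 3 = ∑ l ∈ Finset.range k, F i j l ∧ Frame a s s' ∧ Done i j s')
          (Prog.Runs.forLoop (m := k) (d := 1)
            (fun l s' => s'.Bdd β ∧ s'.reg 0 = i ∧ s'.reg 1 = j ∧ s'.reg 2 = l ∧
              s'.reg 3 = ∑ l ∈ Finset.range l, F i j l ∧ Frame a s s' ∧ Done i j s') (by lia)
            h₃.1 hk ?_ ?_
            (fun l hl s₄ h₄ => Prog.Runs.assign h₄.1 (by lia) ?_) ?_)
          fun s₅ h₅ => Prog.Runs.store h₅.1 (by lia) ?_) ?_) ?_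
  · refine ⟨hs.setReg (by simp [bits]; lia), by simp, (Agree.refl _ _ s).setReg (by decide) 0, ?_,
      ?_⟩
    · intro i' hi' j' hj' h
      lia
    · intro x hx
      rfl
  · rintro i hi s' ⟨h1, h2, h3, -⟩
    exact ⟨h1, h2, hR s' h3⟩
  · obtain ⟨h1, h2, h3, h4⟩ := h₁
    exact ⟨h1.setReg (by simp [bits]; lia), by simp [h2], by simp, h3.setReg (by decide) 0, h4⟩
  · rintro j hj s' ⟨h1, h2, h3, h4, -⟩
    exact ⟨h1, h3, hC s' h4⟩
  · obtain ⟨h1, h2, h3, h4, h5⟩ := h₂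
    refine ⟨h1.setReg ?_, by simp [h2], by simp [h3], by simp [Expr.eval],
      h4.setReg (by decide) _, h5⟩
    simp [Expr.eval, bits]
    lia
  · obtain ⟨h1, h2, h3, h4, h5, h6⟩ := h₃
    exact ⟨h1.setReg (by simp [bits]; lia), by simp [h2], by simp [h3], by simp, by simp [h4],
      h5.setReg (by decide) 0, h6⟩
  · rintro l hl s' ⟨h1, h2, h3, h4, h5, h6, -⟩
    exact ⟨h1, h4, hK s' h6⟩
  · obtain ⟨h1, h2, h3, h4, h5, h6, h7⟩ := h₄
    have hv : (Expr.add (.reg 3) f).eval s₄ = ∑ l ∈ Finset.range (l + 1), F i j l := by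
      simp only [Expr.eval]
      rw [Finset.sum_range_succ, h5, hf s₄ h6 i hi j hj l hl h2 h3 h4]
    rw [hv]
    have hb := hpart i hi j hj (l + 1) hl
    exact ⟨h1.setReg hb, by simp [h4], (h1.setReg hb).setReg (bits_natCast_le (by lia) hβ),
      by simp [h2], by simp [h3], by simp, by simp,
      (h6.setReg (by decide) _).setReg (by decide) _, h7⟩
  · rintro s' ⟨h1, h2, h3, -, h5, h6, h7⟩
    exact ⟨h1, h2, h3, h5, h6, h7⟩
  · obtain ⟨h1, h2, h3, h4, h5, h6⟩ := h₅
    have hv : (Expr.reg 3).eval s₅ = ∑ l ∈ Finset.range k, F i j l := h4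
    have ha : (Expr.add base (.add (.mul (.reg 0) C) (.reg 1))).eval s₅ = b + (i * c + j) := by
      simp only [Expr.eval]
      rw [hbase s₅ h5, hC s₅ h5, h2, h3]
    rw [hv, ha]
    have hb := hpart i hi j hj k le_rfl
    refine ⟨h1.setCell hb, by simp [h3], (h1.setCell hb).setReg (bits_natCast_le (by lia) hβ),
      by simp [h2], by simp, (h5.setCell (by simp) _ _).setReg (by decide) _, ?_, ?_⟩
    · intro i' hi' j' hj' h
      rw [State.setReg_bank, State.setCell_bank]
      split_ifs with heq
      · -- the address determines the pair of indices
        have hij : i' * c + j' = i * c + j := by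
          have : (i' * c + j' : ℤ) = i * c + j := by linarith
          exact_mod_cast this
        have hi'' : i' = i := by
          have e1 : (i' * c + j') / c = i' := by
            rw [mul_comm, Nat.mul_add_div (by lia), Nat.div_eq_of_lt hj', add_zero]
          have e2 : (i * c + j) / c = i := by
            rw [mul_comm, Nat.mul_add_div (by lia), Nat.div_eq_of_lt hj, add_zero]
          rw [← e1, hij, e2]
        subst hi''
        obtain rfl : j' = j := by lia
        rfl
      · refine h6.1 i' hi' j' hj' ?_
        rcases h with h | ⟨rfl, h⟩
        · exact .inl h
        · refine .inr ⟨rfl, lt_of_le_of_ne (by lia) ?_⟩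
          rintro rfl
          exact heq rfl
    · intro x hx
      rw [State.setReg_bank, State.setCell_bank, if_neg, h6.2 x hx]
      have := addr i hi j hj
      have : (0 : ℤ) ≤ i * c + j := by positivity
      lia
  · rintro s' ⟨h1, h2, h3, h4, h5⟩
    refine ⟨h1, h2, h1.setReg (bits_natCast_le (by lia) hβ), by simp, h4.setReg (by decide) _, ?_,
      h5.2⟩
    intro i' hi' j' hj' h
    exact h5.1 i' hi' j' hj' (by lia)
  · rintro s' ⟨h1, h2, h3, h4⟩
    exact ⟨h3, h1, fun i hi j hj => h4.1 i hi j hj (.inl hi), h4.2⟩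

/-- The memory bank `a` holds the matrix `M`, row by row. -/
def State.Holds (s : State) (a : ℕ) {r c : ℕ} (M : Matrix (Fin r) (Fin c) ℤ) : Prop :=
  ∀ (i : Fin r) (j : Fin c), s.bank a ((i : ℕ) * c + (j : ℕ)) = M i j

theorem State.Holds.congr {s s' : State} {a : ℕ} {r c : ℕ} {M : Matrix (Fin r) (Fin c) ℤ}
    (h : s.Holds a M) (hs : s'.bank a = s.bank a) : s'.Holds a M := by
  intro i j
  rw [hs, h]

theorem bits_le_of_abs_le {z : ℤ} {e β : ℕ} (h : |z| ≤ 2 ^ e) (he : e + 2 ≤ β) : bits z ≤ β := by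
  refine le_trans ?_ he
  rw [show e + 2 = (e + 1) + 1 by ring, bits_le_succ_iff, pow_succ]
  rw [Int.abs_eq_natAbs] at h
  have h' : z.natAbs ≤ 2 ^ e := by exact_mod_cast h
  have : 0 < 2 ^ e := by positivity
  lia

theorem sum_abs_le_two_pow {k a ν : ℕ} {F : ℕ → ℤ} (hk : k ≤ 2 ^ ν)
    (hF : ∀ l < k, |F l| ≤ 2 ^ a) : ∑ l ∈ Finset.range k, |F l| ≤ 2 ^ (ν + a) := by
  calc ∑ l ∈ Finset.range k, |F l| ≤ ∑ l ∈ Finset.range k, (2 : ℤ) ^ a :=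
        Finset.sum_le_sum fun l hl => hF l (Finset.mem_range.1 hl)
    _ = (k : ℤ) * 2 ^ a := by simp
    _ ≤ 2 ^ ν * 2 ^ a := by gcongr; exact_mod_cast hk
    _ = _ := (pow_add 2 ν a).symm

/-- The tabulation of a matrix whose entries are sums of `k ≤ 2 ^ ν` terms bounded by `2 ^ e`. -/
theorem tabulate_matrix_runs {β : ℕ} {s : State} {a : ℕ} {R C K f : Expr} {r c k ν e : ℕ}
    (M : Matrix (Fin r) (Fin c) ℤ) (F : Fin r → Fin c → Fin k → ℤ)
    (hM : ∀ i j, M i j = ∑ l, F i j l)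
    (hs : s.Bdd β) (hr : r ≤ β) (hc : c ≤ β) (hk : k ≤ β)
    (hR : ∀ s', Frame a s s' → R.eval s' = r) (hC : ∀ s', Frame a s s' → C.eval s' = c)
    (hK : ∀ s', Frame a s s' → K.eval s' = k)
    (hf : ∀ s', Frame a s s' → ∀ (i : Fin r) (j : Fin c) (l : Fin k),
      s'.reg 0 = (i : ℕ) → s'.reg 1 = (j : ℕ) → s'.reg 2 = (l : ℕ) → f.eval s' = F i j l)
    (hν : k ≤ 2 ^ ν) (hF : ∀ i j l, |F i j l| ≤ 2 ^ e) (he : ν + e + 2 ≤ β) :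
    (tabulate a (.const 0) R C K f).Runs β s 4 fun s' =>
      Frame a s s' ∧ s'.Bdd β ∧ s'.Holds a M := by
  let F' (i j l : ℕ) : ℤ :=
    if h : i < r ∧ j < c ∧ l < k then F ⟨i, h.1⟩ ⟨j, h.2.1⟩ ⟨l, h.2.2⟩ else 0
  have hF' : ∀ i (hi : i < r) j (hj : j < c) l (hl : l < k), F' i j l = F ⟨i, hi⟩ ⟨j, hj⟩ ⟨l, hl⟩ :=
    fun i hi j hj l hl => dif_pos ⟨hi, hj, hl⟩
  refine (tabulate_runs (b := 0) (r := r) (c := c) (k := k) F' hs hr hc hk (fun _ _ => rfl) hR hC hK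
    ?_ ?_).mono ?_
  · intro s' hs' i hi j hj l hl h0 h1 h2
    rw [hF' i hi j hj l hl]
    exact hf s' hs' ⟨i, hi⟩ ⟨j, hj⟩ ⟨l, hl⟩ h0 h1 h2
  · intro i hi j hj
    refine bits_le_of_abs_le ((abs_of_nonneg (Finset.sum_nonneg fun _ _ => abs_nonneg _)).le.trans
      (sum_abs_le_two_pow hν fun l hl => ?_)) he
    rw [hF' i hi j hj l hl]
    exact hF _ _ _
  · rintro s' ⟨h1, h2, h3, -⟩
    refine ⟨h1, h2, fun i j => ?_⟩
    have := h3 i i.2 j j.2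
    rw [zero_add] at this
    rw [this, hM, Finset.sum_range]
    exact Finset.sum_congr rfl fun l _ => hF' i i.2 j j.2 l l.2

end RAM

/-! ### The Faddeev–LeVerrier recursion -/

namespace Matrix

open Polynomial

section CommRing

variable {n R : Type*} [Fintype n] [DecidableEq n] [CommRing R]

theorem derivative_det_eq_sum (M : Matrix n n R[X]) :
    derivative M.det = ∑ i, (M.updateCol i fun r => derivative (M r i)).det := by
  simp only [det_apply, derivative_sum, derivative_smul, derivative_prod_finset]
  rw [Finset.sum_comm]
  refine Finset.sum_congr rfl fun σ _ => ?_
  rw [← Finset.smul_sum]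
  congr 1
  refine Finset.sum_congr rfl fun i _ => ?_
  rw [← Finset.mul_prod_erase _ _ (Finset.mem_univ i), mul_comm]
  congr 1
  · simp
  · refine Finset.prod_congr rfl fun j hj => ?_
    rw [updateCol_ne (Finset.ne_of_mem_erase hj)]

/-- Jacobi's formula for the characteristic matrix. -/
theorem derivative_charpoly (T : Matrix n n R) :
    derivative T.charpoly = trace (adjugate (charmatrix T)) := by
  rw [charpoly, ← det_transpose, derivative_det_eq_sum, trace]
  refine Finset.sum_congr rfl fun i _ => ?_
  rw [diag_apply, adjugate_def, of_apply, cramer_apply]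
  congr 2
  ext r
  rcases eq_or_ne i r with rfl | h
  · simp
  · simp [h]

/-- The matrices produced by the Faddeev–LeVerrier recursion: `q(T)`, where `q` arises from the
characteristic polynomial of `T` by dropping the `j` lowest terms and dividing by `X ^ j`. -/
noncomputable def tailCharpoly (T : Matrix n n R) (j : ℕ) : Matrix n n R :=
  aeval T (divX^[j] T.charpoly)

variable (T : Matrix n n R)

theorem coeff_divX_iterate (p : R[X]) (j i : ℕ) : (divX^[j] p).coeff i = p.coeff (i + j) := by
  induction j generalizing i with
  | zero => rfl
  | succ j ih => rw [Function.iterate_succ_apply', coeff_divX, ih, add_assoc, add_comm 1]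

theorem tailCharpoly_eq (j : ℕ) :
    T.tailCharpoly j = T * T.tailCharpoly (j + 1) + T.charpoly.coeff j • 1 := by
  rw [tailCharpoly, tailCharpoly, Function.iterate_succ_apply']
  conv_lhs => rw [← divX_mul_X_add (divX^[j] T.charpoly)]
  rw [coeff_divX_iterate, zero_add, mul_comm, map_add, map_mul, aeval_X, aeval_C,
    Algebra.algebraMap_eq_smul_one]

theorem tailCharpoly_zero : T.tailCharpoly 0 = 0 := aeval_self_charpoly T

theorem tailCharpoly_of_card_lt {j : ℕ} (h : Fintype.card n < j) : T.tailCharpoly j = 0 := by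
  have : divX^[j] T.charpoly = 0 := by
    ext i
    rw [coeff_divX_iterate, coeff_zero]
    nontriviality R
    exact coeff_eq_zero_of_natDegree_lt (by rw [charpoly_natDegree_eq_dim]; lia)
  rw [tailCharpoly, this, map_zero]

theorem coeff_charpoly_card : T.charpoly.coeff (Fintype.card n) = 1 := by
  nontriviality R
  have := T.charpoly_monic
  rwa [Monic, leadingCoeff, charpoly_natDegree_eq_dim] at this

theorem tailCharpoly_card : T.tailCharpoly (Fintype.card n) = 1 := by
  rw [tailCharpoly_eq, tailCharpoly_of_card_lt _ (Nat.lt_succ_self _), mul_zero, zero_add,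
    coeff_charpoly_card, one_smul]

/-- The matrices of the recursion are the coefficients of the adjugate of `X - T`. -/
theorem coeff_matPolyEquiv_adjugate_charmatrix (j : ℕ) :
    (matPolyEquiv (adjugate (charmatrix T))).coeff j = T.tailCharpoly (j + 1) := by
  set a := matPolyEquiv (adjugate (charmatrix T)) with ha
  have hmul : (X - C T) * a = matPolyEquiv (T.charpoly • 1) := by
    rw [ha, ← matPolyEquiv_charmatrix, ← map_mul, mul_adjugate]
    rfl
  have hrec : ∀ j, a.coeff j = T * a.coeff (j + 1) + T.charpoly.coeff (j + 1) • 1 := by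
    intro j
    have := congrArg (fun q => coeff q (j + 1)) hmul
    simp only [sub_mul, coeff_sub, coeff_X_mul, coeff_C_mul, matPolyEquiv_smul_one,
      coeff_map] at this
    rw [← sub_eq_iff_eq_add', this]
    exact Algebra.algebraMap_eq_smul_one _
  -- both sides satisfy the same downward recursion and vanish for large indices
  have hdiff : ∀ k j, a.coeff j - T.tailCharpoly (j + 1)
      = T ^ k * (a.coeff (j + k) - T.tailCharpoly (j + k + 1)) := by
    intro k
    induction k with
    | zero => simp
    | succ k ih =>
      intro j
      rw [ih, hrec (j + k), tailCharpoly_eq _ (j + k + 1), pow_succ, mul_assoc, mul_sub T]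
      congr 1
      rw [add_sub_add_right_eq_sub]
      rfl
  rw [← sub_eq_zero, hdiff (a.natDegree + Fintype.card n + 1) j,
    coeff_eq_zero_of_natDegree_lt (by lia), tailCharpoly_of_card_lt _ (by lia), sub_zero, mul_zero]

theorem trace_tailCharpoly (j : ℕ) : trace (T.tailCharpoly j) = j * T.charpoly.coeff j := by
  cases j with
  | zero => simp [tailCharpoly_zero]
  | succ j =>
    have h := congrArg (fun q => coeff q j) (derivative_charpoly T)
    simp only [coeff_derivative] at h
    rw [mul_comm, Nat.cast_succ, h, ← coeff_matPolyEquiv_adjugate_charmatrix, trace, trace,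
      finsetSum_coeff]
    refine Finset.sum_congr rfl fun i _ => ?_
    rw [diag_apply, diag_apply, matPolyEquiv_coeff_apply]

/-- **Newton's identities** in the form used by the Faddeev–LeVerrier recursion. -/
theorem card_sub_mul_coeff_charpoly {j k : ℕ} (h : j + k = Fintype.card n) :
    k * T.charpoly.coeff j = -trace (T * T.tailCharpoly (j + 1)) := by
  have h1 := trace_tailCharpoly T j
  rw [tailCharpoly_eq, trace_add, trace_smul, trace_one, ← h, smul_eq_mul, Nat.cast_add] at h1
  linear_combination h1

end CommRing

section Bounds

variable {N : ℕ} (T : Matrix (Fin N) (Fin N) ℤ) {τ ν : ℕ}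

theorem abs_sum_le_two_pow {k ν e : ℕ} {F : Fin k → ℤ} (hk : k ≤ 2 ^ ν)
    (hF : ∀ l, |F l| ≤ 2 ^ e) : |∑ l, F l| ≤ 2 ^ (ν + e) := by
  refine (Finset.abs_sum_le_sum_abs _ _).trans ((Finset.sum_le_sum fun l _ => hF l).trans ?_)
  rw [Finset.sum_const, Finset.card_univ, Fintype.card_fin, nsmul_eq_mul, pow_add]
  gcongr
  exact_mod_cast hk

theorem abs_mul_le_two_pow {a b : ℕ} {x y : ℤ} (hx : |x| ≤ 2 ^ a) (hy : |y| ≤ 2 ^ b) :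
    |x * y| ≤ 2 ^ (a + b) := by
  rw [abs_mul, pow_add]
  exact mul_le_mul hx hy (abs_nonneg _) (by positivity)

theorem abs_mul_apply_le {A B : Matrix (Fin N) (Fin N) ℤ} {a b : ℕ} (hN : N ≤ 2 ^ ν)
    (hA : ∀ i j, |A i j| ≤ 2 ^ a) (hB : ∀ i j, |B i j| ≤ 2 ^ b) (i j : Fin N) :
    |(A * B) i j| ≤ 2 ^ (ν + (a + b)) := by
  rw [mul_apply]
  exact abs_sum_le_two_pow hN fun k => abs_mul_le_two_pow (hA i k) (hB k j)

/-- The entries of the matrices in the Faddeev–LeVerrier recursion grow by a bounded factor in each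
step: by Newton's identities the coefficient is a quotient of a trace by a positive integer. -/
theorem abs_tailCharpoly_apply_le (hN : N ≤ 2 ^ ν) (hT : ∀ i j, |T i j| ≤ 2 ^ τ) {j k : ℕ}
    (h : j + k = N) :
    (∀ i i', |T.tailCharpoly j i i'| ≤ 2 ^ (k * (τ + 2 * ν + 1))) ∧
      |T.charpoly.coeff j| ≤ 2 ^ (k * (τ + 2 * ν + 1)) := by
  induction k generalizing j with
  | zero =>
    obtain rfl : j = N := h
    have h1 := tailCharpoly_card T
    have h2 := coeff_charpoly_card T
    rw [Fintype.card_fin] at h1 h2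
    rw [h1, h2]
    refine ⟨fun i i' => ?_, by simp⟩
    rw [one_apply]
    split_ifs <;> simp
  | succ k ih =>
    obtain ⟨ih, -⟩ := ih (j := j + 1) (by lia)
    have hmul := abs_mul_apply_le (ν := ν) hN hT ih
    have htr : |trace (T * T.tailCharpoly (j + 1))| ≤ _ := abs_sum_le_two_pow hN fun l => hmul l l
    have hc : |T.charpoly.coeff j| ≤ 2 ^ (ν + (ν + (τ + k * (τ + 2 * ν + 1)))) := by
      have h1 := T.card_sub_mul_coeff_charpoly (j := j) (k := k + 1) (by simpa using h)
      have h2 := congrArg abs h1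
      rw [abs_mul, abs_neg] at h2
      refine le_trans ?_ (h2.le.trans htr)
      refine le_mul_of_one_le_left (abs_nonneg _) ?_
      rw [Nat.abs_cast]
      exact_mod_cast Nat.succ_pos k
    refine ⟨fun i i' => ?_, hc.trans (pow_le_pow_right₀ (by norm_num) (by lia))⟩
    rw [tailCharpoly_eq, add_apply, smul_apply, smul_eq_mul]
    have h1 : |(1 : Matrix (Fin N) (Fin N) ℤ) i i'| ≤ 1 := by
      rw [one_apply]
      split_ifs <;> simp
    calc |(T * T.tailCharpoly (j + 1)) i i' + T.charpoly.coeff j * (1 : Matrix _ _ ℤ) i i'|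
        ≤ 2 ^ (ν + (τ + k * (τ + 2 * ν + 1))) + 2 ^ (ν + (ν + (τ + k * (τ + 2 * ν + 1)))) * 1 := by
          refine (abs_add_le _ _).trans (add_le_add (hmul i i') ?_)
          rw [abs_mul]
          exact mul_le_mul hc h1 (abs_nonneg _) (by positivity)
      _ ≤ 2 ^ (ν + (ν + (τ + k * (τ + 2 * ν + 1))))
          + 2 ^ (ν + (ν + (τ + k * (τ + 2 * ν + 1)))) := by
          rw [mul_one]
          exact add_le_add_left (pow_le_pow_right₀ (by norm_num) (Nat.le_add_left _ _)) _
      _ = 2 ^ (ν + (ν + (τ + k * (τ + 2 * ν + 1))) + 1) := by rw [pow_succ]; ring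
      _ ≤ _ := pow_le_pow_right₀ (by norm_num) (by lia)

end Bounds

end Matrix

/-! ### A program for the Faddeev–LeVerrier recursion -/

namespace RAM

namespace Expr

/-- The value is `1` if the values of `e₁` and `e₂` agree and `0` otherwise: it is the integral part
of `1 / (1 + (e₁ - e₂) ^ 2)`. -/
def ifEq (e₁ e₂ : Expr) : Expr :=
  .quot (.const 1) (.add (.const 1) (.mul (.sub e₁ e₂) (.sub e₁ e₂)))

theorem eval_ifEq (s : State) (e₁ e₂ : Expr) :
    (ifEq e₁ e₂).eval s = if e₁.eval s = e₂.eval s then 1 else 0 := by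
  simp only [ifEq, eval]
  split_ifs with h
  · simp [h]
  · have : 0 < (e₁.eval s - e₂.eval s) * (e₁.eval s - e₂.eval s) :=
      mul_self_pos.2 (sub_ne_zero.2 h)
    exact Int.ediv_eq_zero_of_lt (by norm_num) (by lia)

/-- The entry in row `i` and column `j` of the matrix with `c` columns in bank `a`. -/
def entry (a : ℕ) (c i j : Expr) : Expr := .cell a (.add (.mul i c) j)

@[simp] theorem eval_entry (s : State) (a : ℕ) (c i j : Expr) :
    (entry a c i j).eval s = s.bank a (i.eval s * c.eval s + j.eval s) := rfl

end Expr

open RAM.Expr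

/-- The Faddeev–LeVerrier recursion for the matrix `T` in bank `0`, of the size given in register
`5`.  For the characteristic polynomial `X ^ m * q` with `q 0 ≠ 0`, the value `q 0` is left in
register `8`, the size minus `m` in register `9`, and the matrix `S` with `q(T) = T * S + q 0` in
bank `3`. -/
def faddeevLeVerrier : Prog :=
  .seq (tabulate 1 (.const 0) (.reg 5) (.reg 5) (.const 1) (ifEq (.reg 0) (.reg 1)))
  (.seq (tabulate 3 (.const 0) (.reg 5) (.reg 5) (.const 0) (.const 0))
  (.seq (.assign 8 (.const 1))
  (.seq (.assign 9 (.const 0))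
  (forLoop 6 (.reg 5)
    (.seq (tabulate 2 (.const 0) (.reg 5) (.reg 5) (.reg 5)
      (.mul (entry 0 (.reg 5) (.reg 0) (.reg 2)) (entry 1 (.reg 5) (.reg 2) (.reg 1))))
    (.seq (tabulate 4 (.const 0) (.const 1) (.const 1) (.reg 5)
      (entry 2 (.reg 5) (.reg 2) (.reg 2)))
    (.seq (.assign 7 (.sub (.const 0) (.quot (.cell 4 (.const 0)) (.add (.reg 6) (.const 1)))))
    (.seq (.ifPos (.mul (.reg 7) (.reg 7))
      (.seq (tabulate 3 (.const 0) (.reg 5) (.reg 5) (.const 1)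
        (entry 1 (.reg 5) (.reg 0) (.reg 1)))
      (.seq (.assign 8 (.reg 7)) (.assign 9 (.add (.reg 6) (.const 1)))))
      .skip)
    (tabulate 1 (.const 0) (.reg 5) (.reg 5) (.const 1)
      (.add (entry 2 (.reg 5) (.reg 0) (.reg 1))
        (.mul (.reg 7) (ifEq (.reg 0) (.reg 1)))))))))))))

open Matrix

/-- What the program for the Faddeev–LeVerrier recursion has computed when the matrix
`T.tailCharpoly j` is reached: the data for the smallest index `m ≥ j` with a nonzero coefficient of
the characteristic polynomial. -/
def FaddeevLeVerrierResult {N : ℕ} (T : Matrix (Fin N) (Fin N) ℤ) (j : ℕ) (s : State) : Prop :=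
  ∃ m, j ≤ m ∧ m ≤ N ∧ T.charpoly.coeff m ≠ 0 ∧ (∀ i < m, j ≤ i → T.charpoly.coeff i = 0) ∧
    s.Holds 3 (T.tailCharpoly (m + 1)) ∧ s.reg 8 = T.charpoly.coeff m ∧ s.reg 9 = (N - m : ℕ)

theorem faddeevLeVerrier_runs {β N τ ν : ℕ} {s : State} (T : Matrix (Fin N) (Fin N) ℤ)
    (hs : s.Bdd β) (hN : s.reg 5 = N) (hT : s.Holds 0 T) (hτ : ∀ i j, |T i j| ≤ 2 ^ τ)
    (hν : N ≤ 2 ^ ν) (hNβ : N ≤ β) (hβ : (N + 2) * (τ + 2 * ν + 1) + 2 ≤ β) :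
    faddeevLeVerrier.Runs β s 5 fun s' =>
      Agree {0, 1, 2, 3, 6, 7, 8, 9} {1, 2, 3, 4} s s' ∧ s'.Bdd β ∧
      s'.Holds 3 (T.tailCharpoly (T.charpoly.natTrailingDegree + 1)) ∧
      s'.reg 8 = T.charpoly.coeff T.charpoly.natTrailingDegree ∧
      s'.reg 9 = (N - T.charpoly.natTrailingDegree : ℕ) := by
  have hβ3 := hs.le
  have hcard : T.tailCharpoly N = 1 ∧ T.charpoly.coeff N = 1 ∧ T.tailCharpoly (N + 1) = 0 := by
    refine ⟨?_, ?_, T.tailCharpoly_of_card_lt (by simp)⟩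
    · simpa using T.tailCharpoly_card
    · simpa using T.coeff_charpoly_card
  have hsmall : ∀ k ≤ N, k * (τ + 2 * ν + 1) + 2 * (τ + 2 * ν + 1) + 2 ≤ β := by
    intro k hk
    have : k * (τ + 2 * ν + 1) ≤ N * (τ + 2 * ν + 1) := Nat.mul_le_mul_right _ hk
    rw [add_mul] at hβ
    lia
  have hreg5 : ∀ {B s'}, Agree {0, 1, 2, 3, 6, 7, 8, 9} B s s' → s'.reg 5 = N := fun h => by
    rw [h.reg 5 (by decide), hN]
  have hreg5' : ∀ {B s' s'' a}, Agree {0, 1, 2, 3, 6, 7, 8, 9} B s s' → Frame a s' s'' →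
      s''.reg 5 = N := fun h h' => by
    rw [h'.reg 5 (by decide), hreg5 h]
  -- the initial values
  refine Prog.Runs.seq hs ((tabulate_matrix_runs (1 : Matrix (Fin N) (Fin N) ℤ) (k := 1)
    (fun i j _ => if i = j then 1 else 0) (by simp [one_apply]) hs hNβ hNβ (by lia)
    (fun s' h => by simp [eval, h.reg 5 (by decide), hN])
    (fun s' h => by simp [eval, h.reg 5 (by decide), hN]) (fun _ _ => rfl) ?_
    (ν := 0) (by norm_num) (e := 0) (fun i j _ => by split_ifs <;> simp) (by lia)).weaken hs
      (by lia)) ?_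
  · intro s' h i j l h0 h1 h2
    simp [eval_ifEq, eval, h0, h1, Fin.ext_iff]
  rintro s₁ ⟨f₁, b₁, H₁⟩
  refine Prog.Runs.seq b₁ ((tabulate_matrix_runs (0 : Matrix (Fin N) (Fin N) ℤ) (k := 0)
    (fun i j _ => 0) (by simp) b₁ hNβ hNβ (by lia)
    (fun s' h => by simp [eval, h.reg 5 (by decide), f₁.reg 5 (by decide), hN])
    (fun s' h => by simp [eval, h.reg 5 (by decide), f₁.reg 5 (by decide), hN]) (fun _ _ => rfl)
    (fun _ _ _ _ l => l.elim0)
    (ν := 0) (by norm_num) (e := 0) (fun i j _ => by simp) (by lia)).weaken b₁ (by lia)) ?_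
  rintro s₂ ⟨f₂, b₂, H₂⟩
  have a₂ : Agree {0, 1, 2, 3, 6, 7, 8, 9} {1, 2, 3, 4} s s₂ :=
    ((Agree.refl _ _ _).trans f₁ (by decide) (by decide)).trans f₂ (by decide) (by decide)
  have hb1 : bits 1 ≤ β := hβ3.trans' (by decide)
  have hb0 : bits 0 ≤ β := hβ3.trans' (by decide)
  refine Prog.Runs.seq b₂ (Prog.Runs.assign (Q := fun s' => s'.Bdd β ∧ s' = s₂.setReg 8 1) b₂
    (by lia) ⟨b₂.setReg hb1, rfl⟩) ?_
  rintro s₃ ⟨b₃, rfl⟩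
  refine Prog.Runs.seq b₃ (Prog.Runs.assign
    (Q := fun s' => s'.Bdd β ∧ s' = (s₂.setReg 8 1).setReg 9 0) b₃
    (by lia) ⟨b₃.setReg hb0, rfl⟩) ?_
  rintro s₄ ⟨b₄, rfl⟩
  refine Prog.Runs.forLoop (m := N) (d := 4) (fun k s' =>
    Agree {0, 1, 2, 3, 6, 7, 8, 9} {1, 2, 3, 4} s s' ∧ s'.Bdd β ∧ s'.reg 6 = k ∧
      s'.Holds 1 (T.tailCharpoly (N - k)) ∧ FaddeevLeVerrierResult T (N - k) s') (by lia) b₄ hNβ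
      ⟨((a₂.setReg (by decide) _).setReg (by decide) _).setReg (by decide) _, b₄.setReg hb0,
        by simp, ?_, N, le_rfl, le_rfl, ?_, by lia, ?_, ?_, ?_⟩ ?_ ?_ ?_
  · rw [Nat.sub_zero, hcard.1]
    exact H₁.congr (f₂.bank 1 (by decide))
  · simp [hcard.2.1]
  · rw [hcard.2.2]
    exact H₂
  · simp [hcard.2.1]
  · simp
  · rintro k hk s' ⟨h1, h2, h3, -⟩
    exact ⟨h2, h3, hreg5 h1⟩
  · -- one step of the recursion
    rintro k hk s₅ ⟨a₅, b₅, k₅, H₅, R₅⟩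
    obtain ⟨j, hj⟩ : ∃ j, j + (k + 1) = N := ⟨N - (k + 1), by lia⟩
    rw [show N - k = j + 1 by lia] at H₅ R₅
    rw [show N - (k + 1) = j by lia]
    have hbd := abs_tailCharpoly_apply_le T hν hτ (j := j + 1) (k := k) (by lia)
    have hbd' := abs_tailCharpoly_apply_le T hν hτ (j := j) (k := k + 1) (by lia)
    have hk2 := hsmall k (by lia)
    have hk2' := hsmall (k + 1) (by lia)
    have hWb := abs_mul_apply_le (ν := ν) hν hτ hbd.1
    refine Prog.Runs.seq b₅ (tabulate_matrix_runs (T * T.tailCharpoly (j + 1)) (k := N)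
      (fun i i' l => T i l * T.tailCharpoly (j + 1) l i') (fun _ _ => mul_apply) b₅ hNβ hNβ hNβ
      (fun s' h => hreg5' a₅ h) (fun s' h => hreg5' a₅ h) (fun s' h => hreg5' a₅ h) ?_
      (ν := ν) hν (e := τ + k * (τ + 2 * ν + 1)) (fun i i' l => ?_) (by lia)) ?_
    · intro s' h i i' l h0 h1 h2
      have hT' := hT i l
      have hH' := H₅ l i'
      simp only [eval, eval_entry, h0, h1, h2, hreg5' a₅ h, h.bank 0 (by decide),
        h.bank 1 (by decide), a₅.bank 0 (by decide), hT', hH']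
    · rw [abs_mul, pow_add]
      exact mul_le_mul (hτ _ _) (hbd.1 _ _) (abs_nonneg _) (by positivity)
    rintro s₆ ⟨f₆, b₆, H₆⟩
    have a₆ := a₅.trans f₆ (by decide) (by decide)
    refine Prog.Runs.seq b₆ (tabulate_matrix_runs
      (of fun _ _ => trace (T * T.tailCharpoly (j + 1)) : Matrix (Fin 1) (Fin 1) ℤ) (k := N)
      (fun _ _ l => (T * T.tailCharpoly (j + 1)) l l) (fun _ _ => rfl) b₆ (by lia) (by lia) hNβ
      (fun _ _ => rfl) (fun _ _ => rfl) (fun s' h => hreg5' a₆ h) ?_ (ν := ν) hν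
      (fun i i' l => hWb _ _) (by lia)) ?_
    · intro s' h i i' l h0 h1 h2
      simp only [eval, eval_entry, h2, hreg5' a₆ h, h.bank 2 (by decide), H₆ l l]
    rintro s₇ ⟨f₇, b₇, H₇⟩
    have a₇ := a₆.trans f₇ (by decide) (by decide)
    have k₇ : s₇.reg 6 = k := by rw [f₇.reg 6 (by decide), f₆.reg 6 (by decide), k₅]
    have hc : (Expr.sub (.const 0) (.quot (.cell 4 (.const 0)) (.add (.reg 6) (.const 1)))).eval s₇
        = T.charpoly.coeff j := by
      have h := T.card_sub_mul_coeff_charpoly (j := j) (k := k + 1) (by simpa using hj)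
      have h4 : s₇.bank 4 0 = trace (T * T.tailCharpoly (j + 1)) := by simpa using H₇ 0 0
      simp only [eval, k₇, h4]
      rw [show trace (T * T.tailCharpoly (j + 1)) = ((k : ℤ) + 1) * -T.charpoly.coeff j by
        push_cast at h; linear_combination h, Int.mul_ediv_cancel_left _ (by lia)]
      ring
    refine Prog.Runs.seq b₇ (Prog.Runs.assign
      (Q := fun s' => s'.Bdd β ∧ s' = s₇.setReg 7 (T.charpoly.coeff j)) b₇ (by lia)
      (by rw [hc]; exact ⟨b₇.setReg (bits_le_of_abs_le hbd'.2 (by lia)), rfl⟩)) ?_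
    rintro s₈ ⟨b₈, hs₈⟩
    have a₈ : Agree {0, 1, 2, 3, 6, 7, 8, 9} {1, 2, 3, 4} s s₈ := by
      rw [hs₈]; exact a₇.setReg (by decide) _
    have k₈ : s₈.reg 6 = k := by rw [hs₈]; simpa using k₇
    have c₈ : s₈.reg 7 = T.charpoly.coeff j := by rw [hs₈]; simp
    have H₈ : s₈.Holds 1 (T.tailCharpoly (j + 1)) := by
      rw [hs₈]; exact (H₅.congr (f₆.bank 1 (by decide))).congr (f₇.bank 1 (by decide))
    have W₈ : s₈.Holds 2 (T * T.tailCharpoly (j + 1)) := by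
      rw [hs₈]; exact H₆.congr (f₇.bank 2 (by decide))
    have R₈ : FaddeevLeVerrierResult T (j + 1) s₈ := by
      obtain ⟨m, h1, h2, h3, h4, h5, h6, h7⟩ := R₅
      refine ⟨m, h1, h2, h3, h4, ?_, ?_, ?_⟩
      · rw [hs₈]; exact (h5.congr (f₆.bank 3 (by decide))).congr (f₇.bank 3 (by decide))
      · rw [hs₈, State.setReg_reg_of_ne _ _ _ (by decide), f₇.reg 8 (by decide),
          f₆.reg 8 (by decide), h6]
      · rw [hs₈, State.setReg_reg_of_ne _ _ _ (by decide), f₇.reg 9 (by decide),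
          f₆.reg 9 (by decide), h7]
    refine Prog.Runs.seq b₈ (Prog.Runs.ifPos (Q := fun s' =>
      Agree {0, 1, 2, 3, 6, 7, 8, 9} {1, 2, 3, 4} s s' ∧ s'.Bdd β ∧ s'.reg 6 = k ∧
      s'.reg 7 = T.charpoly.coeff j ∧ s'.Holds 2 (T * T.tailCharpoly (j + 1)) ∧
      FaddeevLeVerrierResult T j s') b₈ (by lia) ?_ ?_) ?_
    · intro hpos
      have hne : T.charpoly.coeff j ≠ 0 := by
        intro h
        simp [eval, c₈, h] at hpos
      refine Prog.Runs.seq b₈ (tabulate_matrix_runs (T.tailCharpoly (j + 1)) (k := 1)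
        (fun i i' _ => T.tailCharpoly (j + 1) i i') (by simp) b₈ hNβ hNβ (by lia)
        (fun s' h => hreg5' a₈ h) (fun s' h => hreg5' a₈ h) (fun _ _ => rfl) ?_
        (ν := 0) (by norm_num) (fun i i' _ => hbd.1 _ _) (by lia)) ?_
      · intro s' h i i' l h0 h1 h2
        simp only [eval, eval_entry, h0, h1, hreg5' a₈ h, h.bank 1 (by decide), H₈ i i']
      rintro s₉ ⟨f₉, b₉, H₉⟩
      have hc₉ : s₉.reg 7 = T.charpoly.coeff j := by rw [f₉.reg 7 (by decide), c₈]
      have hk₉ : s₉.reg 6 = k := by rw [f₉.reg 6 (by decide), k₈]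
      have b₁₀ := b₉.setReg (x := 8) (b₉.reg 7)
      refine Prog.Runs.seq b₉ (Prog.Runs.assign
        (Q := fun s' => s'.Bdd β ∧ s' = s₉.setReg 8 (s₉.reg 7)) b₉ (by lia) ⟨b₁₀, rfl⟩) ?_
      rintro _ ⟨-, rfl⟩
      refine Prog.Runs.assign b₁₀ (by lia) ?_
      have hv : (Expr.add (.reg 6) (.const 1)).eval (s₉.setReg 8 (s₉.reg 7)) = (k + 1 : ℕ) := by
        simp [eval, hk₉]
      rw [hv]
      refine ⟨((a₈.trans f₉ (by decide) (by decide)).setReg (by decide) _).setReg (by decide) _,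
        b₁₀.setReg (bits_natCast_le (by lia) hβ3), by simpa using hk₉, by simpa using hc₉,
        W₈.congr (f₉.bank 2 (by decide)), j, le_rfl, by lia, hne, by lia, H₉, ?_, ?_⟩
      · simp [hc₉]
      · simp only [State.setReg_reg_self]
        congr 1
        lia
    · intro hpos
      have hzero : T.charpoly.coeff j = 0 := by
        by_contra h
        exact hpos (by simpa [eval, c₈] using mul_self_pos.2 h)
      refine Prog.Runs.skip b₈ ⟨a₈, b₈, k₈, c₈, W₈, ?_⟩
      obtain ⟨m, h1, h2, h3, h4, h5⟩ := R₈
      refine ⟨m, by lia, h2, h3, fun i hi hji => ?_, h5⟩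
      rcases hji.eq_or_lt with rfl | hji
      exacts [hzero, h4 i hi hji]
    rintro s₉ ⟨a₉, b₉, k₉, c₉, W₉, R₉⟩
    refine Prog.Runs.mono (tabulate_matrix_runs (T.tailCharpoly j) (k := 1)
      (fun i i' _ => T.tailCharpoly j i i') (by simp) b₉ hNβ hNβ (by lia)
      (fun s' h => hreg5' a₉ h) (fun s' h => hreg5' a₉ h) (fun _ _ => rfl) ?_
      (ν := 0) (by norm_num) (fun i i' _ => hbd'.1 _ _) (by lia)) ?_
    · intro s' h i i' l h0 h1 h2
      rw [tailCharpoly_eq, Matrix.add_apply, Matrix.smul_apply, one_apply, smul_eq_mul]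
      simp only [eval, eval_entry, eval_ifEq, h0, h1, hreg5' a₉ h, h.bank 2 (by decide), W₉ i i',
        h.reg 7 (by decide), c₉, Nat.cast_inj, Fin.ext_iff]
    · rintro s' ⟨f, b, H⟩
      refine ⟨b, by rw [f.reg 6 (by decide), k₉],
        (a₉.trans f (by decide) (by decide)).setReg (by decide) _,
        b.setReg (bits_natCast_le (by lia) hβ3), by simp, H, ?_⟩
      obtain ⟨m, h1, h2, h3, h4, h5, h6, h7⟩ := R₉
      refine ⟨m, h1, h2, h3, h4, h5.congr (f.bank 3 (by decide)), ?_, ?_⟩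
      · rw [State.setReg_reg_of_ne _ _ _ (by decide), f.reg 8 (by decide), h6]
      · rw [State.setReg_reg_of_ne _ _ _ (by decide), f.reg 9 (by decide), h7]
  · rintro s' ⟨h1, h2, -, -, m, -, h3, h4, h5, h6, h7, h8⟩
    have hm : T.charpoly.natTrailingDegree = m := by
      refine le_antisymm (Polynomial.natTrailingDegree_le_of_ne_zero h4) ?_
      by_contra! h
      exact Polynomial.trailingCoeff_nonzero_iff_nonzero.2 T.charpoly_monic.ne_zero
        (h5 _ h (by lia))
    rw [hm]
    exact ⟨h1, h2, h6, h7, h8⟩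

end RAM

/-! ### Separable and nilpotent elements -/

namespace QAlg

open Polynomial TensorProduct

section Decomposition

variable {E : Type*} [CommRing E] [Algebra ℚ E]

theorem IsSeparableElement.map {F : Type*} [CommRing F] [Algebra ℚ F] {α : E}
    (h : IsSeparableElement α) (f : E →ₐ[ℚ] F) : IsSeparableElement (f α) := by
  obtain ⟨p, hp, h⟩ := h
  exact ⟨p, hp, by rw [aeval_algHom_apply, h, map_zero]⟩

theorem isSeparableElement_algebraMap (c : ℚ) : IsSeparableElement (algebraMap ℚ E c) :=
  ⟨X - C c, separable_X_sub_C, by simp⟩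

theorem isSeparableElement_of_isIdempotentElem {α : E} (h : IsIdempotentElem α) :
    IsSeparableElement α := by
  refine ⟨X * (X - C 1), separable_X.mul (separable_X_sub_C (x := (1 : ℚ))) ?_, ?_⟩
  · exact ⟨1, -1, by simp⟩
  · simp [mul_sub, h.eq]

variable (E) in
/-- The nilradical, as a vector space. -/
abbrev nilSubmodule : Submodule ℚ E := (nilradical E).restrictScalars ℚ

theorem mem_nilSubmodule {α : E} : α ∈ nilSubmodule E ↔ IsNilpotent α := mem_nilradical

variable [Module.Finite ℚ E]

/-- An element is separable if and only if multiplication by it is a semisimple endomorphism.  This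
makes the known stability properties of commuting semisimple endomorphisms available. -/
theorem isSeparableElement_iff (α : E) :
    IsSeparableElement α ↔ (Algebra.lmul ℚ E α : Module.End ℚ E).IsSemisimple := by
  constructor
  · rintro ⟨p, hp, h⟩
    refine Module.End.isSemisimple_of_squarefree_aeval_eq_zero hp.squarefree ?_
    rw [aeval_algHom_apply, h, map_zero]
  · intro h
    refine ⟨minpoly ℚ (Algebra.lmul ℚ E α), ?_, ?_⟩
    · exact PerfectField.separable_iff_squarefree.2 h.minpoly_squarefree
    · have := minpoly.aeval ℚ (Algebra.lmul ℚ E α)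
      rw [aeval_algHom_apply] at this
      exact (Algebra.lmul_injective (R := ℚ)) (by rw [this, map_zero])

variable (E) in
/-- The subalgebra of all separable elements. -/
def separableSubalgebra : Subalgebra ℚ E where
  carrier := {α | IsSeparableElement α}
  mul_mem' {x y} hx hy := by
    simp only [Set.mem_ofPred_eq, isSeparableElement_iff] at *
    rw [map_mul]
    exact hx.mul_of_commute ((Commute.all x y).map _) hy
  add_mem' {x y} hx hy := by
    simp only [Set.mem_ofPred_eq, isSeparableElement_iff] at *
    rw [map_add]
    exact hx.add_of_commute ((Commute.all x y).map _) hy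
  algebraMap_mem' := isSeparableElement_algebraMap

theorem mem_separableSubalgebra {α : E} : α ∈ separableSubalgebra E ↔ IsSeparableElement α :=
  Iff.rfl

theorem IsSeparableElement.add {x y : E} (hx : IsSeparableElement x) (hy : IsSeparableElement y) :
    IsSeparableElement (x + y) :=
  (separableSubalgebra E).add_mem (mem_separableSubalgebra.2 hx) (mem_separableSubalgebra.2 hy)

theorem IsSeparableElement.sub {x y : E} (hx : IsSeparableElement x) (hy : IsSeparableElement y) :
    IsSeparableElement (x - y) :=
  (separableSubalgebra E).sub_mem (mem_separableSubalgebra.2 hx) (mem_separableSubalgebra.2 hy)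

theorem IsSeparableElement.mul {x y : E} (hx : IsSeparableElement x) (hy : IsSeparableElement y) :
    IsSeparableElement (x * y) :=
  (separableSubalgebra E).mul_mem (mem_separableSubalgebra.2 hx) (mem_separableSubalgebra.2 hy)

theorem IsSeparableElement.smul {x : E} (hx : IsSeparableElement x) (c : ℚ) :
    IsSeparableElement (c • x) :=
  (separableSubalgebra E).smul_mem (mem_separableSubalgebra.2 hx) c

theorem IsSeparableElement.eq_zero_of_isNilpotent {α : E} (h : IsSeparableElement α)
    (h' : IsNilpotent α) : α = 0 := by
  rw [isSeparableElement_iff] at h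
  have := Module.End.eq_zero_of_isNilpotent_isSemisimple (h'.map (Algebra.lmul ℚ E)) h
  exact (Algebra.lmul_injective (R := ℚ)) (by rw [this, map_zero])

/-- The Jordan–Chevalley decomposition of an element. -/
theorem exists_isSeparableElement_add_isNilpotent (α : E) :
    ∃ u v : E, IsSeparableElement u ∧ IsNilpotent v ∧ u + v = α := by
  obtain ⟨f, hf, g, hg, hfn, hgs, h⟩ :=
    Module.End.exists_isNilpotent_isSemisimple (f := Algebra.lmul ℚ E α)
  -- both parts are polynomials in the multiplication by `α`
  have key : ∀ f ∈ Algebra.adjoin ℚ {Algebra.lmul ℚ E α}, ∃ u, Algebra.lmul ℚ E u = f := by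
    intro f hf
    obtain ⟨p, rfl⟩ := (Algebra.adjoin_singleton_eq_range_aeval ℚ (Algebra.lmul ℚ E α)).le hf
    exact ⟨aeval α p, (aeval_algHom_apply _ _ _).symm⟩
  obtain ⟨v, rfl⟩ := key f hf
  obtain ⟨u, rfl⟩ := key g hg
  refine ⟨u, v, (isSeparableElement_iff u).2 hgs, ?_, ?_⟩
  · obtain ⟨k, hk⟩ := hfn
    exact ⟨k, (Algebra.lmul_injective (R := ℚ)) (by rw [map_pow, hk, map_zero])⟩
  · exact (Algebra.lmul_injective (R := ℚ)) (by rw [map_add, h, add_comm])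

variable (E) in
theorem isCompl_separableSubalgebra_nilSubmodule :
    IsCompl (Subalgebra.toSubmodule (separableSubalgebra E)) (nilSubmodule E) := by
  refine ⟨Submodule.disjoint_def.2 fun x hx hx' => ?_,
    codisjoint_iff.2 (eq_top_iff.2 fun x _ => ?_)⟩
  · exact IsSeparableElement.eq_zero_of_isNilpotent hx (mem_nilSubmodule.1 hx')
  · obtain ⟨u, v, hu, hv, rfl⟩ := exists_isSeparableElement_add_isNilpotent x
    exact Submodule.add_mem_sup hu (mem_nilSubmodule.2 hv)

variable (E) in
/-- The projection to the separable part is a homomorphism of algebras. -/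
theorem exists_algHom_separable_part :
    ∃ π : E →ₐ[ℚ] E, ∀ x, IsSeparableElement (π x) ∧ IsNilpotent (x - π x) := by
  choose u v hu hv huv using exists_isSeparableElement_add_isNilpotent (E := E)
  have huniq : ∀ x w, IsSeparableElement w → IsNilpotent (x - w) → u x = w := by
    intro x w hw hx
    refine sub_eq_zero.1 (IsSeparableElement.eq_zero_of_isNilpotent
      ((hu x).sub hw) ?_)
    rw [show u x - w = (x - w) - v x by linear_combination huv x]
    exact (Commute.all _ _).isNilpotent_sub hx (hv x)
  have hsub : ∀ x, x - u x = v x := fun x => by linear_combination -huv x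
  refine ⟨AlgHom.ofLinearMap
    { toFun := u
      map_add' := fun x y => huniq _ _ ((hu x).add (hu y)) ?_
      map_smul' := fun c x => huniq _ _ ((hu x).smul c) ?_ }
    (huniq _ _ (mem_separableSubalgebra.1 (separableSubalgebra E).one_mem) (by simp))
    (fun x y => huniq _ _ ((hu x).mul (hu y)) ?_),
    fun x => ⟨hu x, ?_⟩⟩
  · rw [add_sub_add_comm, hsub, hsub]
    exact (Commute.all _ _).isNilpotent_add (hv x) (hv y)
  · rw [RingHom.id_apply, ← smul_sub, hsub]
    exact (hv x).smul c
  · change IsNilpotent (x * y - u x * u y)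
    rw [show x * y - u x * u y = v x * y + u x * v y by
      linear_combination (-y) * huv x - u x * huv y]
    exact (Commute.all _ _).isNilpotent_add ((Commute.all _ _).isNilpotent_mul_right (hv x))
      ((Commute.all _ _).isNilpotent_mul_left (hv y))
  · exact (hsub x).symm ▸ hv x

/-- The nilradical is the kernel of the trace form. -/
theorem isNilpotent_iff_trace_mul_eq_zero (x : E) :
    IsNilpotent x ↔ ∀ y, Algebra.trace ℚ E (x * y) = 0 := by
  refine ⟨fun h y => (Algebra.isNilpotent_trace_of_isNilpotent
    ((Commute.all _ _).isNilpotent_mul_right h)).eq_zero, fun h => ?_⟩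
  -- otherwise some multiple of `x` is a nonzero idempotent
  set p := minpoly ℚ x with hp
  have hp0 : p ≠ 0 := minpoly.ne_zero (Algebra.IsIntegral.isIntegral x)
  obtain ⟨q, hpq, hq⟩ := exists_eq_pow_rootMultiplicity_mul_and_not_dvd p hp0 0
  set m := p.rootMultiplicity 0
  rw [C_0, sub_zero] at hpq hq
  obtain ⟨a, c, hac⟩ : IsCoprime (X ^ (m + 1)) q :=
    IsCoprime.pow_left ((Polynomial.irreducible_X (R := ℚ)).coprime_iff_not_dvd.2 hq)
  have h0 : x ^ m * aeval x q = 0 := by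
    have h1 := minpoly.aeval ℚ x
    rwa [← hp, hpq, map_mul, map_pow, aeval_X] at h1
  have h1 : aeval x a * x ^ (m + 1) + aeval x c * aeval x q = 1 := by
    simpa using congrArg (aeval x) hac
  set y := aeval x a * x ^ m
  have hε : IsIdempotentElem (x * y) := by
    rw [IsIdempotentElem]
    linear_combination (x * y) * h1 - aeval x a * aeval x c * x * h0
  have h2 : x * y = 0 := by
    have h3 := LinearMap.IsIdempotentElem.eq_zero_of_trace_eq_zero
      (hε.map (Algebra.lmul ℚ E)) (h y)
    exact (Algebra.lmul_injective (R := ℚ)) (by rw [h3, map_zero])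
  exact ⟨m, by linear_combination (-x ^ m) * h1 + aeval x c * h0 + x ^ m * h2⟩

end Decomposition

section Criterion

variable {B : Type*} [CommRing B] [Algebra ℚ B]

/-- If `X ^ m * q` annihilates `δ` and `q 0 ≠ 0`, then `q(δ)` is von Neumann regular. -/
theorem exists_eq_mul_sq_of_aeval {q : ℚ[X]} (hq : q.coeff 0 ≠ 0) {m : ℕ} {δ : B}
    (h : aeval δ (X ^ m * q) = 0) : ∃ u, aeval δ q = u * aeval δ q ^ 2 := by
  have hco : IsCoprime (X ^ m) q := by
    refine IsCoprime.pow_left ((Polynomial.irreducible_X (R := ℚ)).coprime_iff_not_dvd.2 ?_)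
    rwa [X_dvd_iff]
  obtain ⟨a, b, hab⟩ := hco
  refine ⟨aeval δ b, ?_⟩
  calc aeval δ q = aeval δ (a * (X ^ m * q) + b * q ^ 2) := by
        congr 1
        linear_combination (-q) * hab
    _ = _ := by rw [map_add, map_mul, h, mul_zero, zero_add, map_mul, map_pow]

theorem isNilpotent_mul_aeval {q : ℚ[X]} {m : ℕ} {δ : B} (h : aeval δ (X ^ m * q) = 0) :
    IsNilpotent (δ * aeval δ q) := by
  refine ⟨m + 1, ?_⟩
  rw [map_mul, map_pow, aeval_X] at h
  linear_combination δ * aeval δ q ^ m * h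

theorem isUnit_aeval_of_isNilpotent {q : ℚ[X]} (hq : q.coeff 0 ≠ 0) {ν : B} (h : IsNilpotent ν) :
    IsUnit (aeval ν q) := by
  rw [← divX_mul_X_add q, map_add, map_mul, aeval_X, aeval_C, add_comm]
  exact IsNilpotent.isUnit_add_left_of_commute
    ((Commute.all _ _).isNilpotent_mul_left h) ((Ne.isUnit hq).map _) (Commute.all _ _)

theorem mul_eq_zero_of_isNilpotent_mul [Module.Finite ℚ B] {z u w : B} (hz : z = u * z ^ 2)
    (hw : IsSeparableElement w) (h : IsNilpotent (z * w)) : z * w = 0 := by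
  have hε : IsIdempotentElem (u * z) := by
    rw [IsIdempotentElem]
    linear_combination (-u) * hz
  have h1 : u * z * w = 0 := by
    refine IsSeparableElement.eq_zero_of_isNilpotent
      ((isSeparableElement_of_isIdempotentElem hε).mul hw) ?_
    rw [mul_assoc]
    exact (Commute.all _ _).isNilpotent_mul_left h
  linear_combination w * hz + z * h1

variable {E : Type*} [CommRing E] [Algebra ℚ E]

variable (E) in
/-- The map `x ↦ x ⊗ 1 - 1 ⊗ x`, whose values generate the ideal of the diagonal. -/
noncomputable def diagonalDiff : E →ₗ[ℚ] E ⊗[ℚ] E :=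
  (Algebra.TensorProduct.includeLeft (R := ℚ) (S := ℚ) (A := E) (B := E)).toLinearMap
    - (Algebra.TensorProduct.includeRight (R := ℚ) (A := E) (B := E)).toLinearMap

theorem diagonalDiff_apply (x : E) : diagonalDiff E x = x ⊗ₜ 1 - 1 ⊗ₜ x := rfl

/-- A criterion for separability that is linear in `x`: the product annihilates `x ⊗ 1 - 1 ⊗ x`. -/
theorem isSeparableElement_iff_prod_mul_diagonalDiff_eq_zero {n : ℕ} (b : Module.Basis (Fin n) ℚ E)
    (q : Fin n → ℚ[X]) (m : Fin n → ℕ) (hq : ∀ i, (q i).coeff 0 ≠ 0)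
    (hqm : ∀ i, aeval (diagonalDiff E (b i)) (X ^ m i * q i) = 0) (x : E) :
    IsSeparableElement x ↔ (∏ i, aeval (diagonalDiff E (b i)) (q i)) * diagonalDiff E x = 0 := by
  have := Module.Finite.of_basis b
  set z := ∏ i, aeval (diagonalDiff E (b i)) (q i) with hz
  constructor
  · intro hx
    choose u hu using fun i => exists_eq_mul_sq_of_aeval (hq i) (hqm i)
    refine mul_eq_zero_of_isNilpotent_mul (u := ∏ i, u i) ?_ ?_ ?_
    · rw [hz, ← Finset.prod_pow, ← Finset.prod_mul_distrib]
      exact Finset.prod_congr rfl fun i _ => hu i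
    · exact (hx.map (Algebra.TensorProduct.includeLeft (R := ℚ) (S := ℚ) (B := E))).sub
        (hx.map (Algebra.TensorProduct.includeRight (R := ℚ) (A := E)))
    · rw [← b.sum_repr x, map_sum, Finset.mul_sum]
      refine isNilpotent_sum fun i _ => ?_
      rw [map_smul, mul_smul_comm, hz, ← Finset.mul_prod_erase _ _ (Finset.mem_univ i)]
      refine IsNilpotent.smul ?_ _
      rw [mul_right_comm, mul_comm (aeval _ _)]
      exact (Commute.all _ _).isNilpotent_mul_right (isNilpotent_mul_aeval (hqm i))
  · intro h
    obtain ⟨π, hπ⟩ := exists_algHom_separable_part E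
    let ψ : E ⊗[ℚ] E →ₐ[ℚ] E := Algebra.TensorProduct.productMap (AlgHom.id ℚ E) π
    have hψ : ∀ y, ψ (diagonalDiff E y) = y - π y := fun y => by
      simp [ψ, diagonalDiff_apply]
    have h1 := congrArg ψ h
    rw [map_mul, map_zero, hψ, hz, map_prod] at h1
    have h2 : IsUnit (∏ i, ψ (aeval (diagonalDiff E (b i)) (q i))) := by
      refine IsUnit.prod_univ_iff.2 fun i => ?_
      rw [← aeval_algHom_apply, hψ]
      exact isUnit_aeval_of_isNilpotent (hq i) (hπ (b i)).2
    rw [h2.mul_right_eq_zero, sub_eq_zero] at h1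
    rw [h1]
    exact (hπ x).1

end Criterion

end QAlg

/-! ### Kernels and ranks from characteristic polynomials -/

namespace Matrix

open Polynomial

section Map

variable {n R S : Type*} [Fintype n] [DecidableEq n] [CommRing R] [CommRing S]

theorem X_pow_mul_divX_iterate {p : R[X]} {m : ℕ} (h : ∀ i < m, p.coeff i = 0) :
    X ^ m * divX^[m] p = p := by
  ext i
  rw [coeff_X_pow_mul', coeff_divX_iterate]
  split_ifs with hi
  · rw [Nat.sub_add_cancel hi]
  · exact (h i (by lia)).symm

theorem X_pow_natTrailingDegree_mul_divX_iterate (p : R[X]) :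
    X ^ p.natTrailingDegree * divX^[p.natTrailingDegree] p = p :=
  X_pow_mul_divX_iterate fun _ hi => coeff_eq_zero_of_lt_natTrailingDegree hi

theorem tailCharpoly_map (T : Matrix n n R) (f : R →+* S) (j : ℕ) :
    (T.map f).tailCharpoly j = (T.tailCharpoly j).map f := by
  have key : ∀ k j, Fintype.card n < j + k →
      (T.map f).tailCharpoly j = (T.tailCharpoly j).map f := by
    intro k
    induction k with
    | zero =>
      intro j hj
      rw [tailCharpoly_of_card_lt _ (by lia), tailCharpoly_of_card_lt _ (by lia)]
      exact (Matrix.map_zero _ (map_zero f)).symm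
    | succ k ih =>
      intro j hj
      rw [tailCharpoly_eq, tailCharpoly_eq T, ih (j + 1) (by lia), charpoly_map, coeff_map,
        ← RingHom.mapMatrix_apply, ← RingHom.mapMatrix_apply, ← RingHom.mapMatrix_apply, map_add,
        map_mul, ← Algebra.algebraMap_eq_smul_one, ← Algebra.algebraMap_eq_smul_one]
      congr 1
      ext i i'
      simp [algebraMap_matrix_apply, apply_ite f]
  exact key (Fintype.card n + 1) j (by lia)

theorem natTrailingDegree_charpoly_map (T : Matrix n n R) {f : R →+* S}
    (hf : Function.Injective f) :
    (T.map f).charpoly.natTrailingDegree = T.charpoly.natTrailingDegree := by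
  cases subsingleton_or_nontrivial R with
  | inl h =>
    have hz : T.charpoly = 0 := Subsingleton.elim _ _
    rw [charpoly_map, hz, Polynomial.map_zero, natTrailingDegree_zero, natTrailingDegree_zero]
  | inr h =>
  have := hf.nontrivial
  rw [charpoly_map]
  refine le_antisymm (natTrailingDegree_le_of_ne_zero ?_) (natTrailingDegree_le_of_ne_zero ?_)
  · rw [coeff_map, ne_eq, map_eq_zero_iff f hf]
    exact trailingCoeff_nonzero_iff_nonzero.2 T.charpoly_monic.ne_zero
  · have h := trailingCoeff_nonzero_iff_nonzero.2 ((T.charpoly_monic.map f).ne_zero)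
    rw [trailingCoeff, coeff_map] at h
    exact fun h' => h (by rw [h', map_zero])

end Map

section Gram

variable {ι κ : Type*} [Fintype ι] [Fintype κ] [DecidableEq κ] (C : Matrix ι κ ℚ)

omit [DecidableEq κ] in
theorem mulVec_eq_zero_of_gram_mulVec_eq_zero {v : κ → ℚ} (h : (Cᵀ * C) *ᵥ v = 0) : C *ᵥ v = 0 :=
  (Submodule.ext_iff.1 C.ker_mulVecLin_transpose_mul_self v).1 h

theorem mulVec_eq_zero_of_pow_mulVec_eq_zero {k : ℕ} {v : κ → ℚ}
    (h : (Cᵀ * C) ^ k *ᵥ v = 0) : C *ᵥ v = 0 := by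
  have hsymm : (Cᵀ * C)ᵀ = Cᵀ * C := by rw [transpose_mul, transpose_transpose]
  refine C.mulVec_eq_zero_of_gram_mulVec_eq_zero ?_
  induction k with
  | zero =>
    rw [pow_zero, one_mulVec] at h
    rw [h, mulVec_zero]
  | succ k ih =>
    rcases k.eq_zero_or_pos with rfl | hk
    · simpa using h
    · obtain ⟨k, rfl⟩ := Nat.exists_eq_add_of_le' hk
      refine ih ?_
      rw [pow_succ', ← mulVec_mulVec]
      refine (Cᵀ * C).mulVec_eq_zero_of_gram_mulVec_eq_zero ?_
      rw [hsymm, mulVec_mulVec, mul_assoc, ← pow_succ', ← pow_succ', h]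

theorem mul_tailCharpoly_gram :
    C * (Cᵀ * C).tailCharpoly (Cᵀ * C).charpoly.natTrailingDegree = 0 := by
  set G := Cᵀ * C with hG
  have h : G ^ G.charpoly.natTrailingDegree * G.tailCharpoly G.charpoly.natTrailingDegree = 0 := by
    have := congrArg (aeval G) (X_pow_natTrailingDegree_mul_divX_iterate G.charpoly)
    rwa [map_mul, map_pow, aeval_X, aeval_self_charpoly] at this
  refine ext_of_mulVec_single fun j => ?_
  rw [← mulVec_mulVec, zero_mulVec]
  refine C.mulVec_eq_zero_of_pow_mulVec_eq_zero (k := G.charpoly.natTrailingDegree) ?_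
  rw [← hG, mulVec_mulVec, h, zero_mulVec]

/-- The columns of the matrix computed by the Faddeev–LeVerrier recursion from a Gram matrix span
the kernel. -/
theorem span_col_tailCharpoly_gram :
    Submodule.span ℚ
      (Set.range ((Cᵀ * C).tailCharpoly (Cᵀ * C).charpoly.natTrailingDegree).col)
        = LinearMap.ker C.mulVecLin := by
  have h := C.mul_tailCharpoly_gram
  set G := Cᵀ * C with hG
  set m := G.charpoly.natTrailingDegree with hm
  rw [← range_mulVecLin]
  refine le_antisymm ?_ fun v hv => ?_
  · rintro _ ⟨v, rfl⟩
    rw [LinearMap.mem_ker, mulVecLin_apply, mulVecLin_apply, mulVec_mulVec, h, zero_mulVec]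
  · rw [LinearMap.mem_ker, mulVecLin_apply] at hv
    have hc : G.charpoly.coeff m ≠ 0 :=
      trailingCoeff_nonzero_iff_nonzero.2 G.charpoly_monic.ne_zero
    refine ⟨(G.charpoly.coeff m)⁻¹ • v, ?_⟩
    have hGv : G.tailCharpoly (m + 1) *ᵥ G *ᵥ v = 0 := by
      rw [hG, ← mulVec_mulVec, hv, mulVec_zero, mulVec_zero]
    have hcomm : G * G.tailCharpoly (m + 1) = G.tailCharpoly (m + 1) * G := by
      have := congrArg (aeval G) (mul_comm X (divX^[m + 1] G.charpoly))
      rwa [map_mul, map_mul, aeval_X] at this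
    rw [mulVecLin_apply, mulVec_smul, tailCharpoly_eq, add_mulVec, hcomm, ← mulVec_mulVec, hGv,
      zero_add, smul_mulVec, one_mulVec, smul_smul, inv_mul_cancel₀ hc, one_smul]

/-- The rank of a Gram matrix can be read off from its characteristic polynomial. -/
theorem card_sub_natTrailingDegree_charpoly_gram :
    Fintype.card κ - (Cᵀ * C).charpoly.natTrailingDegree = C.rank := by
  have h1 := LinearMap.finrank_maxGenEigenspace_zero_eq (toLin' (Cᵀ * C))
  have h2 : Module.End.maxGenEigenspace (toLin' (Cᵀ * C)) 0 = LinearMap.ker C.mulVecLin := by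
    ext v
    rw [Module.End.mem_maxGenEigenspace, LinearMap.mem_ker, mulVecLin_apply]
    simp only [zero_smul, sub_zero, ← toLin'_pow, toLin'_apply]
    refine ⟨fun ⟨k, hk⟩ => C.mulVec_eq_zero_of_pow_mulVec_eq_zero hk, fun h => ⟨1, ?_⟩⟩
    rw [pow_one, ← mulVec_mulVec, h, mulVec_zero]
  have h3 := LinearMap.finrank_range_add_finrank_ker C.mulVecLin
  rw [h2, charpoly_toLin'] at h1
  rw [Module.finrank_fintype_fun_eq_card] at h3
  rw [rank]
  lia

end Gram

/-- The Cayley–Hamilton theorem: up to the constant coefficient of the characteristic polynomial,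
the last nontrivial matrix of the recursion is inverse to `T`. -/
theorem mul_tailCharpoly_one {n R : Type*} [Fintype n] [DecidableEq n] [CommRing R]
    (T : Matrix n n R) : T * T.tailCharpoly 1 = -(T.charpoly.coeff 0 • 1) := by
  have := T.tailCharpoly_eq 0
  rw [tailCharpoly_zero] at this
  exact (neg_eq_of_add_eq_zero_left this.symm).symm

end Matrix

section Greedy

open Submodule

variable {V : Type*} [AddCommGroup V] [Module ℚ V]

/-- One step of the greedy extraction of a basis. -/
theorem linearIndependent_snoc_of_finrank_span_eq {r : ℕ} {w : Fin r → V}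
    {x : V} (h : Module.finrank ℚ (span ℚ (Set.range (Fin.snoc w x : Fin (r + 1) → V))) = r + 1) :
    LinearIndependent ℚ (Fin.snoc w x : Fin (r + 1) → V) := by
  rw [linearIndependent_iff_card_eq_finrank_span, Set.finrank, h, Fintype.card_fin]

theorem mem_span_of_finrank_span_snoc_ne {r : ℕ} {w : Fin r → V} (hw : LinearIndependent ℚ w)
    {x : V} (h : Module.finrank ℚ (span ℚ (Set.range (Fin.snoc w x : Fin (r + 1) → V))) ≠ r + 1) :
    x ∈ span ℚ (Set.range w) ∧
      Module.finrank ℚ (span ℚ (Set.range (Fin.snoc w x : Fin (r + 1) → V))) = r := by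
  have hx : x ∈ span ℚ (Set.range w) := by
    by_contra hx
    exact h (by simpa using finrank_span_eq_card (linearIndependent_finSnoc.2 ⟨hw, hx⟩))
  refine ⟨hx, ?_⟩
  rw [Fin.range_snoc, span_insert_eq_span hx, finrank_span_eq_card hw, Fintype.card_fin]

end Greedy

/-! ### Linear systems for the separable and the nilpotent elements -/

namespace QAlg

open Polynomial TensorProduct Matrix

/-- The integer matrix of multiplication by `e i ⊗ 1 - 1 ⊗ e i` on the tensor square of an algebra
with structure constants `α`; the pair of indices `(k, l)` is numbered `k * n + l`. -/
def diffMatrix {n : ℕ} (α : Fin n → Fin n → Fin n → ℤ) (i : Fin n) :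
    Matrix (Fin (n * n)) (Fin (n * n)) ℤ :=
  of fun r c => (if r.modNat = c.modNat then α i c.divNat r.divNat else 0)
    - (if r.divNat = c.divNat then α i c.modNat r.modNat else 0)

/-- The matrix `q(T)`, where the characteristic polynomial of `T` is `X ^ m * q` with
`q 0 ≠ 0`. -/
noncomputable def fittingMatrix {N : ℕ} (T : Matrix (Fin N) (Fin N) ℤ) :
    Matrix (Fin N) (Fin N) ℤ :=
  T.tailCharpoly T.charpoly.natTrailingDegree

/-- The product of the first `k` matrices `fittingMatrix (diffMatrix α i)`. -/
noncomputable def fittingProduct {n : ℕ} (α : Fin n → Fin n → Fin n → ℤ) :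
    ℕ → Matrix (Fin (n * n)) (Fin (n * n)) ℤ
  | 0 => 1
  | k + 1 => fittingProduct α k *
      if h : k < n then fittingMatrix (diffMatrix α ⟨k, h⟩) else 1

/-- The coefficients of the linear system for the coordinates of separable elements: row `i`
consists of the entries of the matrix of `z * (e i ⊗ 1 - 1 ⊗ e i)`, where `z` is the product of the
`fittingMatrix (diffMatrix α i)`. -/
noncomputable def separableSystem {n : ℕ} (α : Fin n → Fin n → Fin n → ℤ) :
    Matrix (Fin n) (Fin (n * n * (n * n))) ℤ :=
  of fun i l => (fittingProduct α n * diffMatrix α i) l.divNat l.modNat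

/-- The matrix of the trace form `(x, y) ↦ trace (x * y)`. -/
def traceSystem {n : ℕ} (α : Fin n → Fin n → Fin n → ℤ) : Matrix (Fin n) (Fin n) ℤ :=
  of fun i j => ∑ l : Fin (n * n), α i l.divNat l.modNat * α j l.modNat l.divNat

/-- The vectors `x` with `∑ i, x i * K i l = 0` for all `l`. -/
def solutions {n M : ℕ} (K : Matrix (Fin n) (Fin M) ℤ) : Submodule ℚ (Fin n → ℚ) :=
  LinearMap.ker (K.map (Int.castRingHom ℚ))ᵀ.mulVecLin

theorem mem_solutions {n M : ℕ} {K : Matrix (Fin n) (Fin M) ℤ} {x : Fin n → ℚ} :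
    x ∈ solutions K ↔ ∀ l, ∑ i, x i * K i l = 0 := by
  rw [solutions, LinearMap.mem_ker, mulVecLin_apply, funext_iff]
  refine forall_congr' fun l => ?_
  simp [mulVec, dotProduct, mul_comm]

/-- A vector of integers, regarded as a vector of rational numbers. -/
def ratVec {n : ℕ} (v : Fin n → ℤ) : Fin n → ℚ := fun j => v j

theorem gram_map {n M : ℕ} (K : Matrix (Fin n) (Fin M) ℤ) :
    (K * Kᵀ).map (Int.castRingHom ℚ)
      = ((K.map (Int.castRingHom ℚ))ᵀ)ᵀ * (K.map (Int.castRingHom ℚ))ᵀ := by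
  rw [Matrix.map_mul, transpose_transpose, transpose_map]

/-- The solution space of a linear system, from the Gram matrix of its coefficient matrix. -/
theorem span_col_fittingMatrix {n M : ℕ} (K : Matrix (Fin n) (Fin M) ℤ) :
    Submodule.span ℚ (Set.range fun t => ratVec fun j => fittingMatrix (K * Kᵀ) j t)
      = solutions K := by
  rw [solutions, ← span_col_tailCharpoly_gram, ← gram_map,
    natTrailingDegree_charpoly_map _ (RingHom.injective_int _), tailCharpoly_map]
  rfl

/-- The rank of a matrix, read off from the characteristic polynomial of its Gram matrix. -/
theorem sub_natTrailingDegree_charpoly_gram {n r : ℕ} (W : Matrix (Fin r) (Fin n) ℤ) :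
    n - (Wᵀ * W).charpoly.natTrailingDegree
      = Module.finrank ℚ (Submodule.span ℚ (Set.range fun i => ratVec (W i))) := by
  have h := gram_map Wᵀ
  have h' := card_sub_natTrailingDegree_charpoly_gram (Wᵀ.map (Int.castRingHom ℚ))ᵀ
  rw [← h, natTrailingDegree_charpoly_map _ (RingHom.injective_int _), transpose_transpose,
    Fintype.card_fin, transpose_map, transpose_transpose, rank_eq_finrank_span_row] at h'
  exact h'

section Algebra

variable {n : ℕ} {E : Type*} [CommRing E] [Algebra ℚ E] (b : Module.Basis (Fin n) ℚ E)
  (α : Fin n → Fin n → Fin n → ℤ) (hα : ∀ i j k, structureConstants b i j k = α i j k)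

include hα in
theorem leftMulMatrix_diagonalDiff (i : Fin n) :
    Algebra.leftMulMatrix ((b.tensorProduct b).reindex finProdFinEquiv) (diagonalDiff E (b i))
      = (diffMatrix α i).map (Int.castRingHom ℚ) := by
  ext r c
  have hr : finProdFinEquiv.symm r = (r.divNat, r.modNat) := rfl
  have hc : finProdFinEquiv.symm c = (c.divNat, c.modNat) := rfl
  simp only [structureConstants] at hα
  rw [Algebra.leftMulMatrix_eq_repr_mul, Module.Basis.repr_reindex_apply,
    Module.Basis.reindex_apply, hr, hc, Module.Basis.tensorProduct_apply, diagonalDiff_apply,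
    sub_mul, Algebra.TensorProduct.tmul_mul_tmul, Algebra.TensorProduct.tmul_mul_tmul, one_mul,
    one_mul, map_sub, Finsupp.sub_apply, Module.Basis.tensorProduct_repr_tmul_apply,
    Module.Basis.tensorProduct_repr_tmul_apply, hα, hα]
  simp [diffMatrix, Finsupp.single_apply, eq_comm]

include hα in
theorem isSeparableElement_iff_mem_solutions (x : Fin n → ℚ) :
    IsSeparableElement (b.equivFun.symm x) ↔ x ∈ solutions (separableSystem α) := by
  set b' := (b.tensorProduct b).reindex finProdFinEquiv
  set q : Fin n → ℚ[X] := fun i =>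
    divX^[((diffMatrix α i).map (Int.castRingHom ℚ)).charpoly.natTrailingDegree]
      ((diffMatrix α i).map (Int.castRingHom ℚ)).charpoly with hq
  have hδ : ∀ i, Algebra.leftMulMatrix b' (diagonalDiff E (b i))
      = (diffMatrix α i).map (Int.castRingHom ℚ) := leftMulMatrix_diagonalDiff b α hα
  have hfit : ∀ i, Algebra.leftMulMatrix b' (aeval (diagonalDiff E (b i)) (q i))
      = (fittingMatrix (diffMatrix α i)).map (Int.castRingHom ℚ) := by
    intro i
    rw [← aeval_algHom_apply, hδ, fittingMatrix, ← tailCharpoly_map,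
      ← natTrailingDegree_charpoly_map _ (RingHom.injective_int (Int.castRingHom ℚ))]
    rfl
  have hprod : ∀ k ≤ n, (fittingProduct α k).map (Int.castRingHom ℚ) = Algebra.leftMulMatrix b'
      (∏ i ∈ Finset.range k,
        if h : i < n then aeval (diagonalDiff E (b ⟨i, h⟩)) (q ⟨i, h⟩) else 1) := by
    intro k
    induction k with
    | zero =>
      intro _
      rw [Finset.prod_range_zero, map_one, fittingProduct]
      exact map_one (Int.castRingHom ℚ).mapMatrix
    | succ k ih =>
      intro hk
      rw [Finset.prod_range_succ, map_mul, ← ih (by lia), dif_pos (show k < n by lia), hfit,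
        fittingProduct, dif_pos (show k < n by lia), Matrix.map_mul]
  have hz := hprod n le_rfl
  rw [Finset.prod_range] at hz
  simp only [Fin.is_lt, dif_pos, Fin.eta] at hz
  rw [isSeparableElement_iff_prod_mul_diagonalDiff_eq_zero b q
    (fun i => ((diffMatrix α i).map (Int.castRingHom ℚ)).charpoly.natTrailingDegree) ?_ ?_]
  · rw [← (Algebra.leftMulMatrix_injective b').eq_iff, map_zero, map_mul, ← hz, mem_solutions,
      Module.Basis.equivFun_symm_apply, map_sum, map_sum]
    simp only [map_smul, hδ]
    have h1 : ∀ l : Fin (n * n * (n * n)), ∑ i, x i * (separableSystem α i l : ℚ)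
        = ((fittingProduct α n).map (Int.castRingHom ℚ)
          * ∑ i, x i • (diffMatrix α i).map (Int.castRingHom ℚ)) l.divNat l.modNat := by
      intro l
      rw [Finset.mul_sum, Matrix.sum_apply]
      refine Finset.sum_congr rfl fun i _ => ?_
      rw [Matrix.mul_smul, Matrix.smul_apply, smul_eq_mul, ← Matrix.map_mul]
      rfl
    simp only [h1]
    constructor
    · intro h l
      rw [h]
      rfl
    · intro h
      ext r c
      have := h (finProdFinEquiv (r, c))
      have hr : (finProdFinEquiv (r, c)).divNat = r :=
        congrArg Prod.fst (finProdFinEquiv.symm_apply_apply (r, c))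
      have hc : (finProdFinEquiv (r, c)).modNat = c :=
        congrArg Prod.snd (finProdFinEquiv.symm_apply_apply (r, c))
      rwa [hr, hc] at this
  · intro i
    rw [hq, coeff_divX_iterate, zero_add]
    exact trailingCoeff_nonzero_iff_nonzero.2 (charpoly_monic _).ne_zero
  · intro i
    rw [hq, X_pow_natTrailingDegree_mul_divX_iterate]
    refine Algebra.leftMulMatrix_injective b' ?_
    rw [← aeval_algHom_apply, hδ, aeval_self_charpoly, map_zero]

include hα in
theorem trace_mul_eq_traceSystem (i j : Fin n) :
    Algebra.trace ℚ E (b i * b j) = traceSystem α i j := by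
  simp only [structureConstants] at hα
  rw [Algebra.trace_eq_matrix_trace b, map_mul, trace]
  simp only [diag_apply, mul_apply, Algebra.leftMulMatrix_eq_repr_mul, hα]
  rw [Finset.sum_comm, ← Finset.sum_product', Finset.univ_product_univ, traceSystem, of_apply,
    Int.cast_sum, ← finProdFinEquiv.symm.sum_comp]
  refine Finset.sum_congr rfl fun l _ => ?_
  rw [Int.cast_mul]
  rfl

include hα in
theorem isNilpotent_iff_mem_solutions (x : Fin n → ℚ) :
    IsNilpotent (b.equivFun.symm x) ↔ x ∈ solutions (traceSystem α) := by
  have := Module.Finite.of_basis b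
  have h1 : ∀ j, Algebra.trace ℚ E (b.equivFun.symm x * b j)
      = ∑ i, x i * (traceSystem α i j : ℚ) := by
    intro j
    rw [Module.Basis.equivFun_symm_apply, Finset.sum_mul, map_sum]
    refine Finset.sum_congr rfl fun i _ => ?_
    rw [smul_mul_assoc, map_smul, trace_mul_eq_traceSystem b α hα, smul_eq_mul]
  rw [isNilpotent_iff_trace_mul_eq_zero, mem_solutions]
  simp only [← h1]
  refine ⟨fun h j => h _, fun h y => ?_⟩
  rw [← b.sum_repr y, Finset.mul_sum, map_sum]
  refine Finset.sum_eq_zero fun j _ => ?_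
  rw [mul_smul_comm, map_smul, h, smul_zero]

/-- Multiplying a basis by `d` multiplies the structure constants by `d`. -/
theorem structureConstants_unitsSMul (d : ℚˣ) (i j k : Fin n) :
    structureConstants (b.unitsSMul fun _ => d) i j k = d * structureConstants b i j k := by
  rw [structureConstants, structureConstants, Module.Basis.repr_unitsSMul,
    Module.Basis.unitsSMul_apply, Module.Basis.unitsSMul_apply, Units.smul_def, Units.smul_def,
    Units.smul_def, smul_mul_smul_comm, map_smul, Finsupp.smul_apply, smul_eq_mul, smul_eq_mul,
    ← mul_assoc, ← mul_assoc, Units.inv_mul, one_mul]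

theorem equivFun_symm_unitsSMul (d : ℚˣ) (x : Fin n → ℚ) :
    (b.unitsSMul fun _ => d).equivFun.symm x = (d : ℚ) • b.equivFun.symm x := by
  rw [Module.Basis.equivFun_symm_apply, Module.Basis.equivFun_symm_apply, Finset.smul_sum]
  refine Finset.sum_congr rfl fun i _ => ?_
  rw [Module.Basis.unitsSMul_apply, Units.smul_def, smul_comm]

section Denominator

variable {d : ℤ} (hd : d ≠ 0) (hdα : ∀ i j k, d * structureConstants b i j k = α i j k)

include hd hdα

theorem isSeparableElement_iff_mem_solutions_of_mul (x : Fin n → ℚ) :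
    IsSeparableElement (b.equivFun.symm x) ↔ x ∈ solutions (separableSystem α) := by
  have := Module.Finite.of_basis b
  have hd' : (d : ℚ) ≠ 0 := Int.cast_ne_zero.2 hd
  rw [← isSeparableElement_iff_mem_solutions (b.unitsSMul fun _ => Units.mk0 (d : ℚ) hd') α
    fun i j k => by rw [structureConstants_unitsSMul, ← hdα, Units.val_mk0],
    equivFun_symm_unitsSMul, Units.val_mk0]
  refine ⟨fun h => h.smul _, fun h => ?_⟩
  rw [← inv_smul_smul₀ hd' (b.equivFun.symm x)]
  exact h.smul _

theorem isNilpotent_iff_mem_solutions_of_mul (x : Fin n → ℚ) :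
    IsNilpotent (b.equivFun.symm x) ↔ x ∈ solutions (traceSystem α) := by
  have hd' : (d : ℚ) ≠ 0 := Int.cast_ne_zero.2 hd
  rw [← isNilpotent_iff_mem_solutions (b.unitsSMul fun _ => Units.mk0 (d : ℚ) hd') α
    fun i j k => by rw [structureConstants_unitsSMul, ← hdα, Units.val_mk0],
    equivFun_symm_unitsSMul, Units.val_mk0]
  refine ⟨fun h => h.smul _, fun h => ?_⟩
  rw [← inv_smul_smul₀ hd' (b.equivFun.symm x)]
  exact h.smul _

end Denominator

/-- The numbering of the `m + (n - m)` vectors that make up a basis. -/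
def splittingIndex {m : ℕ} (hm : m ≤ n) (s : Fin m ⊕ Fin (n - m)) : Fin n :=
  Fin.cast (by lia) (finSumFinEquiv s)

theorem splittingIndex_injective {m : ℕ} (hm : m ≤ n) : Function.Injective (splittingIndex hm) :=
  (Fin.cast_injective _).comp finSumFinEquiv.injective

/-- The integer `x` in the entry `x / d` of the inverse of the matrix with columns `W i`, where
`d` is the square of the determinant. -/
noncomputable def inverseNumerator (W : Matrix (Fin n) (Fin n) ℤ) (i j : Fin n) : ℤ :=
  -Wᵀ.charpoly.coeff 0 * Wᵀ.tailCharpoly 1 i j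

/-- The matrix with columns `W i`. -/
def splittingMatrix (W : Matrix (Fin n) (Fin n) ℤ) {m : ℕ} (hm : m ≤ n) :
    Matrix (Fin n) (Fin m ⊕ Fin (n - m)) ℚ :=
  of fun j s => (W (splittingIndex hm s) j : ℚ)

/-- The inverse of the matrix with columns `W i`, by the Cayley-Hamilton theorem. -/
noncomputable def splittingInverse (W : Matrix (Fin n) (Fin n) ℤ) {m : ℕ} (hm : m ≤ n) :
    Matrix (Fin m ⊕ Fin (n - m)) (Fin n) ℚ :=
  of fun s j => (inverseNumerator W (splittingIndex hm s) j : ℚ) /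
      ((Wᵀ.charpoly.coeff 0 * Wᵀ.charpoly.coeff 0 : ℤ) : ℚ)

/-- The output for an algebra of dimension `n`: the rows of `W` form the basis of the algebra that
consists of a basis of the separable subalgebra, of length `m`, and of a basis of the nilradical.
-/
noncomputable def splittingData (W : Matrix (Fin n) (Fin n) ℤ) (m : ℕ) (hm : m ≤ n) :
    SplittingData n where
  m := m
  l := n - m
  U := of fun i j => (W (splittingIndex hm (Sum.inl i)) j : ℚ)
  V := of fun i j => (W (splittingIndex hm (Sum.inr i)) j : ℚ)
  A := splittingMatrix W hm
  B := splittingInverse W hm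

theorem coeff_zero_charpoly_ne_zero {W : Matrix (Fin n) (Fin n) ℤ}
    (hW : LinearIndependent ℚ fun i => ratVec (W i)) : Wᵀ.charpoly.coeff 0 ≠ 0 := by
  have h1 : IsUnit (W.map (Int.castRingHom ℚ)) := linearIndependent_rows_iff_isUnit.1 hW
  rw [isUnit_iff_isUnit_det, isUnit_iff_ne_zero, ← RingHom.mapMatrix_apply, ← RingHom.map_det] at h1
  rw [charpoly_transpose]
  intro h
  refine h1 ?_
  rw [det_eq_sign_charpoly_coeff, h, mul_zero, map_zero]

/-- The data built from `W` are correct if the first `m` rows of `W` span the space of the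
coordinate vectors of separable elements and the other rows are coordinate vectors of nilpotent
elements: by comparison of dimensions, both families are bases. -/
theorem splittingData_isCorrect {W : Matrix (Fin n) (Fin n) ℤ} {m : ℕ} (hm : m ≤ n)
    (hW : LinearIndependent ℚ fun i => ratVec (W i))
    {S N : Submodule ℚ (Fin n → ℚ)}
    (hsep : ∀ x, IsSeparableElement (b.equivFun.symm x) ↔ x ∈ S)
    (hnil : ∀ x, IsNilpotent (b.equivFun.symm x) ↔ x ∈ N)
    (hS : Submodule.span ℚ (Set.range fun i : Fin m => ratVec (W (splittingIndex hm (Sum.inl i))))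
      = S)
    (hN : ∀ i : Fin n, m ≤ (i : ℕ) → ratVec (W i) ∈ N) :
    (splittingData W m hm).IsCorrect b := by
  have := Module.Finite.of_basis b
  set e := b.equivFun.symm
  have hcompl := isCompl_separableSubalgebra_nilSubmodule E
  have hWe : LinearIndependent ℚ fun i => e (ratVec (W i)) :=
    hW.map' e.toLinearMap (LinearMap.ker_eq_bot.2 e.injective)
  -- the dimensions of the two summands
  have hfS : Module.finrank ℚ (Subalgebra.toSubmodule (separableSubalgebra E)) = m := by
    have h1 : Subalgebra.toSubmodule (separableSubalgebra E)
        = (S).map e.toLinearMap := by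
      ext y
      rw [Submodule.mem_map]
      constructor
      · intro hy
        refine ⟨e.symm y, ?_, e.apply_symm_apply y⟩
        rw [← hsep]
        have := mem_separableSubalgebra.1 hy
        rwa [← e.apply_symm_apply y] at this
      · rintro ⟨x, hx, rfl⟩
        exact mem_separableSubalgebra.2 ((hsep x).2 hx)
    rw [h1, LinearEquiv.finrank_map_eq, ← hS, finrank_span_eq_card, Fintype.card_fin]
    exact hW.comp _ ((splittingIndex_injective hm).comp Sum.inl_injective)
  have hfN : Module.finrank ℚ (nilSubmodule E) = n - m := by
    have h1 := Submodule.finrank_add_eq_of_isCompl hcompl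
    rw [hfS, Module.finrank_eq_card_basis b, Fintype.card_fin] at h1
    lia
  let vS : Fin m → separableSubalgebra E := fun i =>
    ⟨e (ratVec (W (splittingIndex hm (Sum.inl i)))), by
    refine mem_separableSubalgebra.2 ((hsep _).2 ?_)
    rw [← hS]
    exact Submodule.subset_span ⟨i, rfl⟩⟩
  let vN : Fin (n - m) → nilSubmodule E := fun i =>
    ⟨e (ratVec (W (splittingIndex hm (Sum.inr i)))), by
      refine mem_nilSubmodule.2 ((hnil _).2 (hN _ ?_))
      simp [splittingIndex]⟩
  have hvS : LinearIndependent ℚ vS :=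
    LinearIndependent.of_comp (separableSubalgebra E).val.toLinearMap
      (hWe.comp _ ((splittingIndex_injective hm).comp Sum.inl_injective))
  have hvN : LinearIndependent ℚ vN := LinearIndependent.of_comp (nilSubmodule E).subtype
      (hWe.comp _ ((splittingIndex_injective hm).comp Sum.inr_injective))
  let bS : Module.Basis (Fin m) ℚ (separableSubalgebra E) := Module.Basis.mk hvS
    (hvS.span_eq_top_of_card_eq_finrank' (by rw [Fintype.card_fin]; exact hfS.symm)).ge
  let bN : Module.Basis (Fin (n - m)) ℚ (nilSubmodule E) := Module.Basis.mk hvN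
    (hvN.span_eq_top_of_card_eq_finrank' (by rw [Fintype.card_fin]; exact hfN.symm)).ge
  have hbS : ∀ i j, b.repr (bS i : E) j = W (splittingIndex hm (Sum.inl i)) j := by
    intro i j
    rw [Module.Basis.mk_apply]
    exact congrFun (b.equivFun.apply_symm_apply _) j
  have hbN : ∀ i j, b.repr (bN i : E) j = W (splittingIndex hm (Sum.inr i)) j := by
    intro i j
    rw [Module.Basis.mk_apply]
    exact congrFun (b.equivFun.apply_symm_apply _) j
  let φ : (separableSubalgebra E × nilSubmodule E) ≃ₗ[ℚ] E :=
    Submodule.prodEquivOfIsCompl _ _ hcompl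
  have hφ : ∀ (u : separableSubalgebra E) (v : nilSubmodule E), φ (u, v) = (u : E) + (v : E) :=
    fun u v => Submodule.coe_prodEquivOfIsCompl' _ _ hcompl (u, v)
  have hA : splittingMatrix W hm = LinearMap.toMatrix (bS.prod bN) b φ.toLinearMap := by
    ext j s
    rw [LinearMap.toMatrix_apply]
    rcases s with i | i
    · rw [Module.Basis.prod_apply]
      simp only [LinearEquiv.coe_coe, Sum.elim_inl, Function.comp_apply, LinearMap.inl_apply, hφ,
        Submodule.coe_zero, add_zero, hbS]
      rfl
    · rw [Module.Basis.prod_apply]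
      simp only [LinearEquiv.coe_coe, Sum.elim_inr, Function.comp_apply, LinearMap.inr_apply, hφ,
        ZeroMemClass.coe_zero, zero_add, hbN]
      rfl
  refine ⟨separableSubalgebra E, nilSubmodule E, bS, bN, φ, rfl, rfl, hφ, fun i j => (hbS i j).symm,
    fun i j => (hbN i j).symm, hA, ?_⟩
  -- the last matrix is a left inverse of `A`
  have hp := coeff_zero_charpoly_ne_zero hW
  have hBA : splittingInverse W hm * splittingMatrix W hm = 1 := by
    have hcomm : Wᵀ.tailCharpoly 1 * Wᵀ = -(Wᵀ.charpoly.coeff 0 • 1) := by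
      rw [← mul_tailCharpoly_one]
      have := congrArg (aeval Wᵀ) (mul_comm (divX^[1] Wᵀ.charpoly) X)
      rwa [map_mul, map_mul, aeval_X] at this
    ext s s'
    have h1 := congrFun (congrFun hcomm (splittingIndex hm s))
      (splittingIndex hm s')
    rw [mul_apply, Matrix.neg_apply, Matrix.smul_apply, one_apply] at h1
    rw [if_congr (splittingIndex_injective hm).eq_iff rfl rfl] at h1
    have hp' : (Wᵀ.charpoly.coeff 0 : ℚ) ≠ 0 := by exact_mod_cast hp
    have h3 : ∑ j, (Wᵀ.tailCharpoly 1 (splittingIndex hm s) j : ℚ)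
        * W (splittingIndex hm s') j
          = -(Wᵀ.charpoly.coeff 0 * if s = s' then 1 else 0) := by
      have := congrArg (Int.cast : ℤ → ℚ) h1
      push_cast at this
      simpa using this
    have h4 : (splittingInverse W hm * splittingMatrix W hm) s s'
        = (-(Wᵀ.charpoly.coeff 0 : ℚ) / (Wᵀ.charpoly.coeff 0 * Wᵀ.charpoly.coeff 0)) *
          ∑ j, (Wᵀ.tailCharpoly 1 (splittingIndex hm s) j : ℚ)
            * W (splittingIndex hm s') j := by
      rw [mul_apply, Finset.mul_sum]
      refine Finset.sum_congr rfl fun j _ => ?_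
      simp only [splittingInverse, splittingMatrix, inverseNumerator, of_apply]
      push_cast
      ring
    rw [h4, h3, one_apply]
    field_simp
  have hAX : splittingMatrix W hm *
      LinearMap.toMatrix b (bS.prod bN) φ.symm.toLinearMap = 1 := by
    rw [hA, ← LinearMap.toMatrix_comp b (bS.prod bN) b]
    simp
  change splittingInverse W hm = _
  rw [← Matrix.mul_one (splittingInverse W hm), ← hAX, ← Matrix.mul_assoc, hBA, Matrix.one_mul]
  rfl

end Algebra

end QAlg

/-! ### Input and output of rational numbers -/

namespace RAM

open RAM.Expr QAlg

/-- The state `s` after writing `w`. -/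
def State.append (s : State) (w : List ℤ) : State := { s with out := s.out ++ w }

theorem State.Bdd.append {β : ℕ} {s : State} (h : s.Bdd β) (w : List ℤ) : (s.append w).Bdd β :=
  ⟨h.le, h.reg, h.bank, h.inp⟩

theorem Agree.append {R B : Finset ℕ} {s s' : State} (h : Agree R B s s') (w : List ℤ) :
    Agree R B (s.append w) (s'.append w) :=
  ⟨h.reg, h.bank, h.inp, by simp [State.append, h.out]⟩

theorem State.append_append (s : State) (v w : List ℤ) :
    (s.append v).append w = s.append (v ++ w) := by
  simp [State.append]

theorem State.append_nil (s : State) : s.append [] = s := by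
  simp [State.append]

theorem encodeRat_div (x : ℤ) {d : ℤ} (hd : 0 < d) :
    encodeRat ((x : ℚ) / d) = [x / (Int.gcd x d : ℤ), d / (Int.gcd x d : ℤ)] := by
  have hg : 0 < Int.gcd x d := Int.gcd_pos_of_ne_zero_right _ hd.ne'
  obtain ⟨x', hx⟩ := Int.gcd_dvd_left x d
  obtain ⟨d', hd'⟩ := Int.gcd_dvd_right x d
  have hg' : (0 : ℤ) < Int.gcd x d := by exact_mod_cast hg
  have hd'0 : 0 < d' := by
    rw [hd'] at hd
    exact pos_of_mul_pos_right hd hg'.le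
  have hx' : x / (Int.gcd x d : ℤ) = x' := Int.ediv_eq_of_eq_mul_right hg'.ne' hx
  have hd'' : d / (Int.gcd x d : ℤ) = d' := Int.ediv_eq_of_eq_mul_right hg'.ne' hd'
  have hcop : Nat.Coprime x'.natAbs d'.natAbs := by
    rw [← hx', ← hd'']
    exact Int.gcd_ediv_gcd_ediv_gcd hg
  have hq : (x : ℚ) / d = (x' : ℚ) / d' := by
    have h1 : (x : ℚ) = Int.gcd x d * x' := by exact_mod_cast hx
    have h2 : (d : ℚ) = Int.gcd x d * d' := by exact_mod_cast hd'
    have h3 : (Int.gcd x d : ℚ) ≠ 0 := by exact_mod_cast hg.ne'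
    conv_lhs => rw [h1, h2]
    exact mul_div_mul_left _ _ h3
  rw [hx', hd'', hq, encodeRat, Rat.num_div_eq_of_coprime hd'0 hcop,
    Rat.den_div_eq_of_coprime hd'0 hcop]

/-- Write the rational number `x / d` in lowest terms; Euclid's algorithm for `x` and `d` uses the
registers `14`, `15` and `16`. -/
def writeRat (x d : Expr) : Prog :=
  .seq (.assign 14 d)
  (.seq (.assign 15 (.sub x (.mul d (.quot x d))))
  (.seq (.whilePos (.reg 15)
    (.seq (.assign 16 (.sub (.reg 14) (.mul (.reg 15) (.quot (.reg 14) (.reg 15)))))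
    (.seq (.assign 14 (.reg 15)) (.assign 15 (.reg 16)))))
  (.seq (.write (.quot x (.reg 14))) (.write (.quot d (.reg 14))))))

/-- The product of two consecutive remainders is halved in each step of Euclid's algorithm, so that
the number of steps is bounded by the number of bits. -/
theorem mul_mod_lt_two_pow {u v k : ℕ} (hv : 0 < v) (h : v < u) (hk : u * v < 2 ^ (k + 1)) :
    v * (u % v) < 2 ^ k := by
  have h1 : v + u % v ≤ u := by
    have h2 := Nat.div_add_mod u v
    have h3 : 1 ≤ u / v := (Nat.one_le_div_iff hv).2 h.le
    have h4 : v * 1 ≤ v * (u / v) := Nat.mul_le_mul_left _ h3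
    lia
  have h2 := Nat.mod_lt u hv
  have h3 : 2 * (v * (u % v)) ≤ u * v := by nlinarith
  rw [pow_succ] at hk
  lia

theorem writeRat_runs {β e : ℕ} {s : State} {x d : Expr} {X D : ℤ} (hs : s.Bdd β)
    (hx : ∀ s', Agree {14, 15, 16} ∅ s s' → x.eval s' = X)
    (hd : ∀ s', Agree {14, 15, 16} ∅ s s' → d.eval s' = D) (hD : 0 < D) (he : D ≤ 2 ^ e)
    (hβ : 2 * e + 2 ≤ β) :
    (writeRat x d).Runs β s 2 fun s' =>
      s'.Bdd β ∧ Agree {14, 15, 16} ∅ (s.append (encodeRat ((X : ℚ) / D))) s' := by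
  have hsmall : ∀ k : ℕ, (k : ℤ) ≤ D → bits k ≤ β := fun k hk =>
    bits_le_of_abs_le (e := e) (by rw [abs_of_nonneg (by positivity)]; exact hk.trans he) (by lia)
  obtain ⟨D', rfl⟩ : ∃ D' : ℕ, D = D' := ⟨D.toNat, by lia⟩
  have hv : (X % D' : ℤ) = ((X % D').toNat : ℕ) :=
    (Int.toNat_of_nonneg (Int.emod_nonneg _ hD.ne')).symm
  set v₀ := (X % D').toNat
  have hv₀ : v₀ < D' := by
    have := Int.emod_lt_of_pos X hD
    lia
  have hmod : ∀ u v : ℤ, u - v * (u / v) = u % v := fun u v => (Int.emod_def u v).symm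
  have hgcd : D'.gcd v₀ = Int.gcd X D' := by
    rw [Int.gcd_comm, ← Int.gcd_natCast_natCast, ← hv]
    have h1 := Int.gcd_sub_mul_right_right (D' : ℤ) X (X / D')
    rwa [mul_comm, hmod] at h1
  have b₁ := hs.setReg (x := 14) (hsmall D' le_rfl)
  have a₁ := (Agree.refl {14, 15, 16} ∅ s).setReg (x := 14) (by decide) D'
  refine Prog.Runs.seq hs (Prog.Runs.assign
    (Q := fun s' => s' = s.setReg 14 D') hs (by lia)
    (by rw [hd s (Agree.refl _ _ _)])) ?_
  rintro _ rfl
  refine Prog.Runs.seq b₁ (Prog.Runs.assign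
    (Q := fun s' => s' = (s.setReg 14 D').setReg 15 v₀) b₁ (by lia) ?_) ?_
  · simp only [eval, hx _ a₁, hd _ a₁, hmod, hv]
  rintro _ rfl
  have b₂ := b₁.setReg (x := 15) (hsmall v₀ (by lia))
  refine Prog.Runs.seq b₂ (Q' := fun s' => s'.Bdd β ∧ Agree {14, 15, 16} ∅ s s' ∧
    s'.reg 14 = Int.gcd X D') (Prog.Runs.whilePos (m := 2 * e) (d := 1)
    (fun k s' => s'.Bdd β ∧ Agree {14, 15, 16} ∅ s s' ∧ ∃ u v : ℕ, s'.reg 14 = u ∧ s'.reg 15 = v ∧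
      v < u ∧ u ≤ D' ∧ u.gcd v = Int.gcd X D' ∧ u * v < 2 ^ k) le_rfl (by lia)
    ⟨b₂, a₁.setReg (by decide) _, D', v₀, by simp, by simp, hv₀, le_rfl, hgcd, ?_⟩ ?_ ?_ ?_) ?_
  · have h1 : D' ≤ 2 ^ e := by exact_mod_cast he
    have h2 : 0 < D' := by exact_mod_cast hD
    calc D' * v₀ < D' * D' := Nat.mul_lt_mul_of_pos_left hv₀ h2
      _ ≤ 2 ^ e * 2 ^ e := Nat.mul_le_mul h1 h1
      _ = _ := by rw [two_mul, pow_add]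
  · exact fun k s' h => h.1
  · rintro k s₃ ⟨b₃, a₃, u, v, hu, hv, huv, huD, hg, hk⟩ hpos
    have hpos' : 0 < v := by
      simp only [eval, hv] at hpos
      exact_mod_cast hpos
    have hvu := Nat.mod_lt u hpos'
    have b₄ := b₃.setReg (x := 16) (hsmall (u % v) (by lia))
    have b₅ := b₄.setReg (x := 14) (hsmall v (by lia))
    refine Prog.Runs.seq b₃ (Prog.Runs.assign
      (Q := fun s' => s' = s₃.setReg 16 (u % v : ℕ)) b₃ le_rfl ?_) ?_
    · simp only [eval, hu, hv, hmod]
      rfl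
    rintro _ rfl
    refine Prog.Runs.seq b₄ (Prog.Runs.assign
      (Q := fun s' => s' = (s₃.setReg 16 (u % v : ℕ)).setReg 14 v) b₄ le_rfl ?_) ?_
    · simp [eval, hv]
    rintro _ rfl
    refine Prog.Runs.assign b₅ le_rfl ?_
    have h16 : (Expr.reg 16).eval ((s₃.setReg 16 (u % v : ℕ)).setReg 14 v) = (u % v : ℕ) := by
      simp [eval]
    rw [h16]
    obtain ⟨k, rfl⟩ : ∃ k', k = k' + 1 := by
      refine ⟨k - 1, ?_⟩
      rcases k with - | k
      · have := Nat.mul_pos (by lia : 0 < u) hpos'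
        lia
      · lia
    refine ⟨k, by lia, b₅.setReg (hsmall _ (by lia)),
      ((a₃.setReg (by decide) _).setReg (by decide) _).setReg (by decide) _, v, u % v, by simp,
      by simp, hvu, by lia, ?_, mul_mod_lt_two_pow hpos' huv hk⟩
    rw [← hg, Nat.gcd_comm u v, Nat.gcd_rec v u, Nat.gcd_comm]
  · rintro k s₃ ⟨b₃, a₃, u, v, hu, hv, huv, huD, hg, hk⟩ hpos
    simp only [eval, hv] at hpos
    obtain rfl : v = 0 := by lia
    rw [Nat.gcd_zero_right] at hg
    exact ⟨b₃, a₃, by rw [hu, hg]⟩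
  rintro s₃ ⟨b₃, a₃, hg⟩
  refine Prog.Runs.seq b₃ (Prog.Runs.write
    (Q := fun s' => s' = s₃.append [X / (Int.gcd X D' : ℤ)]) b₃ (by lia) ?_) ?_
  · simp only [eval, hx _ a₃, hg]
    rfl
  rintro _ rfl
  refine Prog.Runs.write (b₃.append _) (by lia) ?_
  have h1 : (Expr.quot d (.reg 14)).eval (s₃.append [X / (Int.gcd X D' : ℤ)])
      = D' / (Int.gcd X D' : ℤ) := by
    have h2 : ∀ e : Expr, e.eval (s₃.append [X / (Int.gcd X D' : ℤ)]) = e.eval s₃ := by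
      intro e
      induction e with
      | const | reg => rfl
      | cell a i h => simp only [eval, h]; rfl
      | add _ _ h h' | sub _ _ h h' | mul _ _ h h' | quot _ _ h h' => simp only [eval, h, h']
    rw [h2]
    simp only [eval, hd _ a₃, hg]
  rw [h1]
  change State.Bdd β ((s₃.append _).append _) ∧ Agree _ _ _ ((s₃.append _).append _)
  rw [State.append_append, encodeRat_div X hD]
  exact ⟨b₃.append _, a₃.append _⟩

/-- Write the rational numbers `x / d` for all `i, j < n`, where `n` is the content of register `4`
and `x` finds `i` and `j` in the registers `10` and `17`. -/
def writeRats (x d : Expr) : Prog :=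
  forLoop 10 (.reg 4) (forLoop 17 (.reg 4) (writeRat x d))

/-- The hypotheses on `x` and `d` ask for their values in all states that arise from `s` by changes
to the working registers and to the output tape. -/
theorem writeRats_runs {β e n : ℕ} {s : State} {x d : Expr} {X : Fin n → Fin n → ℤ} {D : ℤ}
    (hs : s.Bdd β) (hn : s.reg 4 = n) (hnβ : n ≤ β)
    (hx : ∀ s', Agree {10, 14, 15, 16, 17} ∅ s (({ s' with out := s.out } : State)) →
      ∀ i j : Fin n, s'.reg 10 = ((i : ℕ) : ℤ) → s'.reg 17 = ((j : ℕ) : ℤ) → x.eval s' = X i j)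
    (hd : ∀ s', Agree {10, 14, 15, 16, 17} ∅ s (({ s' with out := s.out } : State)) → d.eval s' = D)
    (hD : 0 < D) (he : D ≤ 2 ^ e) (hβ : 2 * e + 2 ≤ β) :
    (writeRats x d).Runs β s 4 fun s' =>
      s'.Bdd β ∧ Agree {10, 14, 15, 16, 17} ∅ (s.append ((List.finRange n).flatMap fun i =>
        (List.finRange n).flatMap fun j => encodeRat ((X i j : ℚ) / D))) s' := by
  have hβ3 := hs.le
  let w (i : Fin n) (k : ℕ) : List ℤ :=
    ((List.finRange n).take k).flatMap fun j => encodeRat ((X i j : ℚ) / D)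
  let v (k : ℕ) : List ℤ := ((List.finRange n).take k).flatMap fun i => w i n
  have hw : ∀ i (j : Fin n), w i (j + 1) = w i j ++ encodeRat ((X i j : ℚ) / D) := by
    intro i j
    simp only [w]
    rw [List.take_succ_eq_append_getElem (by simp), List.flatMap_append]
    simp
  have hv : ∀ i : Fin n, v (i + 1) = v i ++ w i n := by
    intro i
    simp only [v]
    rw [List.take_succ_eq_append_getElem (by simp), List.flatMap_append]
    simp
  have hforget : ∀ {l : List ℤ} {s' : State}, Agree {10, 14, 15, 16, 17} ∅ (s.append l) s' →
      Agree {10, 14, 15, 16, 17} ∅ s ({ s' with out := s.out } : State) :=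
    fun h => ⟨h.reg, h.bank, h.inp, rfl⟩
  have hsmall : ∀ k ≤ n, bits (k : ℤ) ≤ β := fun k hk => bits_natCast_le (by lia) hβ3
  refine Prog.Runs.forLoop (m := n) (d := 3) (fun i s' => s'.Bdd β ∧ s'.reg 10 = i ∧
    Agree {10, 14, 15, 16, 17} ∅ (s.append (v i)) s') (by lia) hs hnβ
    ⟨hs.setReg (hsmall 0 (by lia)), by simp, ?_⟩ ?_ ?_ ?_
  · rw [show v 0 = [] from rfl, State.append_nil]
    exact (Agree.refl _ _ s).setReg (by decide) _
  · rintro k hk s' ⟨h1, h2, h3⟩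
    exact ⟨h1, h2, (h3.reg 4 (by decide)).trans hn⟩
  · intro i hi s₁ ⟨b₁, i₁, a₁⟩
    refine Prog.Runs.forLoop (m := n) (d := 2) (fun j s' => s'.Bdd β ∧ s'.reg 10 = i ∧
      s'.reg 17 = j ∧ Agree {10, 14, 15, 16, 17} ∅ (s.append (v i ++ w ⟨i, hi⟩ j)) s') (by lia) b₁
      hnβ ⟨b₁.setReg (hsmall 0 (by lia)), by simpa using i₁, by simp, ?_⟩ ?_ ?_ ?_
    · rw [show w ⟨i, hi⟩ 0 = [] from rfl, List.append_nil]
      exact a₁.setReg (by decide) _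
    · rintro k hk s' ⟨h1, h2, h3, h4⟩
      exact ⟨h1, h3, (h4.reg 4 (by decide)).trans hn⟩
    · intro j hj s₂ ⟨b₂, i₂, j₂, a₂⟩
      have key : ∀ s', Agree {14, 15, 16} ∅ s₂ s' →
          Agree {10, 14, 15, 16, 17} ∅ s ({ s' with out := s.out } : State) ∧ s'.reg 10 = i ∧
            s'.reg 17 = j := fun s' h => ⟨hforget (a₂.trans h (by decide) (by decide)),
          (h.reg 10 (by decide)).trans i₂, (h.reg 17 (by decide)).trans j₂⟩
      refine Prog.Runs.mono (writeRat_runs (X := X ⟨i, hi⟩ ⟨j, hj⟩) b₂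
        (fun s' h => hx s' (key s' h).1 ⟨i, hi⟩ ⟨j, hj⟩ (key s' h).2.1 (key s' h).2.2)
        (fun s' h => hd s' (key s' h).1) hD he hβ) ?_
      rintro s' ⟨b, a⟩
      refine ⟨b, (a.reg 17 (by decide)).trans j₂, b.setReg (hsmall _ (by lia)), ?_, by simp, ?_⟩
      · simpa using (a.reg 10 (by decide)).trans i₂
      · rw [hw ⟨i, hi⟩ ⟨j, hj⟩, ← List.append_assoc, ← State.append_append]
        exact ((a₂.append _).trans a (by decide) (by decide)).setReg (by decide) _
    · rintro s' ⟨b, i', -, a⟩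
      refine ⟨b, i', b.setReg (hsmall _ (by lia)), by simp, ?_⟩
      rw [hv ⟨i, hi⟩]
      exact a.setReg (by decide) _
  · rintro s' ⟨b, -, a⟩
    refine ⟨b, ?_⟩
    simpa [v, w, List.take_of_length_le] using a

end RAM

/-! ### Reading an algebra -/

namespace RAM

open RAM.Expr QAlg

theorem State.Bdd.read {β : ℕ} {s : State} (h : s.Bdd β) (x : ℕ) {z : ℤ} {w : List ℤ}
    (hw : s.inp = z :: w) : State.Bdd β { s.setReg x z with inp := w } where
  le := h.le
  reg := (h.setReg (h.inp z (by simp [hw]))).reg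
  bank := h.bank
  inp y hy := h.inp y (by simp [hw, hy])

/-- Read the dimension `n` into register `4`, the numerators and the denominators of the `n ^ 3`
structure constants into the banks `12` and `13`, and write the products of the structure constants
with the product of all denominators to bank `8`. -/
def readAlgebra : Prog :=
  .seq (.read 4)
  (.seq (.assign 11 (.const 1))
  (.seq (forLoop 10 (.mul (.mul (.reg 4) (.reg 4)) (.reg 4))
    (.seq (.read 12)
    (.seq (.store 12 (.reg 10) (.reg 12))
    (.seq (.read 12)
    (.seq (.store 13 (.reg 10) (.reg 12))
    (.assign 11 (.mul (.reg 11) (.reg 12))))))))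
  (tabulate 8 (.const 0) (.mul (.reg 4) (.reg 4)) (.reg 4) (.const 1)
    (.mul (entry 12 (.reg 4) (.reg 0) (.reg 1))
      (.quot (.reg 11) (entry 13 (.reg 4) (.reg 0) (.reg 1)))))))

/-- The product of the denominators of the first `k` terms of a sequence. -/
def prodDen (q : ℕ → ℚ) (k : ℕ) : ℕ := ∏ i ∈ Finset.range k, (q i).den

theorem prodDen_succ (q : ℕ → ℚ) (k : ℕ) : prodDen q (k + 1) = prodDen q k * (q k).den :=
  Finset.prod_range_succ _ _

theorem prodDen_mono (q : ℕ → ℚ) {k m : ℕ} (h : k ≤ m) : prodDen q k ≤ prodDen q m :=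
  Finset.prod_le_prod_of_subset_of_one_le' (Finset.range_subset_range.2 h)
    fun i _ _ => (q i).den_pos

theorem readAlgebra_runs {β n e τ : ℕ} {s : State} (q : ℕ → ℚ) (hs : s.Bdd β)
    (hinp : s.inp = (n : ℤ) :: ((List.range (n * n * n)).map q).flatMap encodeRat)
    (hn : n * n * n ≤ β) (he : prodDen q (n * n * n) ≤ 2 ^ e) (heβ : e + 2 ≤ β)
    (hτ : ∀ i < n * n * n, |(q i).num * (prodDen q (n * n * n) / (q i).den : ℤ)| ≤ 2 ^ τ)
    (hτβ : τ + 2 ≤ β) :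
    readAlgebra.Runs β s 4 fun s' => s'.Bdd β ∧ s'.reg 4 = n ∧ s'.out = s.out ∧
      s'.Holds 8 (Matrix.of fun (r : Fin (n * n)) (k : Fin n) =>
        (q (r * n + k)).num * (prodDen q (n * n * n) / (q (r * n + k)).den : ℤ)) := by
  have hβ3 := hs.le
  have hnn : n * n ≤ n * n * n := by
    rcases n.eq_zero_or_pos with rfl | hn0
    · simp
    · exact Nat.le_mul_of_pos_right _ hn0
  have hn1 : n ≤ n * n := Nat.le_mul_self n
  set M := n * n * n
  have hprod : ∀ k ≤ M, bits (prodDen q k : ℤ) ≤ β := by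
    intro k hk
    refine bits_le_of_abs_le (e := e) ?_ heβ
    rw [Nat.abs_cast]
    exact_mod_cast (prodDen_mono q hk).trans he
  have b₁ := hs.read 4 hinp
  refine Prog.Runs.seq hs (Prog.Runs.read hs (by lia) hinp
    (Q := fun s' => s'.Bdd β ∧ s'.reg 4 = n ∧ s'.out = s.out ∧
      s'.inp = ((List.range M).map q).flatMap encodeRat)
    ⟨b₁, by simp, rfl, rfl⟩) ?_
  rintro s₁ ⟨b₁, n₁, o₁, i₁⟩
  refine Prog.Runs.seq b₁ (Prog.Runs.assign (Q := fun s' => s'.Bdd β ∧ s'.reg 4 = n ∧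
    s'.reg 11 = 1 ∧ s'.out = s.out ∧ s'.inp = ((List.range M).map q).flatMap encodeRat) b₁ (by lia)
    ⟨b₁.setReg (hprod 0 (by lia)), by simpa using n₁, by simp [eval], o₁, i₁⟩) ?_
  rintro s₂ ⟨b₂, n₂, D₂, o₂, i₂⟩
  refine Prog.Runs.seq b₂ (Q' := fun s' => s'.Bdd β ∧ s'.reg 4 = n ∧ s'.out = s.out ∧
    s'.reg 11 = prodDen q M ∧ ∀ i : ℕ, i < M → s'.bank 12 i = (q i).num ∧ s'.bank 13 i = (q i).den)
    (Prog.Runs.weaken (Prog.Runs.forLoop (m := M) (d := 1) (fun t s' => s'.Bdd β ∧ s'.reg 4 = n ∧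
    s'.out = s.out ∧ s'.reg 11 = prodDen q t ∧
    (∀ i : ℕ, i < t → s'.bank 12 i = (q i).num ∧ s'.bank 13 i = (q i).den) ∧ s'.reg 10 = t ∧
    s'.inp = ((List.range' t (M - t)).map q).flatMap encodeRat) le_rfl b₂ hn
    ⟨b₂.setReg (by simp [bits]; lia), by simpa using n₂, o₂, by simpa [prodDen] using D₂,
      fun i hi => by lia, by simp, by simpa [List.range_eq_range'] using i₂⟩ ?_ ?_ ?_) b₂
      (by lia)) ?_
  · rintro k hk s' ⟨h1, h2, h3, h4, h5, h6, h7⟩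
    refine ⟨h1, h6, ?_⟩
    simp only [eval, h2]
    push_cast [M]
    rfl
  · rintro k hk s₃ ⟨b₃, n₃, o₃, D₃, B₃, k₃, i₃⟩
    rw [show M - k = M - (k + 1) + 1 by lia, List.range'_succ, List.map_cons, List.flatMap_cons,
      encodeRat, List.cons_append, List.cons_append, List.nil_append] at i₃
    set w := ((List.range' (k + 1) (M - (k + 1))).map q).flatMap encodeRat
    refine Prog.Runs.seq b₃ (Prog.Runs.read b₃ le_rfl i₃
      (Q := fun s' => s'.Bdd β ∧ s'.reg 12 = (q k).num ∧ s'.inp = ((q k).den : ℤ) :: w ∧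
        Agree {12} ∅ ({ s₃ with inp := s'.inp } : State) s') ⟨b₃.read 12 i₃, by simp, rfl,
        (Agree.refl _ _ ({ s₃ with inp := _ } : State)).setReg (by decide) _⟩) ?_
    rintro s₄ ⟨b₄, z₄, i₄, a₄⟩
    have b₅ := b₄.setCell (a := 12) (i := (k : ℤ)) (b₄.reg 12)
    refine Prog.Runs.seq b₄ (Prog.Runs.store b₄ le_rfl
      (Q := fun s' => s' = s₄.setCell 12 k (s₄.reg 12)) ?_) ?_
    · have : s₄.reg 10 = k := (a₄.reg 10 (by decide)).trans k₃
      simp only [eval, this]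
    rintro _ rfl
    have i₅ : (s₄.setCell 12 k (s₄.reg 12)).inp = ((q k).den : ℤ) :: w := i₄
    refine Prog.Runs.seq b₅ (Prog.Runs.read b₅ le_rfl i₅
      (Q := fun s' => s'.Bdd β ∧ s'.reg 12 = (q k).den ∧
        s'.inp = w ∧ s'.out = s.out ∧ s'.reg 4 = n ∧ s'.reg 10 = k ∧ s'.reg 11 = prodDen q k ∧
        (∀ i : ℕ, i < k + 1 → s'.bank 12 i = (q i).num) ∧
        (∀ i : ℕ, i < k → s'.bank 13 i = (q i).den))
        ⟨b₅.read 12 i₅, by simp, rfl, a₄.out.trans o₃, ?_, ?_, ?_, ?_, ?_⟩) ?_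
    · simpa using (a₄.reg 4 (by decide)).trans n₃
    · simpa using (a₄.reg 10 (by decide)).trans k₃
    · simpa using (a₄.reg 11 (by decide)).trans D₃
    · intro i hi
      change (s₄.setCell 12 k (s₄.reg 12)).bank 12 i = _
      rw [State.setCell_bank]
      split_ifs with h
      · rw [z₄, Nat.cast_inj.1 h]
      · rw [a₄.bank 12 (by decide)]
        exact (B₃ i (lt_of_le_of_ne (by lia) (by exact_mod_cast h))).1
    · intro i hi
      change (s₄.setCell 12 k (s₄.reg 12)).bank 13 i = _
      rw [State.setCell_bank_of_ne _ _ _ _ (by decide), a₄.bank 13 (by decide)]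
      exact (B₃ i hi).2
    rintro s₆ ⟨b₆, z₆, i₆, o₆, n₆, k₆, D₆, B₆, C₆⟩
    have b₇ := b₆.setCell (a := 13) (i := (k : ℤ)) (b₆.reg 12)
    refine Prog.Runs.seq b₆ (Prog.Runs.store b₆ le_rfl
      (Q := fun s' => s' = s₆.setCell 13 k (s₆.reg 12)) ?_) ?_
    · simp only [eval, k₆]
    rintro _ rfl
    refine Prog.Runs.assign b₇ le_rfl ?_
    have hv : (Expr.mul (.reg 11) (.reg 12)).eval (s₆.setCell 13 k (s₆.reg 12))
        = prodDen q (k + 1) := by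
      rw [prodDen_succ]
      simp [eval, D₆, z₆]
    rw [hv]
    have b₈ := b₇.setReg (x := 11) (hprod (k + 1) hk)
    refine ⟨b₈, by simpa using k₆, b₈.setReg (bits_natCast_le (by lia) hβ3), by simpa using n₆,
      o₆, by simp, ?_, by simp, i₆⟩
    intro i hi
    refine ⟨B₆ i hi, ?_⟩
    change (s₆.setCell 13 k (s₆.reg 12)).bank 13 i = _
    rw [State.setCell_bank]
    split_ifs with h
    · rw [z₆, Nat.cast_inj.1 h]
    · exact C₆ i (lt_of_le_of_ne (by lia) (by exact_mod_cast h))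
  · rintro s' ⟨h1, h2, h3, h4, h5, -, -⟩
    exact ⟨h1, h2, h3, h4, h5⟩
  rintro s₃ ⟨b₃, n₃, o₃, D₃, B₃⟩
  have hidx : ∀ (r : Fin (n * n)) (k : Fin n), (r * n + k : ℕ) < M := by
    intro r k
    have : (r + 1) * n ≤ M := Nat.mul_le_mul_right _ r.2
    rw [add_mul, one_mul] at this
    exact lt_of_lt_of_le (Nat.add_lt_add_left k.2 _) this
  refine Prog.Runs.mono (tabulate_matrix_runs (k := 1)
    (Matrix.of fun (r : Fin (n * n)) (k : Fin n) =>
      (q (r * n + k)).num * (prodDen q M / (q (r * n + k)).den : ℤ))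
    (fun r k _ => (q (r * n + k)).num * (prodDen q M / (q (r * n + k)).den : ℤ)) (fun i j => ?_) b₃
    (hnn.trans hn) (by lia) (by lia) ?_ ?_ (fun _ _ => rfl) ?_ (ν := 0) (by lia)
    (fun r k _ => hτ _ (hidx r k)) (by lia)) ?_
  · simp
  · intro s' h
    simp [eval, h.reg 4 (by decide), n₃]
  · intro s' h
    simp [eval, h.reg 4 (by decide), n₃]
  · intro s' h i j l h0 h1 h2
    have := B₃ _ (hidx i j)
    push_cast at this
    simp only [eval, eval_entry, h0, h1, h.reg 4 (by decide), n₃, h.reg 11 (by decide), D₃,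
      h.bank 12 (by decide), h.bank 13 (by decide), this]
  · rintro s' ⟨f, b, H⟩
    exact ⟨b, (f.reg 4 (by decide)).trans n₃, f.out.trans o₃, H⟩

end RAM

/-! ### Programs for the linear systems -/

namespace QAlg

open Matrix

/-- A bound for the number of bits of the coefficients of the characteristic polynomial of a matrix
of size at most `ν` with entries of at most `τ` bits, and of the matrices in the Faddeev–LeVerrier
recursion. -/
def growth {R : Type*} [CommSemiring R] (ν τ : R) : R := (ν + 2) * (τ + 2 * ν + 1) + 2

theorem le_growth (ν τ : ℕ) : τ ≤ growth ν τ ∧ ν ≤ growth ν τ := by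
  simp only [growth]
  constructor <;> nlinarith [Nat.zero_le (ν * τ), Nat.zero_le (ν * ν)]

section

variable {N ν τ : ℕ} (T : Matrix (Fin N) (Fin N) ℤ) (hν : N ≤ ν) (hτ : ∀ i j, |T i j| ≤ 2 ^ τ)

include hν hτ

theorem abs_tailCharpoly_le_growth (j : ℕ) (hj : j ≤ N) :
    (∀ i i', |T.tailCharpoly j i i'| ≤ 2 ^ growth ν τ) ∧ |T.charpoly.coeff j| ≤ 2 ^ growth ν τ := by
  have h := abs_tailCharpoly_apply_le T (hν.trans Nat.lt_two_pow_self.le) hτ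
    (j := j) (k := N - j) (by lia)
  have h1 : (N - j) * (τ + 2 * ν + 1) ≤ growth ν τ :=
    (Nat.mul_le_mul_right _ (show N - j ≤ ν + 2 by lia)).trans (Nat.le_add_right _ _)
  have h2 : (2 : ℤ) ^ ((N - j) * (τ + 2 * ν + 1)) ≤ 2 ^ growth ν τ :=
    pow_le_pow_right₀ (by norm_num) h1
  exact ⟨fun i i' => (h.1 i i').trans h2, h.2.trans h2⟩

theorem abs_tailCharpoly_succ_le_growth (j : ℕ) (hj : j ≤ N) (i i' : Fin N) :
    |T.tailCharpoly (j + 1) i i'| ≤ 2 ^ growth ν τ := by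
  rcases hj.eq_or_lt with rfl | hj
  · rw [T.tailCharpoly_of_card_lt (by simp)]
    simp
  · exact (abs_tailCharpoly_le_growth T hν hτ (j + 1) hj).1 i i'

omit hν hτ in
theorem natTrailingDegree_charpoly_le : T.charpoly.natTrailingDegree ≤ N := by
  refine Polynomial.natTrailingDegree_le_of_ne_zero ?_
  have := T.coeff_charpoly_card
  rw [Fintype.card_fin] at this
  simp [this]

theorem abs_fittingMatrix_le (i i' : Fin N) : |fittingMatrix T i i'| ≤ 2 ^ growth ν τ :=
  (abs_tailCharpoly_le_growth T hν hτ _ (natTrailingDegree_charpoly_le T)).1 i i'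

end

theorem abs_diffMatrix_le {n τ : ℕ} {α : Fin n → Fin n → Fin n → ℤ}
    (hα : ∀ i j k, |α i j k| ≤ 2 ^ τ) (i : Fin n) (r c : Fin (n * n)) :
    |diffMatrix α i r c| ≤ 2 ^ (τ + 1) := by
  have h0 : (0 : ℤ) ≤ 2 ^ τ := by positivity
  rw [diffMatrix, of_apply, pow_succ, mul_two]
  refine (abs_sub _ _).trans (add_le_add ?_ ?_) <;> split_ifs
  exacts [hα _ _ _, by simp, hα _ _ _, by simp]

theorem abs_fittingProduct_le {n τ ν : ℕ} {α : Fin n → Fin n → Fin n → ℤ}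
    (hα : ∀ i j k, |α i j k| ≤ 2 ^ τ) (hν : n * n ≤ ν) (k : ℕ) (r c : Fin (n * n)) :
    |fittingProduct α k r c| ≤ 2 ^ (k * (ν + growth ν (τ + 1))) := by
  induction k generalizing r c with
  | zero =>
    rw [fittingProduct, one_apply]
    split_ifs <;> simp
  | succ k ih =>
    have hle : (2 : ℤ) ^ 0 ≤ 2 ^ growth ν (τ + 1) := pow_le_pow_right₀ (by norm_num) (Nat.zero_le _)
    rw [fittingProduct]
    refine (abs_mul_apply_le (ν := ν) (hν.trans Nat.lt_two_pow_self.le) ih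
      (b := growth ν (τ + 1)) ?_ r c).trans_eq ?_
    · intro i j
      split_ifs
      · exact abs_fittingMatrix_le _ hν (abs_diffMatrix_le hα _) i j
      · rw [one_apply]
        split_ifs
        · simpa using hle
        · simp
    · congr 1
      ring

end QAlg

namespace RAM

open RAM.Expr QAlg Matrix

/-- For the matrix `T` in bank `0`, of the size given in register `5`, write `fittingMatrix T` to
bank `5`. -/
def fitting : Prog :=
  .seq faddeevLeVerrier (tabulate 5 (.const 0) (.reg 5) (.reg 5) (.reg 5)
    (.add (.mul (entry 0 (.reg 5) (.reg 0) (.reg 2)) (entry 3 (.reg 5) (.reg 2) (.reg 1)))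
      (.mul (.reg 8) (.mul (ifEq (.reg 0) (.reg 2)) (ifEq (.reg 0) (.reg 1))))))

theorem fitting_runs {β N τ ν : ℕ} {s : State} (T : Matrix (Fin N) (Fin N) ℤ)
    (hs : s.Bdd β) (hN : s.reg 5 = N) (hT : s.Holds 0 T) (hτ : ∀ i j, |T i j| ≤ 2 ^ τ)
    (hν : N ≤ ν) (hβ : ν + τ + growth ν τ + 3 ≤ β) :
    fitting.Runs β s 5 fun s' => Agree {0, 1, 2, 3, 6, 7, 8, 9} {1, 2, 3, 4, 5} s s' ∧ s'.Bdd β ∧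
      s'.Holds 5 (fittingMatrix T) := by
  have hν' : N ≤ 2 ^ ν := hν.trans Nat.lt_two_pow_self.le
  refine Prog.Runs.seq hs (faddeevLeVerrier_runs T hs hN hT hτ hν' (by lia) ?_) ?_
  · refine le_trans ?_ (show growth ν τ ≤ β by lia)
    rw [growth]
    gcongr
  rintro s₁ ⟨a₁, b₁, S₁, p₁, -⟩
  have hm := natTrailingDegree_charpoly_le T
  set m := T.charpoly.natTrailingDegree
  refine Prog.Runs.mono ((tabulate_matrix_runs (fittingMatrix T) (k := N)
    (fun i j l => T i l * T.tailCharpoly (m + 1) l j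
      + T.charpoly.coeff m * ((if i = l then 1 else 0) * if i = j then 1 else 0)) ?_
    b₁ (by lia) (by lia) (by lia) ?_ ?_ ?_ ?_ (ν := ν) hν' (e := τ + growth ν τ + 1) ?_
    (by lia)).weaken b₁ (by lia)) ?_
  · intro i j
    rw [fittingMatrix, tailCharpoly_eq, Matrix.add_apply, Matrix.smul_apply, mul_apply, one_apply,
      Finset.sum_add_distrib, ← Finset.mul_sum, ← Finset.sum_mul]
    simp
    rfl
  · intro s' h
    simp [eval, h.reg 5 (by decide), a₁.reg 5 (by decide), hN]
  · intro s' h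
    simp [eval, h.reg 5 (by decide), a₁.reg 5 (by decide), hN]
  · intro s' h
    simp [eval, h.reg 5 (by decide), a₁.reg 5 (by decide), hN]
  · intro s' h i j l h0 h1 h2
    simp only [eval, eval_entry, eval_ifEq, h0, h1, h2, h.reg 5 (by decide), a₁.reg 5 (by decide),
      hN, h.reg 8 (by decide), p₁, h.bank 0 (by decide), h.bank 3 (by decide),
      a₁.bank 0 (by decide), hT i l, S₁ l j, Nat.cast_inj, Fin.ext_iff]
  · intro i j l
    have h1 := abs_tailCharpoly_succ_le_growth T hν hτ m hm l j
    have h2 := (abs_tailCharpoly_le_growth T hν hτ m hm).2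
    have h3 : |T i l * T.tailCharpoly (m + 1) l j| ≤ 2 ^ (τ + growth ν τ) :=
      abs_mul_le_two_pow (hτ _ _) h1
    have h4 : |T.charpoly.coeff m * ((if i = l then 1 else 0) * if i = j then 1 else 0)|
        ≤ 2 ^ (τ + growth ν τ) := by
      refine le_trans ?_ (h2.trans (pow_le_pow_right₀ (by norm_num) (Nat.le_add_left _ _)))
      split_ifs <;> simp
    rw [pow_succ, mul_two]
    exact (abs_add_le _ _).trans (add_le_add h3 h4)
  · rintro s' ⟨f, b, H⟩
    exact ⟨((Agree.refl _ _ s).trans a₁ (by decide) (by decide)).trans f (by decide)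
      (by decide), b, H⟩

/-- Bank `8` holds the structure constants `α`. -/
def State.HoldsConstants (s : State) {n : ℕ} (α : Fin n → Fin n → Fin n → ℤ) : Prop :=
  ∀ i j k : Fin n, s.bank 8 (((i : ℕ) * n + (j : ℕ)) * n + (k : ℕ)) = α i j k

theorem State.HoldsConstants.congr {s s' : State} {n : ℕ} {α : Fin n → Fin n → Fin n → ℤ}
    (h : s.HoldsConstants α) (hs : s'.bank 8 = s.bank 8) : s'.HoldsConstants α := by
  intro i j k
  rw [hs, h]

namespace Expr

/-- The structure constant with indices `i`, `j`, `k`. -/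
def constant (i j k : Expr) : Expr := entry 8 (.reg 4) (.add (.mul i (.reg 4)) j) k

/-- The quotient by the content of register `4`. -/
def div4 (r : Expr) : Expr := .quot r (.reg 4)

/-- The remainder modulo the content of register `4`. -/
def mod4 (r : Expr) : Expr := .sub r (.mul (.reg 4) (.quot r (.reg 4)))

/-- The entry in row `r` and column `c` of the `i`-th matrix `diffMatrix`. -/
def diffEntry (i r c : Expr) : Expr :=
  .sub (.mul (ifEq (mod4 r) (mod4 c)) (constant i (div4 c) (div4 r)))
    (.mul (ifEq (div4 r) (div4 c)) (constant i (mod4 c) (mod4 r)))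

variable {s : State} {m n : ℕ} (hn : s.reg 4 = n)

include hn

theorem eval_div4 {r : Expr} {x : Fin (m * n)} (hr : r.eval s = ((x : ℕ) : ℤ)) :
    (div4 r).eval s = ((x.divNat : ℕ) : ℤ) := by
  simp [div4, eval, hn, hr, Fin.coe_divNat]

theorem eval_mod4 {r : Expr} {x : Fin (m * n)} (hr : r.eval s = ((x : ℕ) : ℤ)) :
    (mod4 r).eval s = ((x.modNat : ℕ) : ℤ) := by
  simp only [mod4, eval, hn, hr, Fin.coe_modNat]
  rw [← Int.emod_def, Int.natCast_mod]

theorem eval_constant {α : Fin n → Fin n → Fin n → ℤ} (hα : s.HoldsConstants α) {i j k : Expr}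
    {i' j' k' : Fin n} (hi : i.eval s = ((i' : ℕ) : ℤ)) (hj : j.eval s = ((j' : ℕ) : ℤ))
    (hk : k.eval s = ((k' : ℕ) : ℤ)) : (constant i j k).eval s = α i' j' k' := by
  simp only [constant, eval_entry, eval, hn, hi, hj, hk, hα i' j' k']

theorem eval_diffEntry {α : Fin n → Fin n → Fin n → ℤ} (hα : s.HoldsConstants α) {i r c : Expr}
    {i' : Fin n} {r' c' : Fin (n * n)} (hi : i.eval s = ((i' : ℕ) : ℤ))
    (hr : r.eval s = ((r' : ℕ) : ℤ)) (hc : c.eval s = ((c' : ℕ) : ℤ)) :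
    (diffEntry i r c).eval s = diffMatrix α i' r' c' := by
  have hr1 := eval_div4 hn hr
  have hr2 := eval_mod4 hn hr
  have hc1 := eval_div4 hn hc
  have hc2 := eval_mod4 hn hc
  rw [diffEntry, eval, eval, eval, eval_ifEq, eval_ifEq, eval_constant hn hα hi hc1 hr1,
    eval_constant hn hα hi hc2 hr2, hr1, hr2, hc1, hc2, diffMatrix, of_apply]
  simp only [Nat.cast_inj, Fin.ext_iff, ite_mul, one_mul, zero_mul]

end Expr

/-- Write the product of the matrices `fittingMatrix (diffMatrix α i)` to bank `6`. -/
def computeFittingProduct : Prog :=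
  .seq (.assign 5 (.mul (.reg 4) (.reg 4)))
  (.seq (tabulate 6 (.const 0) (.reg 5) (.reg 5) (.const 1) (ifEq (.reg 0) (.reg 1)))
  (forLoop 10 (.reg 4)
    (.seq (tabulate 0 (.const 0) (.reg 5) (.reg 5) (.const 1)
      (diffEntry (.reg 10) (.reg 0) (.reg 1)))
    (.seq fitting
    (.seq (tabulate 7 (.const 0) (.reg 5) (.reg 5) (.reg 5)
      (.mul (entry 6 (.reg 5) (.reg 0) (.reg 2)) (entry 5 (.reg 5) (.reg 2) (.reg 1))))
    (tabulate 6 (.const 0) (.reg 5) (.reg 5) (.const 1) (entry 7 (.reg 5) (.reg 0) (.reg 1))))))))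

theorem computeFittingProduct_runs {β n τ ν : ℕ} {s : State} {α : Fin n → Fin n → Fin n → ℤ}
    (hs : s.Bdd β) (hn : s.reg 4 = n) (hα : s.HoldsConstants α) (hτ : ∀ i j k, |α i j k| ≤ 2 ^ τ)
    (hν : n * n ≤ ν) (hβ : (ν + 1) * (ν + growth ν (τ + 1)) + τ + 4 ≤ β) :
    computeFittingProduct.Runs β s 6 fun s' =>
      Agree {0, 1, 2, 3, 5, 6, 7, 8, 9, 10} {0, 1, 2, 3, 4, 5, 6, 7} s s' ∧ s'.Bdd β ∧
      s'.Holds 6 (fittingProduct α n) := by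
  have hβ3 := hs.le
  have hnn : n ≤ n * n := Nat.le_mul_self n
  obtain ⟨G, hG⟩ : ∃ G, G = growth ν (τ + 1) := ⟨_, rfl⟩
  have hG' := le_growth ν (τ + 1)
  rw [← hG] at hβ hG'
  have hβ1 : ν + G + τ + 4 ≤ β := by
    rw [add_mul, one_mul] at hβ
    lia
  have hν' : n * n ≤ 2 ^ ν := hν.trans Nat.lt_two_pow_self.le
  have hstep : ∀ k < n, ν + (k * (ν + G) + G) + 2 ≤ β ∧ (k + 1) * (ν + G) + 2 ≤ β := by
    intro k hk
    have : (k + 1) * (ν + G) ≤ (ν + 1) * (ν + G) := Nat.mul_le_mul_right _ (by lia)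
    rw [add_mul k] at *
    lia
  have hN : bits ((n * n : ℕ) : ℤ) ≤ β := bits_natCast_le (by lia) hβ3
  have b₀ := hs.setReg (x := 5) hN
  refine Prog.Runs.seq hs (Prog.Runs.assign
    (Q := fun s' => s' = s.setReg 5 (n * n : ℕ)) hs (by lia) (by simp [eval, hn])) ?_
  rintro _ rfl
  have r4 : ∀ {a} {s₁ s' : State}, s₁.reg 4 = (n : ℤ) → Frame a s₁ s' → s'.reg 4 = (n : ℤ) :=
    fun h h' => (h'.reg 4 (by decide)).trans h
  have r5 : ∀ {a} {s₁ s' : State}, s₁.reg 5 = ((n * n : ℕ) : ℤ) → Frame a s₁ s' →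
      s'.reg 5 = ((n * n : ℕ) : ℤ) :=
    fun h h' => (h'.reg 5 (by decide)).trans h
  have n₀ : (s.setReg 5 (n * n : ℕ)).reg 5 = (n * n : ℕ) := by simp
  refine Prog.Runs.seq b₀ ((tabulate_matrix_runs (1 : Matrix (Fin (n * n)) (Fin (n * n)) ℤ) (k := 1)
    (fun i j _ => if i = j then 1 else 0) (by simp [one_apply]) b₀ (by lia) (by lia) (by lia)
    (fun s' h => by exact r5 n₀ h) (fun s' h => by exact r5 n₀ h) (fun _ _ => rfl) ?_
    (ν := 0) (by norm_num) (e := 0) (fun i j _ => by split_ifs <;> simp) (by lia)).weaken b₀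
      (by lia)) ?_
  · intro s' h i j l h0 h1 h2
    simp [eval_ifEq, eval, h0, h1, Fin.ext_iff]
  rintro s₁ ⟨f₁, b₁, H₁⟩
  have hn₁ : s₁.reg 4 = n := by rw [f₁.reg 4 (by decide)]; simpa using hn
  refine Prog.Runs.forLoop (m := n) (d := 5) (fun k s' =>
    Agree {0, 1, 2, 3, 5, 6, 7, 8, 9, 10} {0, 1, 2, 3, 4, 5, 6, 7} s s' ∧ s'.Bdd β ∧
      s'.reg 10 = k ∧ s'.reg 5 = (n * n : ℕ) ∧ s'.Holds 6 (fittingProduct α k)) (by lia) b₁ (by lia)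
    ⟨?_, b₁.setReg (by simp [bits]; lia), by simp, ?_, H₁⟩ ?_ ?_ ?_
  · exact (((Agree.refl _ _ s).setReg (by decide) _).trans f₁ (by decide) (by decide)).setReg
      (by decide) _
  · simpa using r5 n₀ f₁
  · rintro k hk s' ⟨a, b, h1, h2, -⟩
    exact ⟨b, h1, (a.reg 4 (by decide)).trans hn⟩
  · rintro k hk s₂ ⟨a₂, b₂, k₂, N₂, H₂⟩
    have n₂ : s₂.reg 4 = n := (a₂.reg 4 (by decide)).trans hn
    have hα₂ : s₂.HoldsConstants α := hα.congr (a₂.bank 8 (by decide))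
    have hT := abs_diffMatrix_le hτ ⟨k, hk⟩
    refine Prog.Runs.seq b₂ ((tabulate_matrix_runs (diffMatrix α ⟨k, hk⟩) (k := 1)
      (fun i j _ => diffMatrix α ⟨k, hk⟩ i j) (by simp) b₂ (by lia) (by lia) (by lia)
      (fun s' h => by exact r5 N₂ h) (fun s' h => by exact r5 N₂ h) (fun _ _ => rfl) ?_
      (ν := 0) (by norm_num) (e := τ + 1) (fun i j _ => hT i j) (by lia)).weaken b₂ (by lia)) ?_
    · intro s' h i j l h0 h1 h2
      exact eval_diffEntry (r4 n₂ h) (hα₂.congr (h.bank 8 (by decide)))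
        ((h.reg 10 (by decide)).trans k₂) h0 h1
    rintro s₃ ⟨f₃, b₃, H₃⟩
    have N₃ := r5 N₂ f₃
    refine Prog.Runs.seq b₃ (fitting_runs _ b₃ N₃ H₃ hT hν (by lia)) ?_
    rintro s₄ ⟨a₄, b₄, H₄⟩
    have N₄ : s₄.reg 5 = (n * n : ℕ) := (a₄.reg 5 (by decide)).trans N₃
    have Z₄ : s₄.Holds 6 (fittingProduct α k) :=
      (H₂.congr (f₃.bank 6 (by decide))).congr (a₄.bank 6 (by decide))
    have hZ := abs_fittingProduct_le hτ hν k
    have hQ := abs_fittingMatrix_le _ hν hT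
    have hZ' := abs_fittingProduct_le hτ hν (k + 1)
    rw [← hG] at hZ hQ hZ'
    have hsucc : fittingProduct α (k + 1)
        = fittingProduct α k * fittingMatrix (diffMatrix α ⟨k, hk⟩) := by
      rw [fittingProduct, dif_pos hk]
    refine Prog.Runs.seq b₄ ((tabulate_matrix_runs (fittingProduct α (k + 1)) (k := n * n)
      (fun i j l => fittingProduct α k i l * fittingMatrix (diffMatrix α ⟨k, hk⟩) l j)
      (fun i j => by rw [hsucc, mul_apply]) b₄ (by lia) (by lia) (by lia)
      (fun s' h => by exact r5 N₄ h) (fun s' h => by exact r5 N₄ h)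
      (fun s' h => by exact r5 N₄ h) ?_
      (ν := ν) hν' (e := k * (ν + G) + G) (fun i j l => ?_) (hstep k hk).1).weaken b₄ (by lia)) ?_
    · intro s' h i j l h0 h1 h2
      have e1 := Z₄ i l
      have e2 := H₄ l j
      simp only [eval, eval_entry, h0, h1, h2, r5 N₄ h, h.bank 6 (by decide), h.bank 5 (by decide),
        e1, e2]
    · exact abs_mul_le_two_pow (hZ _ _) (hQ _ _)
    rintro s₅ ⟨f₅, b₅, H₅⟩
    have N₅ := r5 N₄ f₅
    refine Prog.Runs.mono ((tabulate_matrix_runs (fittingProduct α (k + 1)) (k := 1)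
      (fun i j _ => fittingProduct α (k + 1) i j) (by simp) b₅ (by lia) (by lia) (by lia)
      (fun s' h => by exact r5 N₅ h) (fun s' h => by exact r5 N₅ h) (fun s' h => rfl) ?_
      (ν := 0) (by norm_num) (fun i j l => hZ' i j) (by have := (hstep k hk).2; lia)).weaken b₅
      (by lia)) ?_
    · intro s' h i j l h0 h1 h2
      have e1 := H₅ i j
      simp only [eval_entry, eval, h0, h1, r5 N₅ h, h.bank 7 (by decide), e1]
    · rintro s₆ ⟨f₆, b₆, H₆⟩
      have k₆ : s₆.reg 10 = k := by
        rw [f₆.reg 10 (by decide), f₅.reg 10 (by decide), a₄.reg 10 (by decide),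
          f₃.reg 10 (by decide), k₂]
      refine ⟨b₆, k₆, ?_, b₆.setReg (bits_natCast_le (by lia) hβ3), by simp,
        by simpa using r5 N₅ f₆, H₆⟩
      exact ((((a₂.trans f₃ (by decide) (by decide)).trans a₄ (by decide) (by decide)).trans f₅
        (by decide) (by decide)).trans f₆ (by decide) (by decide)).setReg (by decide) _
  · rintro s' ⟨a, b, -, -, H⟩
    exact ⟨a, b, H⟩

/-- For the matrix `K` in bank `a`, with as many rows as given in register `4` and `c` columns,
write `fittingMatrix (K * Kᵀ)` to bank `5`. -/
def solveSystem (a : ℕ) (c : Expr) : Prog :=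
  .seq (.assign 5 (.reg 4))
  (.seq (tabulate 0 (.const 0) (.reg 4) (.reg 4) c
    (.mul (entry a c (.reg 0) (.reg 2)) (entry a c (.reg 1) (.reg 2)))) fitting)

theorem solveSystem_runs {β n m τ ν a : ℕ} {c : Expr} {s : State} (K : Matrix (Fin n) (Fin m) ℤ)
    (hs : s.Bdd β) (hn : s.reg 4 = n) (ha : 5 < a) (hK : s.Holds a K)
    (hc : ∀ s' : State, s'.reg 4 = n → c.eval s' = m) (hτ : ∀ i j, |K i j| ≤ 2 ^ τ)
    (hnν : n ≤ ν) (hν : m ≤ ν) (hβ : ν + (ν + 2 * τ) + growth ν (ν + 2 * τ) + 3 ≤ β) :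
    (solveSystem a c).Runs β s 5 fun s' =>
      Agree {0, 1, 2, 3, 5, 6, 7, 8, 9} {0, 1, 2, 3, 4, 5} s s' ∧ s'.Bdd β ∧
      s'.reg 5 = n ∧ s'.Holds 5 (fittingMatrix (K * Kᵀ)) := by
  have hβ3 := hs.le
  have hν' : m ≤ 2 ^ ν := hν.trans Nat.lt_two_pow_self.le
  have b₀ := hs.setReg (x := 5) (bits_natCast_le (show n ≤ β by lia) hβ3)
  refine Prog.Runs.seq hs (Prog.Runs.assign
    (Q := fun s' => s' = s.setReg 5 n) hs (by lia) (by simp [eval, hn])) ?_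
  rintro _ rfl
  have n₀ : (s.setReg 5 n).reg 4 = n := by simpa using hn
  have r4 : ∀ {s'}, Frame 0 (s.setReg 5 n) s' → s'.reg 4 = n :=
    fun h' => (h'.reg 4 (by decide)).trans n₀
  have hterm : ∀ i j l, |K i l * K j l| ≤ 2 ^ (2 * τ) := by
    intro i j l
    rw [two_mul]
    exact abs_mul_le_two_pow (hτ _ _) (hτ _ _)
  refine Prog.Runs.seq b₀ ((tabulate_matrix_runs (K * Kᵀ) (k := m)
    (fun i j l => K i l * K j l) (fun i j => by rw [mul_apply]; rfl) b₀ (by lia) (by lia) (by lia)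
    (fun s' h => by exact r4 h) (fun s' h => by exact r4 h) (fun s' h => hc _ (r4 h)) ?_
    (ν := ν) hν' (e := 2 * τ) hterm (by lia)).weaken b₀ (by lia)) ?_
  · intro s' h i j l h0 h1 h2
    have e1 := hK i l
    have e2 := hK j l
    have hb : s'.bank a = s.bank a := h.bank a (by simp; lia)
    simp only [eval, eval_entry, h0, h1, h2, hc _ (r4 h), hb, e1, e2]
  rintro s₁ ⟨f₁, b₁, H₁⟩
  have n₁ : s₁.reg 5 = n := (f₁.reg 5 (by decide)).trans (by simp)
  refine Prog.Runs.mono (fitting_runs _ b₁ n₁ H₁ (τ := ν + 2 * τ) (fun i j => ?_) hnν hβ) ?_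
  · rw [mul_apply]
    exact abs_sum_le_two_pow hν' fun l => hterm i j l
  · rintro s₂ ⟨a₂, b₂, H₂⟩
    exact ⟨(((Agree.refl _ _ s).setReg (by decide) _).trans f₁ (by decide) (by decide)).trans a₂
      (by decide) (by decide), b₂, (a₂.reg 5 (by decide)).trans n₁, H₂⟩

end RAM

/-! ### Greedy extraction of a basis -/

namespace QAlg

open Matrix Submodule

/-- The first `r` of the integer vectors `v` form a basis of a subspace, found among the first `r₀`
of the vectors `v₀`, which are kept, and the columns of `C`; the first `t` columns of `C` belong to
the subspace. -/
structure GreedyBasis {n : ℕ} (C : Matrix (Fin n) (Fin n) ℤ) (r₀ : ℕ) (v₀ : ℕ → Fin n → ℤ)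
    (t r : ℕ) (v : ℕ → Fin n → ℤ) : Prop where
  le : r₀ ≤ r
  indep : LinearIndependent ℚ fun i : Fin r => ratVec (v i)
  old : ∀ i < r₀, v i = v₀ i
  new : ∀ i < r, r₀ ≤ i → ∃ j, v i = fun k => C k j
  mem : ∀ j : Fin n, (j : ℕ) < t →
    ratVec (fun k => C k j) ∈ span ℚ (Set.range fun i : Fin r => ratVec (v i))

variable {n r₀ t r : ℕ} {C : Matrix (Fin n) (Fin n) ℤ} {v₀ v v' : ℕ → Fin n → ℤ}

theorem GreedyBasis.le_dim (h : GreedyBasis C r₀ v₀ t r v) : r ≤ n := by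
  simpa using h.indep.fintype_card_le_finrank

theorem GreedyBasis.step (h : GreedyBasis C r₀ v₀ t r v) (ht : t < n) (hv : ∀ i < r, v' i = v i)
    (hv' : v' r = fun k => C k ⟨t, ht⟩) :
    GreedyBasis C r₀ v₀ (t + 1)
      (Module.finrank ℚ (span ℚ (Set.range fun i : Fin (r + 1) => ratVec (v' i)))) v' := by
  have hrow : (fun i : Fin r => ratVec (v i)) = fun i : Fin r => ratVec (v' i) :=
    funext fun i => by rw [hv i i.2]
  have hsnoc : (fun i : Fin (r + 1) => ratVec (v' i))
      = Fin.snoc (fun i : Fin r => ratVec (v i)) (ratVec (v' r)) := by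
    rw [hrow]
    funext i
    refine Fin.lastCases ?_ (fun i => ?_) i <;> simp
  have hspan : span ℚ (Set.range fun i : Fin (r + 1) => ratVec (v' i))
      = span ℚ (insert (ratVec (v' r)) (Set.range fun i : Fin r => ratVec (v i))) := by
    rw [hsnoc, Fin.range_snoc]
  have hmem : ∀ j : Fin n, (j : ℕ) < t + 1 →
      ratVec (fun k => C k j) ∈ span ℚ (Set.range fun i : Fin (r + 1) => ratVec (v' i)) := by
    intro j hj
    rw [hspan]
    rcases (Nat.lt_succ_iff.1 hj).eq_or_lt with hj | hj
    · obtain rfl : j = ⟨t, ht⟩ := Fin.ext hj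
      rw [← hv']
      exact subset_span (Set.mem_insert _ _)
    · exact span_mono (Set.subset_insert _ _) (h.mem j hj)
  by_cases hfin : Module.finrank ℚ (span ℚ (Set.range fun i : Fin (r + 1) => ratVec (v' i)))
      = r + 1
  · rw [hfin]
    refine ⟨h.le.trans (by lia), ?_, fun i hi => (hv i (hi.trans_le h.le)).trans (h.old i hi), ?_,
      hmem⟩
    · rw [hsnoc] at hfin ⊢
      exact linearIndependent_snoc_of_finrank_span_eq hfin
    · intro i hi hi'
      rcases (Nat.lt_succ_iff.1 hi).eq_or_lt with rfl | hi
      · exact ⟨_, hv'⟩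
      · rw [hv i hi]
        exact h.new i hi hi'
  · rw [hsnoc] at hfin
    obtain ⟨h1, h2⟩ := mem_span_of_finrank_span_snoc_ne h.indep hfin
    rw [hsnoc, h2]
    refine ⟨h.le, hrow ▸ h.indep, fun i hi => (hv i (hi.trans_le h.le)).trans (h.old i hi),
      fun i hi hi' => ?_, fun j hj => ?_⟩
    · rw [hv i hi]
      exact h.new i hi hi'
    · have := hmem j hj
      rw [hspan, span_insert_eq_span h1] at this
      rwa [← hrow]

end QAlg

namespace RAM

open RAM.Expr QAlg Matrix

/-- The `i`-th row of the matrix with `n` columns in bank `11`. -/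
def State.row (s : State) (n i : ℕ) (j : Fin n) : ℤ := s.bank 11 ((i : ℤ) * n + (j : ℕ))

/-- Go through the columns of the matrix in bank `5`, of the size given in the registers `4` and
`5`, and append those to the rows in bank `11` that are linearly independent of the previous ones.
The number of rows is in register `12`. -/
def extendBasis : Prog :=
  forLoop 10 (.reg 4)
    (.seq (tabulate 11 (.mul (.reg 12) (.reg 4)) (.const 1) (.reg 4) (.const 1)
      (entry 5 (.reg 4) (.reg 1) (.reg 10)))
    (.seq (tabulate 0 (.const 0) (.reg 4) (.reg 4) (.add (.reg 12) (.const 1))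
      (.mul (entry 11 (.reg 4) (.reg 2) (.reg 0)) (entry 11 (.reg 4) (.reg 2) (.reg 1))))
    (.seq faddeevLeVerrier (.assign 12 (.reg 9)))))

theorem extendBasis_runs {β n r₀ τ ν : ℕ} {s : State} (C : Matrix (Fin n) (Fin n) ℤ)
    (hs : s.Bdd β) (hn : s.reg 4 = n) (hn' : s.reg 5 = n) (hC : s.Holds 5 C)
    (hτ : ∀ i j, |C i j| ≤ 2 ^ τ) (hr₀ : s.reg 12 = r₀)
    (hindep : LinearIndependent ℚ fun i : Fin r₀ => ratVec (s.row n i))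
    (hτ₀ : ∀ i < r₀, ∀ j, |s.row n i j| ≤ 2 ^ τ) (hν : n + 1 ≤ ν)
    (hβ : ν + growth ν (ν + 2 * τ) + 2 ≤ β) :
    extendBasis.Runs β s 6 fun s' =>
      Agree {0, 1, 2, 3, 6, 7, 8, 9, 10, 12} {0, 1, 2, 3, 4, 11} s s' ∧ s'.Bdd β ∧
      ∃ r : ℕ, s'.reg 12 = r ∧ GreedyBasis C r₀ (s.row n) n r (s'.row n) := by
  have hβ3 := hs.le
  have hg := le_growth ν (ν + 2 * τ)
  have hν' : n + 1 ≤ 2 ^ ν := hν.trans Nat.lt_two_pow_self.le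
  refine Prog.Runs.forLoop (m := n) (d := 5) (fun t s' =>
    Agree {0, 1, 2, 3, 6, 7, 8, 9, 10, 12} {0, 1, 2, 3, 4, 11} s s' ∧ s'.Bdd β ∧ s'.reg 10 = t ∧
      ∃ r : ℕ, s'.reg 12 = r ∧ GreedyBasis C r₀ (s.row n) t r (s'.row n)) (by lia) hs (by lia)
    ⟨(Agree.refl _ _ s).setReg (by decide) _, hs.setReg (by simp [bits]; lia), by simp, r₀,
      by simpa using hr₀, le_rfl, hindep, fun _ _ => rfl, by lia, by simp⟩ ?_ ?_ ?_
  · rintro k hk s' ⟨a, b, h, -⟩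
    exact ⟨b, h, (a.reg 4 (by decide)).trans hn⟩
  · rintro t ht s₁ ⟨a₁, b₁, t₁, r, r₁, G₁⟩
    have n₁ : s₁.reg 4 = n := (a₁.reg 4 (by decide)).trans hn
    have hrn := G₁.le_dim
    have hcol : ∀ j : Fin n, s₁.bank 5 (((j : ℕ) : ℤ) * n + t) = C j ⟨t, ht⟩ := fun j => by
      rw [a₁.bank 5 (by decide)]
      exact hC j ⟨t, ht⟩
    -- the candidate becomes row `r`
    refine Prog.Runs.seq b₁ ((tabulate_runs (b := (r : ℤ) * n) (r := 1) (c := n) (k := 1)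
      (fun _ j _ => s₁.bank 5 ((j : ℤ) * n + t)) b₁ (by lia) (by lia) (by lia) ?_ (fun _ _ => rfl)
      ?_ (fun _ _ => rfl) ?_ ?_).weaken b₁ (by lia)) ?_
    · intro s' h
      simp only [eval, h.reg 12 (by decide), h.reg 4 (by decide), r₁, n₁]
    · intro s' h
      simp only [eval, h.reg 4 (by decide), n₁]
    · intro s' h i hi j hj l hl h0 h1 h2
      simp only [eval, eval_entry, h.reg 4 (by decide), n₁, h1, h.reg 10 (by decide), t₁,
        h.bank 5 (by decide)]
    · intro i hi j hj
      rw [Finset.sum_range_one, hcol ⟨j, hj⟩]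
      exact bits_le_of_abs_le (e := τ) (by rw [abs_abs]; exact hτ _ _) (by lia)
    rintro s₂ ⟨f₂, b₂, c₂, u₂⟩
    have hnew : s₂.row n r = fun k => C k ⟨t, ht⟩ := by
      funext j
      have := c₂ 0 (by lia) j j.2
      rw [Finset.sum_range_one, Nat.cast_zero, zero_mul, zero_add, hcol] at this
      exact this
    have hold : ∀ i < r, s₂.row n i = s₁.row n i := by
      intro i hi
      funext j
      refine u₂ _ (Or.inl ?_)
      have h1 : (i + 1) * n ≤ r * n := Nat.mul_le_mul_right _ hi
      zify at h1
      have := j.2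
      lia
    have G₂ := G₁.step ht hold hnew
    have n₂ : s₂.reg 4 = n := (f₂.reg 4 (by decide)).trans n₁
    have r₂ : s₂.reg 12 = r := (f₂.reg 12 (by decide)).trans r₁
    have hbound : ∀ i < r + 1, ∀ j, |s₂.row n i j| ≤ 2 ^ τ := by
      intro i hi j
      rcases (Nat.lt_succ_iff.1 hi).eq_or_lt with rfl | hi
      · rw [hnew]
        exact hτ _ _
      · rw [hold i hi]
        by_cases h : i < r₀
        · rw [G₁.old i h]
          exact hτ₀ i h j
        · obtain ⟨k, hk⟩ := G₁.new i hi (by lia)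
          rw [hk]
          exact hτ _ _
    set W : Matrix (Fin (r + 1)) (Fin n) ℤ := of fun i => s₂.row n i
    have hterm : ∀ (i j : Fin n) (l : Fin (r + 1)), |W l i * W l j| ≤ 2 ^ (2 * τ) := by
      intro i j l
      rw [two_mul]
      exact abs_mul_le_two_pow (hbound _ l.2 _) (hbound _ l.2 _)
    have hr' : r + 1 ≤ 2 ^ ν := by lia
    refine Prog.Runs.seq b₂ ((tabulate_matrix_runs (Wᵀ * W) (k := r + 1)
      (fun i j l => W l i * W l j) (fun i j => by rw [mul_apply]; rfl) b₂ (by lia) (by lia)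
      (by lia) ?_ ?_ ?_ ?_ (ν := ν) hr' (e := 2 * τ) hterm (by lia)).weaken b₂ (by lia)) ?_
    · intro s' h
      simp only [eval, h.reg 4 (by decide), n₂]
    · intro s' h
      simp only [eval, h.reg 4 (by decide), n₂]
    · intro s' h
      simp [eval, h.reg 12 (by decide), r₂]
    · intro s' h i j l h0 h1 h2
      simp only [eval, eval_entry, h0, h1, h2, h.reg 4 (by decide), n₂, h.bank 11 (by decide)]
      rfl
    rintro s₃ ⟨f₃, b₃, H₃⟩
    have N₃ : s₃.reg 5 = n := by
      rw [f₃.reg 5 (by decide), f₂.reg 5 (by decide), a₁.reg 5 (by decide), hn']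
    refine Prog.Runs.seq b₃ (faddeevLeVerrier_runs (Wᵀ * W) b₃ N₃ H₃ (τ := ν + 2 * τ) (ν := ν)
      (fun i j => ?_) (by lia) (by lia) ?_) ?_
    · rw [mul_apply]
      exact abs_sum_le_two_pow hr' fun l => hterm i j l
    · refine le_trans ?_ (show growth ν (ν + 2 * τ) ≤ β by lia)
      rw [growth]
      gcongr
      lia
    rintro s₄ ⟨a₄, b₄, -, -, r₄⟩
    rw [sub_natTrailingDegree_charpoly_gram] at r₄
    refine Prog.Runs.assign b₄ (by lia) ?_
    have hrow : ∀ x : ℤ, ((s₄.setReg 12 x).setReg 10 (t + 1 : ℕ)).row n = s₂.row n := by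
      intro x
      funext i j
      change s₄.bank 11 _ = s₂.bank 11 _
      rw [a₄.bank 11 (by decide), f₃.bank 11 (by decide)]
    have b₅ := b₄.setReg (x := 12) (b₄.reg 9)
    refine ⟨b₅, ?_, ?_, b₅.setReg (bits_natCast_le (by lia) hβ3), by simp,
      Module.finrank ℚ (Submodule.span ℚ (Set.range fun i => ratVec (W i))), ?_, ?_⟩
    · simp [a₄.reg 10 (by decide), f₃.reg 10 (by decide), f₂.reg 10 (by decide), t₁]
    · exact ((((a₁.trans f₂ (by decide) (by decide)).trans f₃ (by decide) (by decide)).trans a₄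
        (by decide) (by decide)).setReg (by decide) _).setReg (by decide) _
    · simpa [eval] using r₄
    · rw [hrow]
      exact G₂
  · rintro s' ⟨a, b, -, h⟩
    exact ⟨a, b, h⟩

end RAM

/-! ### Computation of the two bases -/

namespace QAlg

open Matrix

/-- A bound for the number of bits of the entries of the two linear systems. -/
def systemBits {R : Type*} [CommSemiring R] (ν τ : R) : R :=
  ν * (ν + growth ν (τ + 1)) + ν + τ + 1

/-- A bound for the number of bits of the coordinates of the basis vectors. -/
def basisBits {R : Type*} [CommSemiring R] (ν τ : R) : R := growth ν (ν + 2 * systemBits ν τ)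

/-- A bound for the number of bits of the results of the Faddeev–LeVerrier recursion for the Gram
matrices of the basis vectors. -/
def gramBits {R : Type*} [CommSemiring R] (ν τ : R) : R := growth ν (ν + 2 * basisBits ν τ)

theorem growth_mono (ν : ℕ) {τ τ' : ℕ} (h : τ ≤ τ') : growth ν τ ≤ growth ν τ' := by
  simp only [growth]
  gcongr

theorem growth_le_systemBits {ν : ℕ} (hν : 1 ≤ ν) (τ : ℕ) :
    ν + growth ν (τ + 1) ≤ ν * (ν + growth ν (τ + 1)) :=
  Nat.le_mul_of_pos_left _ hν

theorem abs_separableSystem_le {n τ ν : ℕ} {α : Fin n → Fin n → Fin n → ℤ}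
    (hτ : ∀ i j k, |α i j k| ≤ 2 ^ τ) (hν : n * n ≤ ν) (hν1 : n ≤ ν) :
    (∀ i r k c, |fittingProduct α n r k * diffMatrix α i k c|
      ≤ 2 ^ (ν * (ν + growth ν (τ + 1)) + τ + 1)) ∧
    ∀ i l, |separableSystem α i l| ≤ 2 ^ systemBits ν τ := by
  have h1 : ∀ r k, |fittingProduct α n r k| ≤ 2 ^ (ν * (ν + growth ν (τ + 1))) := fun r k =>
    (abs_fittingProduct_le hτ hν n r k).trans (pow_le_pow_right₀ (by norm_num)
      (Nat.mul_le_mul_right _ hν1))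
  refine ⟨fun i r k c => ?_, fun i l => ?_⟩
  · rw [add_assoc]
    exact abs_mul_le_two_pow (h1 _ _) (abs_diffMatrix_le hτ _ _ _)
  · refine (abs_mul_apply_le (hν.trans Nat.lt_two_pow_self.le) h1 (abs_diffMatrix_le hτ i) _
      _).trans_eq ?_
    congr 1
    rw [systemBits]
    ring

theorem abs_traceSystem_le {n τ ν : ℕ} {α : Fin n → Fin n → Fin n → ℤ}
    (hτ : ∀ i j k, |α i j k| ≤ 2 ^ τ) (hν : n * n ≤ ν) :
    (∀ i j k i' j' k', |α i j k * α i' j' k'| ≤ 2 ^ (2 * τ)) ∧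
    ∀ i j, |traceSystem α i j| ≤ 2 ^ (ν + 2 * τ) := by
  have h : ∀ i j k i' j' k', |α i j k * α i' j' k'| ≤ 2 ^ (2 * τ) := by
    intro i j k i' j' k'
    rw [two_mul]
    exact abs_mul_le_two_pow (hτ _ _ _) (hτ _ _ _)
  refine ⟨h, fun i j => ?_⟩
  exact abs_sum_le_two_pow (hν.trans Nat.lt_two_pow_self.le) fun l => h _ _ _ _ _ _

end QAlg

namespace RAM

open RAM.Expr QAlg Matrix

/-- The square of the content of register `4`. -/
def Expr.square : Expr := .mul (.reg 4) (.reg 4)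

/-- Write the matrix `separableSystem α` to bank `10`. -/
def computeSeparableSystem : Prog :=
  tabulate 10 (.const 0) (.reg 4) (.mul square square) square
    (.mul (entry 6 square (.quot (.reg 1) square) (.reg 2))
      (diffEntry (.reg 0) (.reg 2) (.sub (.reg 1) (.mul square (.quot (.reg 1) square)))))

theorem computeSeparableSystem_runs {β n τ ν : ℕ} {s : State} {α : Fin n → Fin n → Fin n → ℤ}
    (hs : s.Bdd β) (hn : s.reg 4 = n) (hα : s.HoldsConstants α) (hτ : ∀ i j k, |α i j k| ≤ 2 ^ τ)
    (hZ : s.Holds 6 (fittingProduct α n)) (hν1 : n ≤ ν) (hν2 : n * n ≤ ν)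
    (hν4 : n * n * (n * n) ≤ ν) (hβ : systemBits ν τ + 2 ≤ β) :
    computeSeparableSystem.Runs β s 4 fun s' =>
      Frame 10 s s' ∧ s'.Bdd β ∧ s'.Holds 10 (separableSystem α) := by
  have hβ' : ν + (ν * (ν + growth ν (τ + 1)) + τ + 1) + 2 ≤ β := by
    rw [systemBits] at hβ
    lia
  have r4 : ∀ {s'}, Frame 10 s s' → s'.reg 4 = n := fun h => (h.reg 4 (by decide)).trans hn
  have sq : ∀ {s'}, Frame 10 s s' → square.eval s' = ((n * n : ℕ) : ℤ) := fun h => by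
    simp [square, eval, r4 h]
  refine tabulate_matrix_runs (separableSystem α) (k := n * n)
    (fun i l k => fittingProduct α n l.divNat k * diffMatrix α i k l.modNat)
    (fun i l => by rw [separableSystem, of_apply, mul_apply]) hs (by lia) (by lia) (by lia)
    (fun s' h => r4 h) ?_ (fun s' h => sq h) ?_ (ν := ν) (hν2.trans Nat.lt_two_pow_self.le)
    (fun i l k => (abs_separableSystem_le hτ hν2 hν1).1 i _ k _) hβ'
  · intro s' h
    simp only [eval, sq h]
    push_cast
    rfl
  · intro s' h i l k h0 h1 h2
    have h3 : (Expr.sub (.reg 1) (.mul square (.quot (.reg 1) square))).eval s'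
        = ((l.modNat : ℕ) : ℤ) := by
      simp only [eval, sq h, h1, Fin.coe_modNat]
      rw [← Int.emod_def, Int.natCast_mod]
    have h4 := hZ l.divNat k
    have h5 := eval_diffEntry (r4 h) (hα.congr (h.bank 8 (by decide))) (i := .reg 0) h0
      (r := .reg 2) h2 h3
    rw [eval, h5, eval_entry]
    simp only [eval, sq h, h1, h2, h.bank 6 (by decide)]
    rw [← h4, Fin.coe_divNat, Int.natCast_div]

/-- Write the matrix `traceSystem α` to bank `14`. -/
def computeTraceSystem : Prog :=
  tabulate 14 (.const 0) (.reg 4) (.reg 4) square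
    (.mul (constant (.reg 0) (div4 (.reg 2)) (mod4 (.reg 2)))
      (constant (.reg 1) (mod4 (.reg 2)) (div4 (.reg 2))))

theorem computeTraceSystem_runs {β n τ ν : ℕ} {s : State} {α : Fin n → Fin n → Fin n → ℤ}
    (hs : s.Bdd β) (hn : s.reg 4 = n) (hα : s.HoldsConstants α) (hτ : ∀ i j k, |α i j k| ≤ 2 ^ τ)
    (hν1 : n ≤ ν) (hν2 : n * n ≤ ν) (hβ : ν + 2 * τ + 2 ≤ β) :
    computeTraceSystem.Runs β s 4 fun s' =>
      Frame 14 s s' ∧ s'.Bdd β ∧ s'.Holds 14 (traceSystem α) := by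
  have r4 : ∀ {s'}, Frame 14 s s' → s'.reg 4 = n := fun h => (h.reg 4 (by decide)).trans hn
  refine tabulate_matrix_runs (traceSystem α) (k := n * n)
    (fun i j l => α i l.divNat l.modNat * α j l.modNat l.divNat)
    (fun i l => rfl) hs (by lia) (by lia) (by lia)
    (fun s' h => r4 h) (fun s' h => r4 h) ?_ ?_ (ν := ν) (hν2.trans Nat.lt_two_pow_self.le)
    (fun i j l => (abs_traceSystem_le hτ hν2).1 _ _ _ _ _ _) hβ
  · intro s' h
    simp [square, eval, r4 h]
  · intro s' h i j l h0 h1 h2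
    have h3 := hα.congr (h.bank 8 (by decide))
    have h4 := eval_div4 (r4 h) (r := .reg 2) h2
    have h5 := eval_mod4 (r4 h) (r := .reg 2) h2
    rw [eval, eval_constant (r4 h) h3 (i := .reg 0) h0 h4 h5,
      eval_constant (r4 h) h3 (i := .reg 1) h1 h5 h4]

/-- Write a basis of the solution space of `separableSystem α`, followed by a basis of the solution
space of `traceSystem α`, to bank `11`, and the length of the first one to register `13`. -/
def computeBases : Prog :=
  .seq computeFittingProduct
  (.seq computeSeparableSystem
  (.seq (solveSystem 10 (.mul square square))
  (.seq (.assign 12 (.const 0))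
  (.seq extendBasis
  (.seq (.assign 13 (.reg 12))
  (.seq computeTraceSystem
  (.seq (solveSystem 14 (.reg 4))
  extendBasis)))))))

theorem computeBases_runs {β n τ ν : ℕ} {s : State} {α : Fin n → Fin n → Fin n → ℤ}
    (hs : s.Bdd β) (hn : s.reg 4 = n) (hα : s.HoldsConstants α) (hτ : ∀ i j k, |α i j k| ≤ 2 ^ τ)
    (hcodisj : solutions (separableSystem α) ⊔ solutions (traceSystem α) = ⊤)
    (hν1 : n + 1 ≤ ν) (hν2 : n * n ≤ ν) (hν4 : n * n * (n * n) ≤ ν)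
    (hβ : 2 * gramBits ν τ + 4 ≤ β) :
    computeBases.Runs β s 6 fun s' =>
      Agree {0, 1, 2, 3, 5, 6, 7, 8, 9, 10, 12, 13} {0, 1, 2, 3, 4, 5, 6, 7, 10, 11, 14} s s' ∧
      s'.Bdd β ∧ s'.reg 5 = n ∧ (∀ i < n, ∀ j, |s'.row n i j| ≤ 2 ^ basisBits ν τ) ∧
      (LinearIndependent ℚ fun i : Fin n => ratVec (s'.row n i)) ∧
      ∃ m : ℕ, m ≤ n ∧ s'.reg 13 = m ∧
        Submodule.span ℚ (Set.range fun i : Fin m => ratVec (s'.row n i))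
          = solutions (separableSystem α) ∧
        ∀ i < n, m ≤ i → ratVec (s'.row n i) ∈ solutions (traceSystem α) := by
  have hβ3 := hs.le
  -- inequalities between the bounds for the numbers of bits
  have hG := growth_le_systemBits (show 1 ≤ ν by lia) τ
  have hG' := le_growth ν (τ + 1)
  have hσ : systemBits ν τ = ν * (ν + growth ν (τ + 1)) + ν + τ + 1 := rfl
  have hκ := le_growth ν (ν + 2 * systemBits ν τ)
  have hκ' : growth ν (ν + 2 * systemBits ν τ) = basisBits ν τ := rfl
  have hl := le_growth ν (ν + 2 * basisBits ν τ)
  have hl' : growth ν (ν + 2 * basisBits ν τ) = gramBits ν τ := rfl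
  have hβ1 : (ν + 1) * (ν + growth ν (τ + 1)) + τ + 4 ≤ β := by
    rw [add_mul, one_mul]
    lia
  generalize hR : ({0, 1, 2, 3, 5, 6, 7, 8, 9, 10, 12, 13} : Finset ℕ) = R
  generalize hB : ({0, 1, 2, 3, 4, 5, 6, 7, 10, 11, 14} : Finset ℕ) = B
  refine Prog.Runs.seq hs (computeFittingProduct_runs hs hn hα hτ hν2 hβ1) ?_
  rintro s₁ ⟨a₁, b₁, Z₁⟩
  replace a₁ : Agree R B s s₁ := (Agree.refl R B s).trans a₁ (by rw [← hR]; decide)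
    (by rw [← hB]; decide)
  have n₁ : s₁.reg 4 = n := (a₁.reg 4 (by rw [← hR]; decide)).trans hn
  have α₁ : s₁.HoldsConstants α := hα.congr (a₁.bank 8 (by rw [← hB]; decide))
  refine Prog.Runs.seq b₁ ((computeSeparableSystem_runs b₁ n₁ α₁ hτ Z₁ (by lia) hν2 hν4
    (by lia)).weaken b₁ (by lia)) ?_
  rintro s₂ ⟨a₂, b₂, K₂⟩
  replace a₂ : Agree R B s s₂ := a₁.trans a₂ (by rw [← hR]; decide) (by rw [← hB]; decide)
  have n₂ : s₂.reg 4 = n := (a₂.reg 4 (by rw [← hR]; decide)).trans hn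
  have hK := (abs_separableSystem_le hτ hν2 (by lia)).2
  refine Prog.Runs.seq b₂ ((solveSystem_runs (separableSystem α) b₂ n₂ (by lia) K₂ ?_ hK (by lia)
    hν4 (by lia)).weaken b₂ (by lia)) ?_
  · intro s' h
    simp [square, eval, h]
  rintro s₃ ⟨a₃, b₃, N₃, C₃⟩
  replace a₃ : Agree R B s s₃ := a₂.trans a₃ (by rw [← hR]; decide) (by rw [← hB]; decide)
  set C := fittingMatrix (separableSystem α * (separableSystem α)ᵀ)
  have hgram : ∀ {M : ℕ} (K : Matrix (Fin n) (Fin M) ℤ), M ≤ ν →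
      (∀ i l, |K i l| ≤ 2 ^ systemBits ν τ) →
      ∀ i j, |fittingMatrix (K * Kᵀ) i j| ≤ 2 ^ basisBits ν τ := by
    intro M K hM hK
    refine abs_fittingMatrix_le _ (by lia) fun i j => ?_
    rw [mul_apply, two_mul]
    exact abs_sum_le_two_pow (hM.trans Nat.lt_two_pow_self.le) fun l =>
      abs_mul_le_two_pow (hK _ _) (hK _ _)
  have hC := hgram (separableSystem α) hν4 hK
  have b₄ := b₃.setReg (x := 12) (z := 0) (by simp [bits]; lia)
  refine Prog.Runs.seq b₃ (Prog.Runs.assign (Q := fun s' => s' = s₃.setReg 12 0) b₃ (by lia) rfl) ?_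
  rintro _ rfl
  have a₄ : Agree R B s (s₃.setReg 12 0) := a₃.setReg (by rw [← hR]; decide) _
  have n₄ : (s₃.setReg 12 0).reg 4 = n := (a₄.reg 4 (by rw [← hR]; decide)).trans hn
  refine Prog.Runs.seq b₄ (extendBasis_runs (r₀ := 0) C b₄ n₄ (by simpa using N₃)
    (C₃.congr rfl) hC (by simp) (linearIndependent_empty_type) (by lia) hν1 (by lia)) ?_
  rintro s₅ ⟨a₅, b₅, m, m₅, G₅⟩
  have N₅ : s₅.reg 5 = n := (a₅.reg 5 (by decide)).trans (by simpa using N₃)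
  replace a₅ : Agree R B s s₅ := a₄.trans a₅ (by rw [← hR]; decide) (by rw [← hB]; decide)
  refine Prog.Runs.seq b₅ (Prog.Runs.assign
    (Q := fun s' => s' = s₅.setReg 13 m) b₅ (by lia) (by simp [eval, m₅])) ?_
  rintro _ rfl
  have b₆ := b₅.setReg (x := 13) (z := m) (m₅ ▸ b₅.reg 12)
  have a₆ : Agree R B s (s₅.setReg 13 m) := a₅.setReg (by rw [← hR]; decide) _
  have n₆ : (s₅.setReg 13 m).reg 4 = n := (a₆.reg 4 (by rw [← hR]; decide)).trans hn
  have α₆ : (s₅.setReg 13 m).HoldsConstants α := hα.congr (a₆.bank 8 (by rw [← hB]; decide))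
  refine Prog.Runs.seq b₆ ((computeTraceSystem_runs b₆ n₆ α₆ hτ (by lia) hν2
    (by lia)).weaken b₆ (by lia)) ?_
  rintro s₇ ⟨f₇, b₇, K₇⟩
  have a₇ : Agree R B s s₇ := a₆.trans f₇ (by rw [← hR]; decide) (by rw [← hB]; decide)
  have n₇ : s₇.reg 4 = n := (a₇.reg 4 (by rw [← hR]; decide)).trans hn
  have hK' : ∀ i j, |traceSystem α i j| ≤ 2 ^ systemBits ν τ := fun i j =>
    ((abs_traceSystem_le hτ hν2).2 i j).trans (pow_le_pow_right₀ (by norm_num) (by lia))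
  refine Prog.Runs.seq b₇ ((solveSystem_runs (c := .reg 4) (ν := ν) (traceSystem α) b₇ n₇ (by lia)
    K₇ (fun _ h => h) hK'
    (by lia) (by lia) (by lia)).weaken b₇ (by lia)) ?_
  rintro s₈ ⟨f₈, b₈, N₈, C₈⟩
  have a₈ : Agree R B s s₈ := a₇.trans f₈ (by rw [← hR]; decide) (by rw [← hB]; decide)
  have n₈ : s₈.reg 4 = n := (a₈.reg 4 (by rw [← hR]; decide)).trans hn
  have hC' := hgram (traceSystem α) (by lia) hK'
  have hrow : s₈.row n = s₅.row n := by
    funext i j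
    change s₈.bank 11 _ = s₅.bank 11 _
    rw [f₈.bank 11 (by decide), f₇.bank 11 (by decide)]
    rfl
  have hm₈ : s₈.reg 12 = m := by
    rw [f₈.reg 12 (by decide), f₇.reg 12 (by decide), ← m₅]
    simp
  have hbd : ∀ i < m, ∀ j, |s₈.row n i j| ≤ 2 ^ basisBits ν τ := by
    intro i hi j
    rw [hrow]
    obtain ⟨k, hk⟩ := G₅.new i hi (Nat.zero_le _)
    rw [hk]
    exact hC _ _
  refine Prog.Runs.mono (extendBasis_runs _ b₈ n₈ N₈ C₈ hC' hm₈ (hrow ▸ G₅.indep) hbd hν1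
    (by lia)) ?_
  rintro s₉ ⟨f₉, b₉, r, -, G₉⟩
  have hspan : Submodule.span ℚ (Set.range fun i : Fin m => ratVec (s₉.row n i))
      = solutions (separableSystem α) := by
    have h1 : (fun i : Fin m => ratVec (s₉.row n i)) = fun i : Fin m => ratVec (s₅.row n i) := by
      funext i
      rw [G₉.old i i.2, hrow]
    rw [h1, ← span_col_fittingMatrix]
    refine le_antisymm (Submodule.span_le.2 ?_) (Submodule.span_le.2 ?_)
    · rintro _ ⟨i, rfl⟩
      obtain ⟨k, hk⟩ := G₅.new i i.2 (Nat.zero_le _)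
      simp only [hk]
      exact Submodule.subset_span ⟨k, rfl⟩
    · rintro _ ⟨k, rfl⟩
      exact G₅.mem k k.2
  have htop : Submodule.span ℚ (Set.range fun i : Fin r => ratVec (s₉.row n i)) = ⊤ := by
    rw [eq_top_iff, ← hcodisj, sup_le_iff]
    constructor
    · rw [← hspan]
      refine Submodule.span_mono ?_
      rintro _ ⟨i, rfl⟩
      exact ⟨⟨i, i.2.trans_le G₉.le⟩, rfl⟩
    · rw [← span_col_fittingMatrix, Submodule.span_le]
      rintro _ ⟨k, rfl⟩
      exact G₉.mem k k.2
  obtain rfl : r = n := by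
    have h1 := finrank_span_eq_card G₉.indep
    rw [htop, finrank_top, Module.finrank_fin_fun, Fintype.card_fin] at h1
    exact h1.symm
  refine ⟨a₈.trans f₉ (by rw [← hR]; decide) (by rw [← hB]; decide), b₉,
    (f₉.reg 5 (by decide)).trans N₈, fun i hi j => ?_, G₉.indep, m, G₉.le, ?_, hspan,
    fun i hi hmi => ?_⟩
  · by_cases him : i < m
    · rw [G₉.old i him]
      exact hbd i him j
    · obtain ⟨k, hk⟩ := G₉.new i hi (by lia)
      rw [hk]
      exact hC' _ _
  · rw [f₉.reg 13 (by decide), f₈.reg 13 (by decide), f₇.reg 13 (by decide)]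
    simp
  · obtain ⟨k, hk⟩ := G₉.new i hi hmi
    rw [hk, ← span_col_fittingMatrix]
    exact Submodule.subset_span ⟨k, rfl⟩

end RAM

/-! ### Writing the result -/

namespace QAlg

open Matrix

theorem map_splittingIndex {n m : ℕ} (hm : m ≤ n) :
    ((List.finRange m).map Sum.inl ++ (List.finRange (n - m)).map Sum.inr).map (splittingIndex hm)
      = List.finRange n := by
  refine List.map_injective_iff.2 Fin.val_injective ?_
  rw [List.map_append, List.map_map, List.map_map, List.map_append, List.map_map, List.map_map,
    List.map_coe_finRange_eq_range]
  conv_rhs => rw [show n = m + (n - m) by lia, List.range_add, ← List.map_coe_finRange_eq_range,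
    ← List.map_coe_finRange_eq_range, List.map_map]
  congr 1

theorem encode_splittingData {n m : ℕ} (W : Matrix (Fin n) (Fin n) ℤ) (hm : m ≤ n) :
    (splittingData W m hm).encode = (m : ℤ) :: ((n - m : ℕ) : ℤ) ::
      (((List.finRange n).flatMap fun i => (List.finRange n).flatMap fun j => encodeRat (W i j)) ++
      ((List.finRange n).flatMap fun i => (List.finRange n).flatMap fun j => encodeRat (W j i)) ++
      ((List.finRange n).flatMap fun i => (List.finRange n).flatMap fun j =>
        encodeRat ((inverseNumerator W i j : ℚ)
          / ((Wᵀ.charpoly.coeff 0 * Wᵀ.charpoly.coeff 0 : ℤ) : ℚ)))) := by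
  have key : ∀ G : Fin n → List ℤ, (List.finRange n).flatMap G
      = ((List.finRange m).map Sum.inl ++ (List.finRange (n - m)).map Sum.inr).flatMap
        fun s => G (splittingIndex hm s) := by
    intro G
    conv_lhs => rw [← map_splittingIndex hm, List.flatMap_map]
  rw [key fun i => (List.finRange n).flatMap fun j => encodeRat (W i j),
    key fun i => (List.finRange n).flatMap fun j =>
        encodeRat ((inverseNumerator W i j : ℚ)
          / ((Wᵀ.charpoly.coeff 0 * Wᵀ.charpoly.coeff 0 : ℤ) : ℚ))]
  simp only [key fun j => encodeRat (W j _)]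
  rw [List.flatMap_append, List.flatMap_map, List.flatMap_map]
  rfl

/-- The coordinate vectors of separable elements and those of nilpotent elements span the space of
all coordinate vectors. -/
theorem solutions_sup_eq_top {n : ℕ} {E : Type*} [CommRing E] [Algebra ℚ E]
    (b : Module.Basis (Fin n) ℚ E) {S N : Submodule ℚ (Fin n → ℚ)}
    (hsep : ∀ x, IsSeparableElement (b.equivFun.symm x) ↔ x ∈ S)
    (hnil : ∀ x, IsNilpotent (b.equivFun.symm x) ↔ x ∈ N) : S ⊔ N = ⊤ := by
  have := Module.Finite.of_basis b
  refine eq_top_iff.2 fun x _ => ?_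
  have h1 : b.equivFun.symm x
      ∈ Subalgebra.toSubmodule (separableSubalgebra E) ⊔ nilSubmodule E := by
    rw [(isCompl_separableSubalgebra_nilSubmodule E).sup_eq_top]
    trivial
  obtain ⟨y, hy, z, hz, hyz⟩ := Submodule.mem_sup.1 h1
  refine Submodule.mem_sup.2 ⟨b.equivFun y, (hsep _).1 ?_, b.equivFun z, (hnil _).1 ?_, ?_⟩
  · rw [LinearEquiv.symm_apply_apply]
    exact mem_separableSubalgebra.1 hy
  · rw [LinearEquiv.symm_apply_apply]
    exact mem_nilSubmodule.1 hz
  · rw [← map_add, hyz, LinearEquiv.apply_symm_apply]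

end QAlg

namespace RAM

open RAM.Expr QAlg Matrix

/-- Write the splitting data for the basis in bank `11`, with the length of the basis of the first
summand in register `13`. -/
def writeSplitting : Prog :=
  .seq (tabulate 0 (.const 0) (.reg 4) (.reg 4) (.const 1) (entry 11 (.reg 4) (.reg 1) (.reg 0)))
  (.seq faddeevLeVerrier
  (.seq (.write (.reg 13))
  (.seq (.write (.sub (.reg 4) (.reg 13)))
  (.seq (writeRats (entry 11 (.reg 4) (.reg 10) (.reg 17)) (.const 1))
  (.seq (writeRats (entry 11 (.reg 4) (.reg 17) (.reg 10)) (.const 1))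
  (writeRats (.sub (.const 0) (.mul (.reg 8) (entry 3 (.reg 4) (.reg 10) (.reg 17))))
    (.mul (.reg 8) (.reg 8))))))))

theorem writeSplitting_runs {β n m κ ν : ℕ} {s : State} (W : Matrix (Fin n) (Fin n) ℤ)
    (hm : m ≤ n) (hs : s.Bdd β) (hn : s.reg 4 = n) (hn' : s.reg 5 = n) (hm' : s.reg 13 = m)
    (hW : s.Holds 11 W) (hindep : LinearIndependent ℚ fun i => ratVec (W i))
    (hκ : ∀ i j, |W i j| ≤ 2 ^ κ) (hν : n ≤ ν) (hβ : 4 * growth ν κ + 4 ≤ β) :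
    writeSplitting.Runs β s 5 fun s' => s'.out = s.out ++ (splittingData W m hm).encode := by
  have hg := le_growth ν κ
  have hp := coeff_zero_charpoly_ne_zero hindep
  have r4 : ∀ {s'}, Frame 0 s s' → s'.reg 4 = n := fun h => (h.reg 4 (by decide)).trans hn
  refine Prog.Runs.seq hs ((tabulate_matrix_runs Wᵀ (k := 1) (fun i j _ => Wᵀ i j) (by simp) hs
    (by lia) (by lia) (by lia) (fun s' h => by exact r4 h) (fun s' h => by exact r4 h)
    (fun _ _ => rfl) ?_ (ν := 0) (by norm_num) (fun i j _ => hκ j i) (by lia)).weaken hs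
    (by lia)) ?_
  · intro s' h i j l h0 h1 h2
    have := hW j i
    simp only [eval_entry, eval, h0, h1, r4 h, h.bank 11 (by decide), this]
    rfl
  rintro s₁ ⟨f₁, b₁, H₁⟩
  refine Prog.Runs.seq b₁ (faddeevLeVerrier_runs Wᵀ b₁ ((f₁.reg 5 (by decide)).trans hn') H₁
    (fun i j => hκ j i) (hν.trans Nat.lt_two_pow_self.le) (by lia) ?_) ?_
  · refine le_trans ?_ (show growth ν κ ≤ β by lia)
    rw [growth]
    gcongr
  rw [show Wᵀ.charpoly.natTrailingDegree = 0 from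
    Nat.le_zero.1 (Polynomial.natTrailingDegree_le_of_ne_zero hp), zero_add]
  rintro s₂ ⟨f₂, b₂, S₂, p₂, -⟩
  have hpb := (abs_tailCharpoly_le_growth Wᵀ hν (fun i j => hκ j i) 0 (Nat.zero_le _)).2
  set p := Wᵀ.charpoly.coeff 0
  have n₂ : s₂.reg 4 = n := (f₂.reg 4 (by decide)).trans (r4 f₁)
  have m₂ : s₂.reg 13 = m := by rw [f₂.reg 13 (by decide), f₁.reg 13 (by decide), hm']
  have W₂ : s₂.Holds 11 W := (hW.congr (f₁.bank 11 (by decide))).congr (f₂.bank 11 (by decide))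
  have o₂ : s₂.out = s.out := by rw [f₂.out, f₁.out]
  refine Prog.Runs.seq b₂ (Prog.Runs.write (Q := fun s' => s' = s₂.append [(m : ℤ)]) b₂ (by lia)
    (by simp only [eval, m₂]; rfl)) ?_
  rintro _ rfl
  refine Prog.Runs.seq (b₂.append _) (Prog.Runs.write
    (Q := fun s' => s' = s₂.append [(m : ℤ), ((n - m : ℕ) : ℤ)]) (b₂.append _) (by lia) ?_) ?_
  · have h1 : (Expr.sub (.reg 4) (.reg 13)).eval (s₂.append [(m : ℤ)]) = ((n - m : ℕ) : ℤ) := by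
      change s₂.reg 4 - s₂.reg 13 = _
      rw [n₂, m₂, Nat.cast_sub hm]
    rw [h1]
    simp [State.append]
  rintro _ rfl
  -- the output programs change neither the matrices nor the determinant
  let Kept (s' : State) : Prop :=
    s'.reg 4 = n ∧ s'.reg 8 = p ∧ s'.Holds 11 W ∧ s'.Holds 3 (Wᵀ.tailCharpoly 1)
  have keep : ∀ {t s' : State} (w : List ℤ), Kept t →
      Agree {10, 14, 15, 16, 17} ∅ t ({ s' with out := w } : State) → Kept s' :=
    fun w hk h => ⟨(h.reg 4 (by decide)).trans hk.1, (h.reg 8 (by decide)).trans hk.2.1,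
      hk.2.2.1.congr (h.bank 11 (by decide)), hk.2.2.2.congr (h.bank 3 (by decide))⟩
  have k₂ : Kept (s₂.append [(m : ℤ), ((n - m : ℕ) : ℤ)]) := ⟨n₂, p₂, W₂, S₂⟩
  refine Prog.Runs.seq (b₂.append _) ((writeRats_runs (X := fun i j => W i j) (D := 1) (e := 0)
    (b₂.append _) n₂ (by lia) (fun s' h i j h0 h1 => ?_) (fun _ _ => rfl) (by norm_num)
    (by norm_num) (by lia)).weaken (b₂.append _) (by lia)) ?_
  · obtain ⟨h2, -, h4, -⟩ := keep _ k₂ h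
    have := h4 i j
    simp only [eval_entry, eval, h0, h1, h2, this]
  rintro s₃ ⟨b₃, a₃⟩
  have k₃ : Kept s₃ := keep (t := (s₂.append _).append _) s₃.out k₂ a₃
  refine Prog.Runs.seq b₃ ((writeRats_runs (X := fun i j => W j i) (D := 1) (e := 0)
    b₃ k₃.1 (by lia) (fun s' h i j h0 h1 => ?_) (fun _ _ => rfl) (by norm_num)
    (by norm_num) (by lia)).weaken b₃ (by lia)) ?_
  · obtain ⟨h2, -, h4, -⟩ := keep _ k₃ h
    have := h4 j i
    simp only [eval_entry, eval, h0, h1, h2, this]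
  rintro s₄ ⟨b₄, a₄⟩
  have k₄ : Kept s₄ := keep (t := s₃.append _) s₄.out k₃ a₄
  refine Prog.Runs.mono ((writeRats_runs (X := inverseNumerator W) (D := p * p)
    (e := 2 * growth ν κ) b₄ k₄.1 (by lia) (fun s' h i j h0 h1 => ?_) (fun s' h => ?_)
    (mul_self_pos.2 hp) ?_ (by lia)).weaken b₄ (by lia)) ?_
  · obtain ⟨h2, h3, -, h5⟩ := keep _ k₄ h
    have := h5 i j
    simp only [eval_entry, eval, h0, h1, h2, h3, this, inverseNumerator]
    ring
  · obtain ⟨-, h3, -, -⟩ := keep _ k₄ h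
    simp only [eval, h3]
  · rw [← abs_mul_abs_self, two_mul, pow_add]
    exact mul_le_mul hpb hpb (abs_nonneg _) (by positivity)
  · rintro s₅ ⟨-, a₅⟩
    rw [a₅.out, encode_splittingData]
    simp only [State.append, a₄.out, a₃.out, o₂, Int.cast_one, div_one, List.append_assoc,
      List.cons_append, List.nil_append]
    rfl

end RAM

/-! ### The polynomial time bound -/

namespace RAM

open QAlg

theorem abs_le_two_pow_bits (z : ℤ) : |z| ≤ 2 ^ bits z := by
  have h1 : z.natAbs < 2 ^ Nat.size z.natAbs := Nat.lt_size_self _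
  have h2 : 2 ^ Nat.size z.natAbs ≤ 2 ^ bits z := Nat.pow_le_pow_right (by lia) (Nat.le_succ _)
  rw [Int.abs_eq_natAbs]
  exact_mod_cast h1.le.trans h2

theorem bitLength_append (v w : List ℤ) : bitLength (v ++ w) = bitLength v + bitLength w := by
  simp [bitLength]

theorem bits_le_bitLength {z : ℤ} {w : List ℤ} (h : z ∈ w) : bits z ≤ bitLength w :=
  List.le_sum_of_mem (List.mem_map_of_mem h)

theorem length_le_bitLength (w : List ℤ) : w.length ≤ bitLength w := by
  induction w with
  | nil => simp
  | cons z w ih =>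
    have := one_le_bits z
    simp only [bitLength, List.map_cons, List.sum_cons, List.length_cons] at *
    lia

theorem prodDen_le (q : ℕ → ℚ) (k : ℕ) :
    prodDen q k ≤ 2 ^ bitLength (((List.range k).map q).flatMap encodeRat) := by
  induction k with
  | zero => simp [prodDen, Nat.one_le_two_pow]
  | succ k ih =>
    rw [prodDen_succ, List.range_succ, List.map_append, List.flatMap_append, bitLength_append,
      pow_add]
    refine Nat.mul_le_mul ih ?_
    have h1 := abs_le_two_pow_bits (q k).den
    rw [Nat.abs_cast] at h1
    have h2 : (q k).den ≤ 2 ^ bits (q k).den := by exact_mod_cast h1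
    refine h2.trans (Nat.pow_le_pow_right (by lia) (bits_le_bitLength ?_))
    simp [encodeRat]

end RAM

namespace QAlg

open RAM Matrix

theorem finRange_mul_flatMap {β : Type*} (m n : ℕ) (G : Fin (m * n) → List β) :
    (List.finRange (m * n)).flatMap G = (List.finRange m).flatMap fun i =>
      (List.finRange n).flatMap fun j => G (finProdFinEquiv (i, j)) := by
  have h : List.finRange (m * n) = (List.finRange m).flatMap fun i =>
      (List.finRange n).map fun j => finProdFinEquiv (i, j) := by
    rw [← List.ofFn_id, List.ofFn_mul, List.flatMap_def, ← List.ofFn_eq_map]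
    congr 2
    funext i
    rw [← List.ofFn_eq_map]
    congr 1
    funext j
    ext
    simp [finProdFinEquiv, mul_comm, add_comm]
  rw [h, List.flatMap_assoc]
  simp only [List.flatMap_map]

/-- The structure constants as a sequence, in the order of the encoding of the algebra. -/
noncomputable def constantSeq {n : ℕ} {E : Type*} [CommRing E] [Algebra ℚ E]
    (b : Module.Basis (Fin n) ℚ E) (t : ℕ) : ℚ :=
  if h : t < n * n * n then structureConstants b (Fin.divNat (m := n) (n := n) (Fin.divNat ⟨t, h⟩))
    (Fin.modNat (m := n) (n := n) (Fin.divNat ⟨t, h⟩)) (Fin.modNat ⟨t, h⟩) else 0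

section

variable {n : ℕ} {E : Type*} [CommRing E] [Algebra ℚ E] (b : Module.Basis (Fin n) ℚ E)

theorem constantSeq_apply (i j k : Fin n) :
    constantSeq b (finProdFinEquiv (finProdFinEquiv (i, j), k) : Fin (n * n * n))
      = structureConstants b i j k := by
  have h1 : ∀ {m : ℕ} (x : Fin m) (y : Fin n), (finProdFinEquiv (x, y)).divNat = x :=
    fun x y => congrArg Prod.fst (finProdFinEquiv.symm_apply_apply (x, y))
  have h2 : ∀ {m : ℕ} (x : Fin m) (y : Fin n), (finProdFinEquiv (x, y)).modNat = y :=
    fun x y => congrArg Prod.snd (finProdFinEquiv.symm_apply_apply (x, y))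
  rw [constantSeq, dif_pos (Fin.is_lt _), Fin.eta, h1, h1, h2, h2]

theorem encodeAlgebra_eq : encodeAlgebra b
    = (n : ℤ) :: ((List.range (n * n * n)).map (constantSeq b)).flatMap encodeRat := by
  rw [← List.map_coe_finRange_eq_range, List.map_map, List.flatMap_map, finRange_mul_flatMap,
    finRange_mul_flatMap]
  simp only [Function.comp_apply, constantSeq_apply]
  rfl

end

/-- A bound for all integers, in bits, and for the lengths of all loops in the computation for an
algebra with input of length `x`. -/
def totalBits {R : Type*} [CommSemiring R] (x : R) : R := 4 * gramBits (x ^ 4 + 1) (2 * x) + 4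

/-- The program that computes the decomposition of an algebra. -/
def computeSplitting : Prog := .seq readAlgebra (.seq computeBases writeSplitting)

theorem computeSplitting_runs {n : ℕ} {E : Type*} [CommRing E] [Algebra ℚ E]
    (b : Module.Basis (Fin n) ℚ E) : ∃ D : SplittingData n, D.IsCorrect b ∧
      computeSplitting.Runs (totalBits (bitLength (encodeAlgebra b)))
        (State.init (encodeAlgebra b)) 6 fun s => s.out = D.encode := by
  set L := bitLength (encodeAlgebra b) with hL
  set q := constantSeq b
  have hinp : encodeAlgebra b = (n : ℤ) :: ((List.range (n * n * n)).map q).flatMap encodeRat :=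
    encodeAlgebra_eq b
  -- the sizes of the input
  have hL' : L = bits n + bitLength (((List.range (n * n * n)).map q).flatMap encodeRat) := by
    rw [hL, hinp]
    simp [bitLength]
  have hn3 : n * n * n + 1 ≤ L := by
    have h1 := length_le_bitLength (encodeAlgebra b)
    rw [← hL, hinp, List.length_cons, List.length_flatMap] at h1
    simp only [encodeRat, List.length_cons, List.length_nil, List.map_const', List.length_map,
      List.length_range, List.sum_replicate, smul_eq_mul] at h1
    lia
  have hden : prodDen q (n * n * n) ≤ 2 ^ L :=
    (prodDen_le q _).trans (Nat.pow_le_pow_right (by lia) (by lia))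
  have hτ : ∀ i < n * n * n,
      |(q i).num * (prodDen q (n * n * n) / (q i).den : ℤ)| ≤ 2 ^ (2 * L) := by
    intro i hi
    rw [abs_mul, two_mul, pow_add]
    refine mul_le_mul ((abs_le_two_pow_bits _).trans (pow_le_pow_right₀ (by norm_num)
      (bits_le_bitLength ?_))) ?_ (abs_nonneg _) (by positivity)
    · rw [hinp]
      simp only [List.mem_cons, List.mem_flatMap, List.mem_map, List.mem_range]
      exact Or.inr ⟨_, ⟨i, hi, rfl⟩, by simp [encodeRat]⟩
    · rw [← Int.natCast_div, Nat.abs_cast]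
      exact_mod_cast (Nat.div_le_self _ _).trans hden
  have hn1 : n ≤ n * n * n := by
    rcases n.eq_zero_or_pos with rfl | h
    · simp
    · rw [mul_assoc]
      exact Nat.le_mul_of_pos_right _ (by positivity)
  have hnL : n ≤ L := by lia
  obtain ⟨ν, hν⟩ : ∃ ν, ν = L ^ 4 + 1 := ⟨_, rfl⟩
  have hLν : L ≤ L ^ 4 := Nat.le_self_pow (by norm_num) L
  have hν1 : n + 1 ≤ ν := by lia
  have hν4 : n * n * (n * n) ≤ ν := by
    have : n ^ 4 ≤ L ^ 4 := Nat.pow_le_pow_left hnL 4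
    rw [show n * n * (n * n) = n ^ 4 by ring]
    lia
  have hν2 : n * n ≤ ν := (Nat.le_mul_self _).trans hν4
  -- the bounds in bits
  obtain ⟨β, hβ⟩ : ∃ β, β = totalBits L := ⟨_, rfl⟩
  have hβ' : β = 4 * gramBits ν (2 * L) + 4 := by rw [hβ, hν, totalBits]
  have hg1 := (le_growth ν (ν + 2 * systemBits ν (2 * L))).1
  have hg2 := (le_growth ν (ν + 2 * basisBits ν (2 * L))).1
  have hg3 : growth ν (basisBits ν (2 * L)) ≤ gramBits ν (2 * L) := growth_mono ν (by lia)
  have hg4 : 2 * L ≤ systemBits ν (2 * L) := by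
    rw [systemBits]
    lia
  change ν + 2 * systemBits ν (2 * L) ≤ basisBits ν (2 * L) at hg1
  change ν + 2 * basisBits ν (2 * L) ≤ gramBits ν (2 * L) at hg2
  have hinit : (State.init (encodeAlgebra b)).Bdd β := by
    refine ⟨by lia, fun _ => by simp [State.init, bits]; lia,
      fun _ _ => by simp [State.init, bits]; lia, fun z hz => ?_⟩
    have := bits_le_bitLength hz
    change bits z ≤ L at this
    lia
  -- the integral structure constants
  set d := prodDen q (n * n * n)
  have hd : (d : ℤ) ≠ 0 := by
    exact_mod_cast Finset.prod_ne_zero_iff.2 fun i _ => (q i).den_ne_zero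
  let t (i j k : Fin n) : ℕ := (finProdFinEquiv (finProdFinEquiv (i, j), k) : Fin (n * n * n))
  have ht : ∀ i j k, t i j k < n * n * n := fun i j k => Fin.is_lt _
  let α (i j k : Fin n) : ℤ := (q (t i j k)).num * (d / (q (t i j k)).den : ℤ)
  have hα : ∀ i j k, ((d : ℤ) : ℚ) * structureConstants b i j k = α i j k := by
    intro i j k
    have h1 : (q (t i j k)).den ∣ d := Finset.dvd_prod_of_mem _ (Finset.mem_range.2 (ht i j k))
    obtain ⟨c, hc⟩ := h1
    have h2 : (d / (q (t i j k)).den : ℤ) = c := by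
      rw [hc, ← Int.natCast_div, Nat.mul_div_cancel_left _ (q (t i j k)).den_pos]
    have h3 : q (t i j k) = structureConstants b i j k := constantSeq_apply b i j k
    have h4 := Rat.mul_den_eq_num (q (t i j k))
    simp only [α]
    rw [← h3, h2, hc]
    push_cast
    rw [← h4]
    ring
  have hsep := isSeparableElement_iff_mem_solutions_of_mul b α hd hα
  have hnil := isNilpotent_iff_mem_solutions_of_mul b α hd hα
  have hατ : ∀ i j k, |α i j k| ≤ 2 ^ (2 * L) := fun i j k => hτ _ (ht i j k)
  -- the run of the program
  have hrun := readAlgebra_runs q hinit hinp (by lia) hden (by lia) hτ (by lia)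
  suffices h : computeSplitting.Runs β (State.init (encodeAlgebra b)) 6 fun s =>
      ∃ D : SplittingData n, D.IsCorrect b ∧ s.out = D.encode by
    obtain ⟨c, s, h1, h2, D, h3, h4⟩ := h
    exact ⟨D, h3, c, s, h1, hβ ▸ h2, h4⟩
  refine Prog.Runs.seq hinit (hrun.weaken hinit (by lia)) ?_
  rintro s₁ ⟨b₁, n₁, o₁, H₁⟩
  have α₁ : s₁.HoldsConstants α := by
    intro i j k
    have h1 := H₁ (finProdFinEquiv (i, j)) k
    have h2 : ((finProdFinEquiv (i, j) : Fin (n * n)) : ℕ) = i * n + j := by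
      simp [finProdFinEquiv, mul_comm, add_comm]
    have h3 : t i j k = (i * n + j) * n + k := by
      simp [t, finProdFinEquiv, mul_comm, add_comm]
    rw [Matrix.of_apply, h2, ← h3] at h1
    push_cast at h1
    exact h1
  refine Prog.Runs.seq b₁ (computeBases_runs b₁ n₁ α₁ hατ (solutions_sup_eq_top b hsep hnil) hν1 hν2
    hν4 (by lia)) ?_
  rintro s₂ ⟨a₂, b₂, N₂, hκ, hindep, m, hm, m₂, hS, hN⟩
  refine Prog.Runs.mono ((writeSplitting_runs (of fun i : Fin n => s₂.row n i) hm b₂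
    ((a₂.reg 4 (by decide)).trans n₁) N₂ m₂ (fun _ _ => rfl) hindep (fun i j => hκ i i.2 j)
    (show n ≤ ν by lia) (by lia)).weaken b₂ (by lia)) ?_
  intro s₃ h₃
  refine ⟨_, splittingData_isCorrect b hm hindep hsep hnil ?_ fun i hi => hN i i.2 hi, ?_⟩
  · rw [← hS]
    rfl
  · rw [h₃, a₂.out, o₁]
    rfl

theorem eval_totalBits (L : ℕ) :
    (totalBits (Polynomial.X : Polynomial ℕ)).eval L = totalBits L := by
  simp [totalBits, gramBits, basisBits, systemBits, growth]

end QAlg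

theorem theorem1p2 :
    ∃ (P : RAM.Prog) (p : Polynomial ℕ),
      ∀ (n : ℕ) (E : Type*) [CommRing E] [Algebra ℚ E] (b : Module.Basis (Fin n) ℚ E),
        ∃ D : QAlg.SplittingData n,
          D.IsCorrect b ∧
          P.OutputsInTime (QAlg.encodeAlgebra b) D.encode
            (p.eval (RAM.bitLength (QAlg.encodeAlgebra b))) := by
  refine ⟨QAlg.computeSplitting, Polynomial.C QAlg.computeSplitting.weight *
    QAlg.totalBits Polynomial.X ^ 6, fun n E _ _ b => ?_⟩
  obtain ⟨D, hD, c, s, hrun, hc, hout⟩ := QAlg.computeSplitting_runs b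
  refine ⟨D, hD, c, s, hrun, hout, hc.trans_eq ?_⟩
  rw [Polynomial.eval_mul, Polynomial.eval_C, Polynomial.eval_pow, QAlg.eval_totalBits]
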